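/- **Setting.** Let $f,g\in\mathbb C[z]$ with $\deg f=m\ge 2$ and $\deg g=n\ge 0$. Write $\Sigma$ for the set of critical values of $f$ and $\Sigma_\epsilon$ for that of $f+\epsilon g$. A *cycle* of $f$ is $C(t)=\sum_{j=1}^m n_jz_j(t)$, where $n_j\in\mathbb Z$, $\sum_j n_j=0$, and $z_1(t),\dots,z_m(t)$ are the distinct preimages of $t\in\mathbb C\setminus\Sigma$ under $f$, labelled over one base value and continued analytically (so $C$ is multivalued in $t$). Let $z_j(t,\epsilon)$ be the solutions of $f+\epsilon g=t$ with $z_j(t,0)=z_j(t)$, continued analytically over the pairs $(t,\epsilon)$ with $t\notin\Sigma_\epsilon$, and let $C_\epsilon(t)=\sum_{j=1}^m n_jz_j(t,\epsilon)$ (if $n>m$, the other $n-m$ roots have weight $0$). Put $$\Delta(t,\epsilon)=\sum_{j=1}^m n_jf(z_j(t,\epsilon)),\qquad M_1(t)=-\sum_{j=1}^m n_jg(z_j(t)),$$ so that $\Delta=\epsilon M_1+o(\epsilon)$; a zero of one of these multivalued functions is a zero of at least one of its branches. **Alien limit cycles.** Let $\epsilon\neq0$ be small. A cycle $C_\epsilon(t)$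 (a branch at some $t\notin\Sigma_\epsilon$, viewed as a divisor) with $\Delta(t,\epsilon)=0$ on that branch is *regular* if it belongs to a continuous family of such solutions $C_{s\epsilon}(t(s))$, $0<s\le1$, with $t(1)=t$, that tends for $s\to0$ to a cycle $C(t(0))$ with $t(0)\notin\Sigma$ and $M_1(t(0))=0$ on this branch. It is an *alien limit cycle* if $t$ is isolated among the zeros of $\Delta(\cdot,\epsilon)$ and $C_\epsilon(t)$ is not regular. **Genericity.** In $\mathbb{CP}^m$ let $\Gamma_f$ be the closure of $\{z\in\mathbb C^m: f(z_1)=\dots=f(z_m),\ z_i\ne z_j \text{ for } i\neq j\}$, let $S_g$ be the closure of $\{z\in\mathbb C^m:\sum_j n_jg(z_j)=0\}$, and let $L_\infty$ be the hyperplane at infinity. The cycle is *regular at infinity* (for $f,g$) if the number of points of $\Gamma_f\cap S_g\cap L_\infty$ is minimal among all cycles of $f$. It is *asymmetric* if no permutation of $\{1,\dots,m\}$ other than the identity sends $(n_1,\dots,n_m)$ to $\pm(n_1,\dots,n_m)$. "Generic $f,g$" means: all $(f,g)$ in an open dense subset of the space of pairs of polynomials of degrees exactly $m$ and $n$ (in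 terms of coefficients); this subset may depend on $m,n$ and the weights. In (iii), "generic $g$" is meant in the same sense, with $f$ and the weights fixed. **Theorem C.** (i) Let $m>2$ and $n<m$. For all weights $(n_j)$ and generic $f,g$: if the cycle is asymmetric and regular at infinity, then for all sufficiently small $\epsilon\ne0$ there are no alien limit cycles. (ii) Let $m>2$, $n>m$ and $m\nmid n$. For all weights $(n_j)$ and generic $f,g$: if the cycle is asymmetric and regular at infinity, then $M_1\not\equiv0$ and for all sufficiently small $\epsilon\neq0$ there exist alien limit cycles. (iii) Let $m=2$. For every $f$ of degree $2$, all weights and generic $g$ of degree $n$: if the cycle is regular at infinity, then for all sufficiently small $\epsilon\ne0$ there are no alien limit cycles. -/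

import Mathlib

open Polynomial Filter Topology
open scoped LinearAlgebra.Projectivization

namespace ZeroCycles

/-- The set of critical values of a polynomial. -/
def criticalValues (p : ℂ[X]) : Set ℂ :=
  {t | ∃ c : ℂ, p.derivative.eval c = 0 ∧ p.eval c = t}

/-- `m`-tuples of pairwise distinct preimages under `p` of one common regular value. -/
def regularTuples (p : ℂ[X]) (m : ℕ) : Set (Fin m → ℂ) :=
  {z | Function.Injective z ∧ ∃ t : ℂ, t ∉ criticalValues p ∧ ∀ j, p.eval (z j) = t}

/-- A zero-dimensional cycle `∑ⱼ nⱼ zⱼ(t)` of a polynomial `f` of degree `m`: integer weights of sum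
zero, together with a labelling of one regular fibre, which determines the germs `zⱼ(t)`.
All other branches are obtained by analytic continuation. -/
structure ZeroCycle (f : ℂ[X]) (m : ℕ) where
  /-- the weights `nⱼ` -/
  weight : Fin m → ℤ
  sum_weight : ∑ j, weight j = 0
  /-- the points `zⱼ(t₀)` over a regular value `t₀` -/
  base : Fin m → ℂ
  base_mem : base ∈ regularTuples f m

/-- The integral `∑ⱼ nⱼ p(zⱼ)` of `p` along the divisor `∑ⱼ nⱼ zⱼ`. -/
def integral {m : ℕ} (w : Fin m → ℤ) (p : ℂ[X]) (z : Fin m → ℂ) : ℂ :=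
  ∑ j, (w j : ℂ) * p.eval (z j)

/-- The divisor `∑ⱼ nⱼ zⱼ`. -/
noncomputable def divisor {m : ℕ} (w : Fin m → ℤ) (z : Fin m → ℂ) : ℂ →₀ ℤ :=
  ∑ j, Finsupp.single (z j) (w j)

/-- The deformation `f + ε g`. -/
noncomputable def deform (f g : ℂ[X]) (ε : ℂ) : ℂ[X] := f + C ε * g

/-- `z` is a branch `(zⱼ(t))` of the cycle `K` at the regular value `t` of `f`: it is obtained from
the base fibre by continuation over a path of regular values. -/
def IsBranch {f : ℂ[X]} {m : ℕ} (K : ZeroCycle f m) (t : ℂ) (z : Fin m → ℂ) : Prop :=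
  JoinedIn (regularTuples f m) K.base z ∧ ∀ j, f.eval (z j) = t

/-- The pairs `(z, ε)` with `z` an `m`-tuple of distinct preimages under `f + ε g` of one value that
is regular for `f + ε g`. -/
def deformedTuples (f g : ℂ[X]) (m : ℕ) : Set ((Fin m → ℂ) × ℂ) :=
  {q | q.1 ∈ regularTuples (deform f g q.2) m}

/-- `z` is a branch `(zⱼ(t, ε))` of the deformed cycle at `(t, ε)`: it is obtained from the base
fibre (at `ε = 0`) by continuation over a path of pairs `(t', ε')` with `t'` a regular value of
`f + ε' g`. -/
def IsDeformedBranch {f : ℂ[X]} (g : ℂ[X]) {m : ℕ} (K : ZeroCycle f m) (ε t : ℂ)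
    (z : Fin m → ℂ) : Prop :=
  JoinedIn (deformedTuples f g m) (K.base, 0) (z, ε) ∧ ∀ j, (deform f g ε).eval (z j) = t

/-- The branch `z` of the cycle at the regular value `t` solves the tangential problem `M₁(t) = 0`,
where `M₁(t) = -∑ⱼ nⱼ g(zⱼ(t))`. -/
def IsTangentialSolution {f : ℂ[X]} (g : ℂ[X]) {m : ℕ} (K : ZeroCycle f m) (t : ℂ)
    (z : Fin m → ℂ) : Prop :=
  IsBranch K t z ∧ -integral K.weight g z = 0

/-- The branch `z` of the deformed cycle at `(t, ε)` solves the infinitesimal problem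
`Δ(t, ε) = 0`, where `Δ(t, ε) = ∑ⱼ nⱼ f(zⱼ(t, ε))`. -/
def IsInfinitesimalSolution {f : ℂ[X]} (g : ℂ[X]) {m : ℕ} (K : ZeroCycle f m) (ε t : ℂ)
    (z : Fin m → ℂ) : Prop :=
  IsDeformedBranch g K ε t z ∧ integral K.weight f z = 0

/-- The zeros `t` of (at least one branch of) `Δ(·, ε)`. -/
def displacementZeros {f : ℂ[X]} (g : ℂ[X]) {m : ℕ} (K : ZeroCycle f m) (ε : ℂ) : Set ℂ :=
  {t | ∃ z, IsInfinitesimalSolution g K ε t z}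

/-- The cycle `∑ⱼ nⱼ zⱼ` at `(t, ε)` belongs to a family of solutions of the infinitesimal problem,
with parameter `s ε`, `0 < s ≤ 1`, that tends for `s → 0` to a solution of the tangential problem
over a regular value of `f`. -/
def IsRegularCycle {f : ℂ[X]} (g : ℂ[X]) {m : ℕ} (K : ZeroCycle f m) (ε t : ℂ)
    (z : Fin m → ℂ) : Prop :=
  ∃ (τ : ℝ → ℂ) (Z : ℝ → Fin m → ℂ),
    ContinuousOn τ (Set.Icc 0 1) ∧ ContinuousOn Z (Set.Icc 0 1) ∧
    (∀ s ∈ Set.Ioc (0 : ℝ) 1, IsInfinitesimalSolution g K ((s : ℂ) * ε) (τ s) (Z s)) ∧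
    IsTangentialSolution g K (τ 0) (Z 0) ∧
    τ 1 = t ∧ divisor K.weight (Z 1) = divisor K.weight z

/-- An alien limit cycle: a solution of the infinitesimal problem, with `t` isolated among the zeros
of `Δ(·, ε)`, that is not regular. -/
def IsAlien {f : ℂ[X]} (g : ℂ[X]) {m : ℕ} (K : ZeroCycle f m) (ε t : ℂ)
    (z : Fin m → ℂ) : Prop :=
  IsInfinitesimalSolution g K ε t z ∧ ¬ AccPt t (𝓟 (displacementZeros g K ε)) ∧
    ¬ IsRegularCycle g K ε t z

/-- There are no alien limit cycles for small `ε ≠ 0`. -/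
def NoAlienCycles {f : ℂ[X]} (g : ℂ[X]) {m : ℕ} (K : ZeroCycle f m) : Prop :=
  ∀ᶠ ε in 𝓝[≠] (0 : ℂ), ∀ t z, ¬ IsAlien g K ε t z

/-- `M₁` does not vanish identically, and there are alien limit cycles for all small `ε ≠ 0`. -/
def HasAlienCycles {f : ℂ[X]} (g : ℂ[X]) {m : ℕ} (K : ZeroCycle f m) : Prop :=
  (∃ t z, IsBranch K t z ∧ ¬ IsTangentialSolution g K t z) ∧
    ∀ᶠ ε in 𝓝[≠] (0 : ℂ), ∃ t z, IsAlien g K ε t z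

/-- The closure in the projective space `ℂPᵐ` of a subset of the affine chart `ℂᵐ`, with homogeneous
coordinates `(z₁ : ⋯ : zₘ : z_{m+1})` and the chart `z_{m+1} = 1`. -/
def projectiveClosure {m : ℕ} (A : Set (Fin m → ℂ)) : Set (ℙ ℂ ((Fin m → ℂ) × ℂ)) :=
  {P | P.rep ∈ closure {v : (Fin m → ℂ) × ℂ | ∃ a ∈ A, ∃ l : ℂ, l ≠ 0 ∧ v = (l • a, l)}}

/-- The hyperplane at infinity `z_{m+1} = 0`. -/
def hyperplaneAtInfinity (m : ℕ) : Set (ℙ ℂ ((Fin m → ℂ) × ℂ)) :=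
  {P | P.rep.2 = 0}

/-- The connection curve: the closure of the set of the tuples of pairwise distinct points on which
`p` takes the same value. -/
def connectionCurve (p : ℂ[X]) (m : ℕ) : Set (ℙ ℂ ((Fin m → ℂ) × ℂ)) :=
  projectiveClosure {z | Function.Injective z ∧ ∀ i j, p.eval (z i) = p.eval (z j)}

/-- The zero hypersurface: the closure of `{z | ∑ⱼ nⱼ q(zⱼ) = 0}`. -/
def zeroHypersurface {m : ℕ} (w : Fin m → ℤ) (q : ℂ[X]) : Set (ℙ ℂ ((Fin m → ℂ) × ℂ)) :=
  projectiveClosure {z | integral w q z = 0}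

/-- The cycle with weights `w` is regular at infinity: the number of common points at infinity of
the connection curve and the zero hypersurface is minimal among all cycles. -/
def RegularAtInfinity {m : ℕ} (p q : ℂ[X]) (w : Fin m → ℤ) : Prop :=
  ∀ w' : Fin m → ℤ, ∑ j, w' j = 0 →
    (connectionCurve p m ∩ zeroHypersurface w q ∩ hyperplaneAtInfinity m).encard ≤
      (connectionCurve p m ∩ zeroHypersurface w' q ∩ hyperplaneAtInfinity m).encard

/-- The cycle with weights `w` is asymmetric: only the identity permutation preserves the weights up
to a global sign. -/
def Asymmetric {m : ℕ} (w : Fin m → ℤ) : Prop :=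
  ∀ h : Equiv.Perm (Fin m), (w ∘ h = w ∨ w ∘ h = -w) → h = 1

/-- The space of polynomials of degree exactly `d`, through their coefficient vectors, with the
topology of `ℂ^{d+1}`. -/
abbrev PolySpace (d : ℕ) : Type := {a : Fin (d + 1) → ℂ // a (Fin.last d) ≠ 0}

/-- The polynomial with the given coefficients. -/
noncomputable def PolySpace.poly {d : ℕ} (a : PolySpace d) : ℂ[X] :=
  ∑ i, C (a.1 i) * X ^ (i : ℕ)

/-- A property holds for generic points: on an open dense set. -/
def Generic {E : Type*} [TopologicalSpace E] (P : E → Prop) : Prop :=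
  ∃ U : Set E, IsOpen U ∧ Dense U ∧ ∀ x ∈ U, P x

end ZeroCycles

open Polynomial Filter Topology
open scoped LinearAlgebra.Projectivization

namespace ZeroCycles

/-! ### Compactness along ultrafilters -/

lemma eventually_of_forall_ultrafilter {α : Type*} {l : Filter α} {Q : α → Prop}
    (h : ∀ U : Ultrafilter α, ↑U ≤ l → (∀ᶠ y in (U : Filter α), ¬ Q y) → False) :
    ∀ᶠ y in l, Q y := by
  rw [Filter.Eventually, mem_iff_ultrafilter]
  intro U hU
  by_contra hc
  exact h U hU (Ultrafilter.eventually_not.2 hc)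

lemma exists_tendsto_of_bounded {α E : Type*} [PseudoMetricSpace E] [ProperSpace E]
    (U : Ultrafilter α) (Z : α → E) (K : Set E) (hK : Bornology.IsBounded K)
    (h : ∀ᶠ y in (U : Filter α), Z y ∈ K) : ∃ z, Tendsto Z U (𝓝 z) := by
  have hc : IsCompact (closure K) := hK.isCompact_closure
  obtain ⟨z, -, hz⟩ := hc.ultrafilter_le_nhds (U.map Z) (by
    rw [le_principal_iff]
    exact mem_of_superset h (fun y hy => subset_closure hy))
  exact ⟨z, hz⟩

lemma exists_tendsto_of_norm_le {α E : Type*} [SeminormedAddCommGroup E] [ProperSpace E]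
    (U : Ultrafilter α) (Z : α → E) (R : ℝ) (h : ∀ᶠ y in (U : Filter α), ‖Z y‖ ≤ R) :
    ∃ z, Tendsto Z U (𝓝 z) :=
  exists_tendsto_of_bounded U Z (Metric.closedBall 0 R) Metric.isBounded_closedBall
    (h.mono fun y hy => by simpa using hy)

/-- Used to freeze combinatorial data, such as indices and embeddings, in arguments by compactness.
-/
lemma eventually_eq_of_finite {α β : Type*} [Finite β] (U : Ultrafilter α) (Z : α → β) :
    ∃ b, ∀ᶠ y in (U : Filter α), Z y = b := by
  by_contra hc
  push Not at hc
  have h2 : ∀ b, ∀ᶠ y in (U : Filter α), ¬ Z y = b := hc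
  rw [← eventually_all] at h2
  obtain ⟨y, hy⟩ := h2.exists
  exact hy _ rfl

/-! ### Root tuples -/

/-- `Z` is an enumeration, with multiplicities, of the fibre of `p` over `t`, where `a` is the
leading coefficient of `p`. -/
def RootTuple (p : ℂ[X]) (a t : ℂ) {N : ℕ} (Z : Fin N → ℂ) : Prop :=
  ∀ x, p.eval x - t = a * ∏ i, (x - Z i)

lemma exists_map_univ_eq {α : Type*} {N : ℕ} (s : Multiset α) (hs : s.card = N) :
    ∃ Z : Fin N → α, Multiset.map Z Finset.univ.val = s := by
  subst hs
  refine ⟨fun i => s.toList.get (i.cast (by simp)), ?_⟩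
  have : (Finset.univ : Finset (Fin s.card)).val = (List.finRange s.card : Multiset _) := rfl
  rw [this, Multiset.map_coe]
  conv_rhs => rw [← Multiset.coe_toList s]
  congr 1
  apply List.ext_get <;> simp

lemma exists_perm_of_map_univ_eq {α : Type*} {N : ℕ} (Z Z' : Fin N → α)
    (h : Multiset.map Z Finset.univ.val = Multiset.map Z' Finset.univ.val) :
    ∃ ρ : Equiv.Perm (Fin N), Z' = Z ∘ ρ := by
  classical
  have hc : ∀ c, Nonempty ({a // Z' a = c} ≃ {b // Z b = c}) := by
    intro c
    rw [← Fintype.card_eq]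
    have := congrArg (Multiset.count c) h
    rw [Multiset.count_map, Multiset.count_map] at this
    rw [Fintype.card_subtype, Fintype.card_subtype, Finset.card_def, Finset.card_def,
      Finset.filter_val, Finset.filter_val]
    simp_rw [eq_comm (a := c)] at this
    exact this.symm
  refine ⟨Equiv.ofFiberEquiv (fun c => (hc c).some), funext fun i => ?_⟩
  exact (Equiv.ofFiberEquiv_map _ i).symm

lemma exists_perm_of_prod_eq {N : ℕ} (Z Z' : Fin N → ℂ)
    (h : ∀ x, ∏ i, (x - Z i) = ∏ i, (x - Z' i)) : ∃ ρ : Equiv.Perm (Fin N), Z' = Z ∘ ρ := by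
  apply exists_perm_of_map_univ_eq
  have h1 : ∏ i, (X - C (Z i)) = ∏ i, (X - C (Z' i)) := by
    apply Polynomial.funext
    intro x
    simpa [eval_prod] using h x
  have h2 : ∀ W : Fin N → ℂ, (∏ i, (X - C (W i))).roots = Multiset.map W Finset.univ.val := by
    intro W
    have : ∏ i, (X - C (W i)) = (Multiset.map (fun a => X - C a)
        (Multiset.map W Finset.univ.val)).prod := by
      rw [Multiset.map_map]; rfl
    rw [this, roots_multiset_prod_X_sub_C]
  rw [← h2, ← h2, h1]

namespace RootTuple

variable {p : ℂ[X]} {a t : ℂ} {N : ℕ} {Z Z' : Fin N → ℂ}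

lemma eq_poly (h : RootTuple p a t Z) : p - C t = C a * ∏ i, (X - C (Z i)) := by
  apply Polynomial.funext
  intro x
  simpa [eval_prod] using h x

lemma eval_root (h : RootTuple p a t Z) (i : Fin N) : p.eval (Z i) = t := by
  have := h (Z i)
  rw [Finset.prod_eq_zero (Finset.mem_univ i) (sub_self _), mul_zero] at this
  exact sub_eq_zero.1 this

lemma exists_index (h : RootTuple p a t Z) (ha : a ≠ 0) {x : ℂ} (hx : p.eval x = t) :
    ∃ i, Z i = x := by
  have := h x
  rw [hx, sub_self] at this
  obtain ⟨i, -, hi⟩ := Finset.prod_eq_zero_iff.1 ((mul_eq_zero.1 this.symm).resolve_left ha)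
  exact ⟨i, (sub_eq_zero.1 hi).symm⟩

lemma exists_perm (h : RootTuple p a t Z) (ha : a ≠ 0) (h' : RootTuple p a t Z') :
    ∃ ρ : Equiv.Perm (Fin N), Z' = Z ∘ ρ :=
  exists_perm_of_prod_eq Z Z' fun x => mul_left_cancel₀ ha ((h x).symm.trans (h' x))

lemma comp_perm (h : RootTuple p a t Z) (ρ : Equiv.Perm (Fin N)) : RootTuple p a t (Z ∘ ρ) := by
  intro x
  rw [h x, ← Equiv.prod_comp ρ (fun i => x - Z i)]
  rfl

lemma eval_derivative (h : RootTuple p a t Z) (i : Fin N) :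
    p.derivative.eval (Z i) = a * ∏ j ∈ Finset.univ.erase i, (Z i - Z j) := by
  have h1 : p.derivative = C a * derivative (∏ i, (X - C (Z i))) := by
    have := congrArg derivative h.eq_poly
    simpa using this
  rw [h1, ← Finset.mul_prod_erase _ _ (Finset.mem_univ i)]
  simp [eval_prod]

/-- By `eval_derivative` the derivative at an entry is, up to `a`, the product of its differences to
the other entries, so repeated entries are exactly the critical points in the fibre. -/
lemma injective_iff (h : RootTuple p a t Z) (ha : a ≠ 0) :
    Function.Injective Z ↔ t ∉ criticalValues p := by
  constructor
  · rintro hi ⟨c, hc, hct⟩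
    obtain ⟨i, rfl⟩ := h.exists_index ha hct
    rw [h.eval_derivative] at hc
    obtain ⟨j, hj, hz⟩ := Finset.prod_eq_zero_iff.1 ((mul_eq_zero.1 hc).resolve_left ha)
    exact (Finset.mem_erase.1 hj).1 (hi (sub_eq_zero.1 hz)).symm
  · intro ht i j hij
    by_contra hne
    apply ht
    refine ⟨Z i, ?_, h.eval_root i⟩
    rw [h.eval_derivative, Finset.prod_eq_zero (Finset.mem_erase.2 ⟨Ne.symm hne, Finset.mem_univ j⟩)
      (sub_eq_zero.2 hij), mul_zero]

lemma derivative_ne_zero (h : RootTuple p a t Z) (ha : a ≠ 0) (hZ : Function.Injective Z)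
    (i : Fin N) : p.derivative.eval (Z i) ≠ 0 := fun h0 =>
  (h.injective_iff ha).1 hZ ⟨Z i, h0, h.eval_root i⟩

lemma mem_regularTuples (h : RootTuple p a t Z) (ha : a ≠ 0) (hZ : Function.Injective Z) :
    Z ∈ regularTuples p N :=
  ⟨hZ, t, (h.injective_iff ha).1 hZ, h.eval_root⟩

lemma of_tendsto {α : Type*} {l : Filter α} [l.NeBot] {P : α → ℂ[X]} {A T : α → ℂ}
    {W : α → Fin N → ℂ} (hP : ∀ x, Tendsto (fun y => (P y).eval x) l (𝓝 (p.eval x)))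
    (hA : Tendsto A l (𝓝 a)) (hT : Tendsto T l (𝓝 t)) (hW : Tendsto W l (𝓝 Z))
    (h : ∀ᶠ y in l, RootTuple (P y) (A y) (T y) (W y)) : RootTuple p a t Z := by
  intro x
  have h1 : Tendsto (fun y => (P y).eval x - T y) l (𝓝 (p.eval x - t)) := (hP x).sub hT
  have h2 : Tendsto (fun y => A y * ∏ i, (x - W y i)) l (𝓝 (a * ∏ i, (x - Z i))) :=
    hA.mul (tendsto_finsetProd _ fun i _ => tendsto_const_nhds.sub ((tendsto_pi_nhds.1 hW) i))
  refine tendsto_nhds_unique (h1.congr' ?_) h2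
  filter_upwards [h] with y hy using hy x

end RootTuple

lemma exists_rootTuple {p : ℂ[X]} {N : ℕ} (hp : p.natDegree = N) (hN : 0 < N) (t : ℂ) :
    ∃ Z : Fin N → ℂ, RootTuple p p.leadingCoeff t Z := by
  have hd : (p - C t).natDegree = N := by rw [natDegree_sub_C, hp]
  have hl : (p - C t).leadingCoeff = p.leadingCoeff := by
    rw [leadingCoeff, hd, coeff_sub, coeff_C_of_ne_zero hN.ne', sub_zero, leadingCoeff, hp]
  have hs := IsAlgClosed.splits (p - C t)
  obtain ⟨Z, hZ⟩ := exists_map_univ_eq (p - C t).roots (hs.natDegree_eq_card_roots.symm.trans hd)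
  refine ⟨Z, fun x => ?_⟩
  have := hs.eval_eq_prod_roots x
  rw [← hZ, Multiset.map_map, hl, eval_sub, eval_C] at this
  exact this

/-- As many distinct points as the degree exhaust a fibre. -/
lemma rootTuple_of_injective {p : ℂ[X]} {N : ℕ} (hp : p.natDegree = N) (hN : 0 < N) {t : ℂ}
    {Z : Fin N → ℂ} (hi : Function.Injective Z) (hZ : ∀ i, p.eval (Z i) = t) :
    RootTuple p p.leadingCoeff t Z := by
  obtain ⟨W, hW⟩ := exists_rootTuple hp hN t
  have ha : p.leadingCoeff ≠ 0 := by
    rw [Ne, leadingCoeff_eq_zero]; rintro rfl; simp at hp; omega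
  choose ρ hρ using fun i => hW.exists_index ha (hZ i)
  have hρi : Function.Injective ρ := fun i j hij => hi (by rw [← hρ i, ← hρ j, hij])
  have : Z = W ∘ (Equiv.ofBijective ρ (Finite.injective_iff_bijective.1 hρi)) := by
    funext i; simp [hρ]
  rw [this]
  exact hW.comp_perm _

lemma rootTuple_of_mem_regularTuples {p : ℂ[X]} {N : ℕ} (hp : p.natDegree = N) (hN : 0 < N)
    {Z : Fin N → ℂ} (hZ : Z ∈ regularTuples p N) :
    ∃ t, RootTuple p p.leadingCoeff t Z ∧ t ∉ criticalValues p := by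
  obtain ⟨hi, t, ht, hZt⟩ := hZ
  exact ⟨t, rootTuple_of_injective hp hN hi hZt, ht⟩

lemma mem_regularTuples_iff {p : ℂ[X]} {N : ℕ} (hp : p.natDegree = N) (hN : 0 < N)
    {Z : Fin N → ℂ} : Z ∈ regularTuples p N ↔ Function.Injective Z ∧ ∃ t, ∀ i, p.eval (Z i) = t := by
  constructor
  · rintro ⟨h, t, -, h2⟩; exact ⟨h, t, h2⟩
  · rintro ⟨h, t, h2⟩
    refine (rootTuple_of_injective hp hN h h2).mem_regularTuples ?_ h
    rw [Ne, leadingCoeff_eq_zero]; rintro rfl; simp at hp; omega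

/-! ### Convergence of polynomials -/

/-- Coefficientwise convergence of polynomials of bounded degree. -/
structure PolyTendsto {α : Type*} (P : α → ℂ[X]) (l : Filter α) (p : ℂ[X]) (N : ℕ) : Prop where
  coeff : ∀ i, Tendsto (fun y => (P y).coeff i) l (𝓝 (p.coeff i))
  deg : ∀ᶠ y in l, (P y).natDegree ≤ N
  deg_lim : p.natDegree ≤ N

namespace PolyTendsto

variable {α : Type*} {P : α → ℂ[X]} {l : Filter α} {p : ℂ[X]} {N : ℕ}

lemma eval (h : PolyTendsto P l p N) {x : α → ℂ} {x₀ : ℂ} (hx : Tendsto x l (𝓝 x₀)) :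
    Tendsto (fun y => (P y).eval (x y)) l (𝓝 (p.eval x₀)) := by
  rw [eval_eq_sum_range' (Nat.lt_succ_of_le h.deg_lim)]
  have : Tendsto (fun y => ∑ i ∈ Finset.range N.succ, (P y).coeff i * x y ^ i) l
      (𝓝 (∑ i ∈ Finset.range N.succ, p.coeff i * x₀ ^ i)) :=
    tendsto_finsetSum _ fun i _ => (h.coeff i).mul (hx.pow i)
  refine this.congr' ?_
  filter_upwards [h.deg] with y hy
  rw [eval_eq_sum_range' (Nat.lt_succ_of_le hy)]

lemma eval_const (h : PolyTendsto P l p N) (x : ℂ) :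
    Tendsto (fun y => (P y).eval x) l (𝓝 (p.eval x)) := h.eval tendsto_const_nhds

lemma mono {l' : Filter α} (h : PolyTendsto P l p N) (hl : l' ≤ l) : PolyTendsto P l' p N :=
  ⟨fun i => (h.coeff i).mono_left hl, h.deg.filter_mono hl, h.deg_lim⟩

end PolyTendsto

/-! ### Bounds and limits of roots. -/

/-- Cauchy's bound: for `‖x‖ > 1` the lower terms add up to at most `M ‖x‖^(N-1)`, and the leading
term is at least `δ ‖x‖^N`. -/
lemma norm_le_of_eval_eq {p : ℂ[X]} {N : ℕ} (hp : p.natDegree ≤ N) (hN : 0 < N) {x t : ℂ} {M δ : ℝ}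
    (hδ : 0 < δ) (hδp : δ ≤ ‖p.coeff N‖)
    (hM : ∑ i ∈ Finset.range N, ‖p.coeff i‖ + ‖t‖ ≤ M) (hx : p.eval x = t) :
    ‖x‖ ≤ max 1 (M / δ) := by
  by_contra! hc
  obtain ⟨h1, h2⟩ := max_lt_iff.1 hc
  rw [eval_eq_sum_range' (Nat.lt_succ_of_le hp), Finset.sum_range_succ] at hx
  have h3 : p.coeff N * x ^ N = t - ∑ i ∈ Finset.range N, p.coeff i * x ^ i := by
    rw [← hx]; ring
  have hpow : ∀ i ≤ N - 1, ‖x‖ ^ i ≤ ‖x‖ ^ (N - 1) := fun i hi => pow_le_pow_right₀ h1.le hi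
  have h4 : ‖p.coeff N * x ^ N‖ ≤ M * ‖x‖ ^ (N - 1) := by
    rw [h3]
    calc _ ≤ ‖t‖ + ∑ i ∈ Finset.range N, ‖p.coeff i * x ^ i‖ :=
          (norm_sub_le _ _).trans (by gcongr; exact norm_sum_le _ _)
      _ ≤ ‖t‖ * ‖x‖ ^ (N - 1) + ∑ i ∈ Finset.range N, ‖p.coeff i‖ * ‖x‖ ^ (N - 1) := by
          gcongr with i hi
          · exact le_mul_of_one_le_right (norm_nonneg _) (one_le_pow₀ h1.le)
          · rw [norm_mul, norm_pow]
            gcongr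
            · exact h1.le
            · have := Finset.mem_range.1 hi; omega
      _ = (∑ i ∈ Finset.range N, ‖p.coeff i‖ + ‖t‖) * ‖x‖ ^ (N - 1) := by
          rw [← Finset.sum_mul]; ring
      _ ≤ _ := by gcongr
  rw [norm_mul, norm_pow] at h4
  have h5 : ‖x‖ ^ N = ‖x‖ * ‖x‖ ^ (N - 1) := by rw [← pow_succ']; congr 1; omega
  rw [h5, ← mul_assoc] at h4
  have h6 : ‖p.coeff N‖ * ‖x‖ ≤ M := le_of_mul_le_mul_right h4 (by positivity)
  have : δ * ‖x‖ ≤ M := le_trans (by gcongr) h6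
  rw [div_lt_iff₀ hδ] at h2
  linarith

lemma PolyTendsto.exists_bound {α : Type*} {P : α → ℂ[X]} {l : Filter α} {p : ℂ[X]} {N : ℕ}
    (h : PolyTendsto P l p N) (hN : 0 < N) (hp : p.coeff N ≠ 0) (B : ℝ) :
    ∃ R, ∀ᶠ y in l, ∀ x t, ‖t‖ ≤ B → (P y).eval x = t → ‖x‖ ≤ R := by
  have h1 : ∀ᶠ y in l, ‖p.coeff N‖ / 2 < ‖(P y).coeff N‖ :=
    (h.coeff N).norm.eventually (lt_mem_nhds (half_lt_self (norm_pos_iff.2 hp)))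
  have h2 : Tendsto (fun y => ∑ i ∈ Finset.range N, ‖(P y).coeff i‖) l
      (𝓝 (∑ i ∈ Finset.range N, ‖p.coeff i‖)) := tendsto_finsetSum _ fun i _ => (h.coeff i).norm
  have h3 := h2.eventually (gt_mem_nhds (lt_add_one _))
  refine ⟨max 1 ((∑ i ∈ Finset.range N, ‖p.coeff i‖ + 1 + B) / (‖p.coeff N‖ / 2)), ?_⟩
  filter_upwards [h1, h3, h.deg] with y hy1 hy3 hyd x t ht hx
  exact norm_le_of_eval_eq hyd hN (half_pos (norm_pos_iff.2 hp)) hy1.le (by linarith) hx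

/-- Limits of rescaled root tuples are root tuples of the leading form. -/
lemma RootTuple.of_tendsto_scaled {α : Type*} {l : Filter α} [l.NeBot] {P : α → ℂ[X]} {p : ℂ[X]}
    {N : ℕ} (h : PolyTendsto P l p N) {A T lam : α → ℂ} {a : ℂ} {W : α → Fin N → ℂ}
    {v : Fin N → ℂ} (hA : Tendsto A l (𝓝 a)) (hAc : ∀ᶠ y in l, (P y).coeff N = A y)
    (hl0 : ∀ᶠ y in l, lam y ≠ 0) (hl : Tendsto lam l (𝓝 0))
    (hW : Tendsto (fun y => lam y • W y) l (𝓝 v))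
    (hR : ∀ᶠ y in l, RootTuple (P y) (A y) (T y) (W y)) :
    ∃ T₀, Tendsto (fun y => lam y ^ N * T y) l (𝓝 T₀) ∧ RootTuple (C a * X ^ N) a T₀ v := by
  have hpa : p.coeff N = a := tendsto_nhds_unique ((h.coeff N).congr' hAc) hA
  -- After rescaling, the term of degree `i` carries the factor `lam ^ (N - i)`, so only the leading
  -- term survives.
  have hE : ∀ x : ℂ, Tendsto (fun y => lam y ^ N * (P y).eval (x / lam y)) l (𝓝 (a * x ^ N)) := by
    intro x
    have h1 : Tendsto (fun y => ∑ i ∈ Finset.range (N + 1),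
        (P y).coeff i * x ^ i * lam y ^ (N - i)) l
        (𝓝 (∑ i ∈ Finset.range (N + 1), p.coeff i * x ^ i * 0 ^ (N - i))) :=
      tendsto_finsetSum _ fun i _ => ((h.coeff i).mul_const _).mul (hl.pow _)
    rw [Finset.sum_range_succ, Finset.sum_eq_zero, zero_add, hpa, Nat.sub_self, pow_zero,
      mul_one] at h1
    · refine h1.congr' ?_
      filter_upwards [h.deg, hl0] with y hy hy0
      rw [eval_eq_sum_range' (Nat.lt_succ_of_le hy), Finset.mul_sum]
      refine Finset.sum_congr rfl fun i hi => ?_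
      have hi' : i ≤ N := Nat.lt_succ_iff.1 (Finset.mem_range.1 hi)
      have : lam y ^ N = lam y ^ i * lam y ^ (N - i) := by rw [← pow_add]; congr 1; omega
      rw [this, div_pow]
      field_simp
    · intro i hi
      rw [zero_pow (by have := Finset.mem_range.1 hi; omega), mul_zero]
  have hprod : ∀ x : ℂ, Tendsto (fun y => A y * ∏ i, (x - lam y * W y i)) l
      (𝓝 (a * ∏ i, (x - v i))) := fun x =>
    hA.mul (tendsto_finsetProd _ fun i _ => tendsto_const_nhds.sub
      (by simpa using (tendsto_pi_nhds.1 hW) i))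
  have hid : ∀ x : ℂ, ∀ᶠ y in l, lam y ^ N * (P y).eval (x / lam y) -
      A y * ∏ i, (x - lam y * W y i) = lam y ^ N * T y := by
    intro x
    filter_upwards [hR, hl0] with y hy hy0
    have h2 := hy (x / lam y)
    have h3 : ∏ i, (x - lam y * W y i) = lam y ^ N * ∏ i, (x / lam y - W y i) := by
      have : lam y ^ N = ∏ _i : Fin N, lam y := by simp
      rw [this, ← Finset.prod_mul_distrib]
      refine Finset.prod_congr rfl fun i _ => ?_
      field_simp
    rw [h3]
    linear_combination lam y ^ N * h2
  -- The sequence does not involve `x`, so its limit is the same for all `x`; that is the root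
  -- identity for `v`.
  have hT : ∀ x : ℂ, Tendsto (fun y => lam y ^ N * T y) l (𝓝 (a * x ^ N - a * ∏ i, (x - v i))) :=
    fun x => ((hE x).sub (hprod x)).congr' (hid x)
  refine ⟨_, hT 0, fun x => ?_⟩
  have := tendsto_nhds_unique (hT 0) (hT x)
  rw [this]
  simp

/-- Along polynomials whose degree drops from `n` to `m` in the limit, exactly `m` of the `n` roots
converge, and the others tend to infinity. -/
lemma exists_tendsto_roots_of_degree_drop {α : Type*} (U : Ultrafilter α) {P : α → ℂ[X]} {p : ℂ[X]}
    {n m : ℕ} (h : PolyTendsto P U p n) (hpm : p.natDegree = m) (hm : 0 < m) {A T : α → ℂ}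
    {t : ℂ} {Z : α → Fin n → ℂ} (hT : Tendsto T U (𝓝 t))
    (hR : ∀ᶠ y in (U : Filter α), RootTuple (P y) (A y) (T y) (Z y)) :
    ∃ (s : Finset (Fin n)) (ζ : Fin n → ℂ), s.card = m ∧
      (∀ i ∈ s, Tendsto (fun y => Z y i) U (𝓝 (ζ i))) ∧
      (∀ i ∉ s, Tendsto (fun y => ‖Z y i‖) U atTop) ∧
      ∀ x, p.eval x - t = p.leadingCoeff * ∏ i ∈ s, (x - ζ i) := by
  classical
  -- Projective normalisation: the factor `x - Z i` becomes the linear form `β x - γ` with `(β, γ) =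
  -- (1, Z i) / max 1 ‖Z i‖`. Its coefficients stay bounded and cannot both tend to 0. The roots
  -- that escape are those with `β → 0`.
  set μ : α → Fin n → ℝ := fun y i => max 1 ‖Z y i‖ with hμ
  have hμ1 : ∀ y i, 1 ≤ μ y i := fun y i => le_max_left _ _
  have hμ0 : ∀ y i, (μ y i : ℂ) ≠ 0 := fun y i => by
    exact_mod_cast (zero_lt_one.trans_le (hμ1 y i)).ne'
  set β : α → Fin n → ℂ := fun y i => (μ y i : ℂ)⁻¹ with hβ
  set γ : α → Fin n → ℂ := fun y i => Z y i * (μ y i : ℂ)⁻¹ with hγ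
  have hβn : ∀ y i, ‖β y i‖ = (μ y i)⁻¹ := fun y i => by
    simp only [hβ, norm_inv, Complex.norm_real, Real.norm_eq_abs,
      abs_of_pos (zero_lt_one.trans_le (hμ1 y i))]
  have hγn : ∀ y i, ‖γ y i‖ = ‖Z y i‖ * (μ y i)⁻¹ := fun y i => by
    simp only [hγ, norm_mul, norm_inv, Complex.norm_real, Real.norm_eq_abs,
      abs_of_pos (zero_lt_one.trans_le (hμ1 y i))]
  obtain ⟨β₀, hβ₀⟩ := exists_tendsto_of_norm_le U β 1 (Eventually.of_forall fun y => by
    rw [pi_norm_le_iff_of_nonneg zero_le_one]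
    intro i; rw [hβn]; exact inv_le_one_of_one_le₀ (hμ1 y i))
  obtain ⟨γ₀, hγ₀⟩ := exists_tendsto_of_norm_le U γ 1 (Eventually.of_forall fun y => by
    rw [pi_norm_le_iff_of_nonneg zero_le_one]
    intro i; rw [hγn, ← div_eq_mul_inv]
    exact div_le_one_of_le₀ (le_max_right _ _) (zero_le_one.trans (hμ1 y i)))
  have hβi := tendsto_pi_nhds.1 hβ₀
  have hγi := tendsto_pi_nhds.1 hγ₀
  have hmax : ∀ i, max ‖β₀ i‖ ‖γ₀ i‖ = 1 := by
    intro i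
    refine tendsto_nhds_unique ((hβi i).norm.max (hγi i).norm) ?_
    refine tendsto_const_nhds.congr fun y => ?_
    rw [hβn, hγn]
    have hpos := zero_lt_one.trans_le (hμ1 y i)
    rw [← one_mul (μ y i)⁻¹, ← mul_assoc, mul_one, ← max_mul_of_nonneg _ _ (by positivity)]
    exact (mul_inv_cancel₀ hpos.ne').symm
  -- a point where the limit of the normalised products does not vanish
  obtain ⟨x₀, hx₀⟩ : ∃ x₀ : ℂ, ∏ i, (β₀ i * x₀ - γ₀ i) ≠ 0 := by
    have : (∏ i, (C (β₀ i) * X - C (γ₀ i)) : ℂ[X]) ≠ 0 := by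
      rw [Finset.prod_ne_zero_iff]
      intro i _ h0
      have h1 := congrArg (fun q => coeff q 1) h0
      have h2 := congrArg (fun q => coeff q 0) h0
      simp at h1 h2
      have := hmax i
      rw [h1, h2] at this; simp at this
    by_contra! hc
    apply this
    apply Polynomial.funext
    intro x
    simpa [eval_prod] using hc x
  have hprod : ∀ x : ℂ, Tendsto (fun y => ∏ i, (β y i * x - γ y i)) U
      (𝓝 (∏ i, (β₀ i * x - γ₀ i))) := fun x =>
    tendsto_finsetProd _ fun i _ => ((hβi i).mul_const x).sub (hγi i)
  set c : α → ℂ := fun y => A y * ∏ i, (μ y i : ℂ) with hc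
  have hPc : ∀ᶠ y in (U : Filter α), ∀ x, (P y).eval x - T y = c y * ∏ i, (β y i * x - γ y i) := by
    filter_upwards [hR] with y hy x
    rw [hy x, hc, mul_assoc, ← Finset.prod_mul_distrib]
    congr 1
    refine Finset.prod_congr rfl fun i _ => ?_
    simp only [hβ, hγ]
    have := hμ0 y i
    field_simp
  have hPT : ∀ x, Tendsto (fun y => (P y).eval x - T y) U (𝓝 (p.eval x - t)) :=
    fun x => (h.eval_const x).sub hT
  have hclim : Tendsto c U (𝓝 ((p.eval x₀ - t) / ∏ i, (β₀ i * x₀ - γ₀ i))) := by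
    refine ((hPT x₀).div (hprod x₀) hx₀).congr' ?_
    filter_upwards [hPc, (hprod x₀).eventually_ne hx₀] with y hy hy0
    rw [Pi.div_apply, hy x₀, mul_div_assoc, div_self hy0, mul_one]
  set c₀ := (p.eval x₀ - t) / ∏ i, (β₀ i * x₀ - γ₀ i)
  have hid : ∀ x, p.eval x - t = c₀ * ∏ i, (β₀ i * x - γ₀ i) := fun x =>
    tendsto_nhds_unique (hPT x) (((hclim.mul (hprod x))).congr'
      (hPc.mono fun y hy => (hy x).symm))
  set s : Finset (Fin n) := Finset.univ.filter fun i => β₀ i ≠ 0 with hs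
  set ζ : Fin n → ℂ := fun i => γ₀ i / β₀ i with hζ
  set c₁ : ℂ := c₀ * ((∏ i ∈ s, β₀ i) * ∏ i ∈ Finset.univ.filter (fun i => ¬ β₀ i ≠ 0), (-γ₀ i))
  have hid2 : ∀ x, p.eval x - t = c₁ * ∏ i ∈ s, (x - ζ i) := by
    intro x
    have e1 : ∏ i ∈ s, (β₀ i * x - γ₀ i) = (∏ i ∈ s, β₀ i) * ∏ i ∈ s, (x - ζ i) := by
      rw [← Finset.prod_mul_distrib]
      refine Finset.prod_congr rfl fun i hi => ?_
      have : β₀ i ≠ 0 := (Finset.mem_filter.1 hi).2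
      simp only [hζ]; field_simp
    have e2 : ∏ i ∈ Finset.univ.filter (fun i => ¬ β₀ i ≠ 0), (β₀ i * x - γ₀ i) =
        ∏ i ∈ Finset.univ.filter (fun i => ¬ β₀ i ≠ 0), (-γ₀ i) := by
      refine Finset.prod_congr rfl fun i hi => ?_
      have : β₀ i = 0 := not_not.1 (Finset.mem_filter.1 hi).2
      rw [this]; ring
    rw [hid x, ← Finset.prod_filter_mul_prod_filter_not Finset.univ (fun i => β₀ i ≠ 0), e1, e2]
    ring
  have hpoly : p - C t = C c₁ * ∏ i ∈ s, (X - C (ζ i)) := by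
    apply Polynomial.funext
    intro x
    simpa [eval_prod] using hid2 x
  have hmon : (∏ i ∈ s, (X - C (ζ i))).Monic := monic_prod_of_monic _ _ fun i _ => monic_X_sub_C _
  have hdeg : (p - C t).natDegree = m := by rw [natDegree_sub_C, hpm]
  have hlead : (p - C t).leadingCoeff = p.leadingCoeff := by
    rw [leadingCoeff, hdeg, coeff_sub, coeff_C_of_ne_zero hm.ne', sub_zero, leadingCoeff, hpm]
  have hc₁ : c₁ = p.leadingCoeff := by
    rw [← hlead, hpoly, leadingCoeff_mul, hmon.leadingCoeff, leadingCoeff_C, mul_one]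
  have hp0 : p.leadingCoeff ≠ 0 := by
    rw [Ne, leadingCoeff_eq_zero]; rintro rfl; simp at hpm; omega
  refine ⟨s, ζ, ?_, fun i hi => ?_, fun i hi => ?_, fun x => by rw [hid2 x, hc₁]⟩
  · rw [hpoly, natDegree_C_mul (by rw [hc₁]; exact hp0),
      natDegree_prod_of_monic _ _ (fun i _ => monic_X_sub_C _)] at hdeg
    simpa using hdeg
  · have hb : β₀ i ≠ 0 := (Finset.mem_filter.1 hi).2
    refine ((hγi i).div (hβi i) hb).congr fun y => ?_
    simp only [Pi.div_apply, hγ, hβ]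
    have := hμ0 y i
    field_simp
  · have hb : β₀ i = 0 := by
      by_contra hne; exact hi (Finset.mem_filter.2 ⟨Finset.mem_univ _, hne⟩)
    have h1 : Tendsto (fun y => (μ y i)⁻¹) U (𝓝[>] 0) := by
      rw [tendsto_nhdsWithin_iff]
      refine ⟨?_, Eventually.of_forall fun y => inv_pos.2 (zero_lt_one.trans_le (hμ1 y i))⟩
      have := (hβi i).norm
      rw [hb, norm_zero] at this
      exact this.congr fun y => hβn y i
    have h2 : Tendsto (fun y => μ y i) U atTop := by
      refine h1.inv_tendsto_nhdsGT_zero.congr fun y => ?_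
      simp
    refine tendsto_atTop.2 fun b => ?_
    filter_upwards [h2.eventually_ge_atTop (max b 2)] with y hy
    rcases le_max_iff.1 hy with h3 | h3
    · linarith [le_max_left b 2, le_max_right b 2]
    · exact (le_max_left _ _).trans h3

/-! ### Local continuation of simple roots. -/

lemma isOpen_setOf_injective {k : ℕ} : IsOpen {z : Fin k → ℂ | Function.Injective z} := by
  have : {z : Fin k → ℂ | Function.Injective z} = ⋂ i, ⋂ j, {z | i ≠ j → z i ≠ z j} := by
    ext z
    simp only [Set.mem_ofPred_eq, Set.mem_iInter]
    exact ⟨fun h i j hij he => hij (h he), fun h i j he => by_contra fun hij => h i j hij he⟩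
  rw [this]
  refine isOpen_iInter_of_finite fun i => isOpen_iInter_of_finite fun j => ?_
  by_cases hij : i = j
  · simp [hij]
  · simpa [hij] using isOpen_ne_fun (continuous_apply i) (continuous_apply j)

@[simp] lemma deform_zero_right (f g : ℂ[X]) : deform f g 0 = f := by simp [deform]

@[simp] lemma eval_deform (f g : ℂ[X]) (e x : ℂ) :
    (deform f g e).eval x = f.eval x + e * g.eval x := by simp [deform]

lemma derivative_deform (f g : ℂ[X]) (e : ℂ) :
    (deform f g e).derivative = deform f.derivative g.derivative e := by simp [deform]

/-- Simple roots of `f + ε g - t` continue holomorphically in `(t, ε)`. -/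
lemma exists_local_root (f g : ℂ[X]) {x₀ e₀ t₀ : ℂ} (ht : (deform f g e₀).eval x₀ = t₀)
    (hd : (deform f g e₀).derivative.eval x₀ ≠ 0) :
    ∃ ψ : ℂ × ℂ → ℂ, ψ (t₀, e₀) = x₀ ∧
      (∀ᶠ u in 𝓝 (t₀, e₀), DifferentiableAt ℂ ψ u ∧ (deform f g u.2).eval (ψ u) = u.1) ∧
      ∀ᶠ v in 𝓝 (x₀, e₀), ψ ((deform f g v.2).eval v.1, v.2) = v.1 := by
  -- Inverse function theorem for `(x, ε) ↦ ((f + ε g)(x), ε)`: its differential is triangular, with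
  -- diagonal entries `(f + ε g)'(x)` and 1.
  set Φ : ℂ × ℂ → ℂ × ℂ := fun v => (f.eval v.1 + v.2 * g.eval v.1, v.2) with hΦ
  have hcd : ContDiff ℂ 1 Φ :=
    (((f.contDiff_aeval (𝕜 := ℂ) 1).comp contDiff_fst).add
      (contDiff_snd.mul ((g.contDiff_aeval (𝕜 := ℂ) 1).comp contDiff_fst))).prodMk contDiff_snd
  have hp : HasFDerivAt Φ ((((f.derivative.eval x₀ • ContinuousLinearMap.fst ℂ ℂ ℂ) +
      (e₀ • (g.derivative.eval x₀ • ContinuousLinearMap.fst ℂ ℂ ℂ) +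
        g.eval x₀ • ContinuousLinearMap.snd ℂ ℂ ℂ))).prod (ContinuousLinearMap.snd ℂ ℂ ℂ))
      (x₀, e₀) := by
    refine HasFDerivAt.prodMk ?_ hasFDerivAt_snd
    have h1 : HasFDerivAt (fun v : ℂ × ℂ => f.eval v.1)
        (f.derivative.eval x₀ • ContinuousLinearMap.fst ℂ ℂ ℂ) (x₀, e₀) :=
      HasDerivAt.comp_hasFDerivAt (f := Prod.fst) (x₀, e₀) (f.hasDerivAt x₀) hasFDerivAt_fst
    have h2 : HasFDerivAt (fun v : ℂ × ℂ => g.eval v.1)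
        (g.derivative.eval x₀ • ContinuousLinearMap.fst ℂ ℂ ℂ) (x₀, e₀) :=
      HasDerivAt.comp_hasFDerivAt (f := Prod.fst) (x₀, e₀) (g.hasDerivAt x₀) hasFDerivAt_fst
    exact h1.add (hasFDerivAt_snd.mul h2)
  set D := f.derivative.eval x₀ + e₀ * g.derivative.eval x₀ with hD
  have hD0 : D ≠ 0 := by rw [derivative_deform, eval_deform] at hd; exact hd
  set E : (ℂ × ℂ) ≃L[ℂ] (ℂ × ℂ) := ContinuousLinearEquiv.equivOfInverse
    (((D⁻¹ • (ContinuousLinearMap.fst ℂ ℂ ℂ - g.eval x₀ • ContinuousLinearMap.snd ℂ ℂ ℂ))).prod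
      (ContinuousLinearMap.snd ℂ ℂ ℂ))
    (f₁ := ((((f.derivative.eval x₀ • ContinuousLinearMap.fst ℂ ℂ ℂ) +
      (e₀ • (g.derivative.eval x₀ • ContinuousLinearMap.fst ℂ ℂ ℂ) +
        g.eval x₀ • ContinuousLinearMap.snd ℂ ℂ ℂ))).prod (ContinuousLinearMap.snd ℂ ℂ ℂ)))
    (by
      rintro ⟨u, v⟩
      simp only [ContinuousLinearMap.prod_apply, add_apply,
        smul_apply, sub_apply, ContinuousLinearMap.coe_fst',
        ContinuousLinearMap.coe_snd', smul_eq_mul, Prod.mk.injEq, and_true]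
      field_simp
      rw [hD]; ring)
    (by
      rintro ⟨u, v⟩
      simp only [ContinuousLinearMap.prod_apply, add_apply,
        smul_apply, sub_apply, ContinuousLinearMap.coe_fst',
        ContinuousLinearMap.coe_snd', smul_eq_mul, Prod.mk.injEq, and_true]
      field_simp
      rw [hD]; ring) with hE
  have hp' : HasFDerivAt Φ (E : (ℂ × ℂ) →L[ℂ] (ℂ × ℂ)) (x₀, e₀) := hp
  have hΦ0 : Φ (x₀, e₀) = (t₀, e₀) := by simp only [hΦ, ← ht, eval_deform]
  have hc := hcd.contDiffAt (x := (x₀, e₀))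
  set Θ := hc.toOpenPartialHomeomorph Φ hp' one_ne_zero with hΘ
  have hsrc : (x₀, e₀) ∈ Θ.source := hc.mem_toOpenPartialHomeomorph_source hp' one_ne_zero
  have hcoe : (Θ : ℂ × ℂ → ℂ × ℂ) = Φ := hc.toOpenPartialHomeomorph_coe hp' one_ne_zero
  have htgt : (t₀, e₀) ∈ Θ.target := by
    have := Θ.map_source hsrc
    rwa [hcoe, hΦ0] at this
  have hsymm : ContDiffAt ℂ 1 Θ.symm (t₀, e₀) := by
    have := hc.to_localInverse hp' one_ne_zero
    rwa [hΦ0] at this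
  refine ⟨fun u => (Θ.symm u).1, ?_, ?_, ?_⟩
  · have := Θ.left_inv hsrc
    rw [hcoe, hΦ0] at this
    simp [this]
  · filter_upwards [hsymm.eventually (by simp), Θ.open_target.mem_nhds htgt] with u hu hut
    refine ⟨(hu.differentiableAt one_ne_zero).fst, ?_⟩
    have h1 : Φ (Θ.symm u) = u := by rw [← hcoe]; exact Θ.right_inv hut
    have h2 : (Θ.symm u).2 = u.2 := (congrArg Prod.snd h1 :)
    rw [eval_deform, ← h2]
    exact congrArg Prod.fst h1
  · filter_upwards [Θ.open_source.mem_nhds hsrc] with v hv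
    have h1 : Θ.symm (Φ v) = v := by rw [← hcoe]; exact Θ.left_inv hv
    simp only [eval_deform]
    exact congrArg Prod.fst h1

/-- Tuples of simple roots of `f + ε g - t` continue holomorphically in `(t, ε)`. -/
lemma exists_local_section (f g : ℂ[X]) {k : ℕ} {z₀ : Fin k → ℂ} {e₀ t₀ : ℂ}
    (hinj : Function.Injective z₀) (ht : ∀ j, (deform f g e₀).eval (z₀ j) = t₀)
    (hd : ∀ j, (deform f g e₀).derivative.eval (z₀ j) ≠ 0) :
    ∃ Ψ : ℂ × ℂ → Fin k → ℂ, Ψ (t₀, e₀) = z₀ ∧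
      (∀ᶠ u in 𝓝 (t₀, e₀), DifferentiableAt ℂ Ψ u ∧ Function.Injective (Ψ u) ∧
        ∀ j, (deform f g u.2).eval (Ψ u j) = u.1) ∧
      ∀ᶠ v : (Fin k → ℂ) × ℂ in 𝓝 (z₀, e₀),
        ∀ t, (∀ j, (deform f g v.2).eval (v.1 j) = t) → Ψ (t, v.2) = v.1 := by
  choose ψ h1 h2 h3 using fun j => exists_local_root f g (ht j) (hd j)
  have h0 : (fun j => ψ j (t₀, e₀)) = z₀ := funext h1
  have hdiff : ∀ᶠ u in 𝓝 (t₀, e₀), DifferentiableAt ℂ (fun u j => ψ j u) u := by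
    filter_upwards [eventually_all.2 h2] with u hu
    exact differentiableAt_pi.2 fun j => (hu j).1
  refine ⟨fun u j => ψ j u, h0, ?_, ?_⟩
  · have hi : ∀ᶠ u in 𝓝 (t₀, e₀), Function.Injective fun j => ψ j u := by
      refine hdiff.self_of_nhds.continuousAt.eventually
        (isOpen_setOf_injective.mem_nhds ?_)
      change Function.Injective (fun j => ψ j (t₀, e₀))
      rw [h0]; exact hinj
    filter_upwards [hdiff, hi, eventually_all.2 h2] with u hu hui hu2
    exact ⟨hu, hui, fun j => (hu2 j).2⟩
  · have : ∀ j, ∀ᶠ v : (Fin k → ℂ) × ℂ in 𝓝 (z₀, e₀),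
        ψ j ((deform f g v.2).eval (v.1 j), v.2) = v.1 j := fun j =>
      ((((continuous_apply j).comp continuous_fst).prodMk continuous_snd).tendsto
        (z₀, e₀)).eventually (h3 j)
    filter_upwards [eventually_all.2 this] with v hv t htv
    funext j
    rw [← htv j]
    exact hv j

/-- Local sections of the covering by ordered fibres of a polynomial. -/
lemma exists_section {p : ℂ[X]} {N : ℕ} (hp : p.natDegree = N) (hN : 0 < N) {z₀ : Fin N → ℂ}
    {t₀ : ℂ} (hz : RootTuple p p.leadingCoeff t₀ z₀) (hi : Function.Injective z₀) :
    ∃ (Ψ : ℂ → Fin N → ℂ) (r : ℝ), 0 < r ∧ Ψ t₀ = z₀ ∧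
      ∀ t ∈ Metric.ball t₀ r, DifferentiableAt ℂ Ψ t ∧ Function.Injective (Ψ t) ∧
        RootTuple p p.leadingCoeff t (Ψ t) := by
  have ha : p.leadingCoeff ≠ 0 := by
    rw [Ne, leadingCoeff_eq_zero]; rintro rfl; simp at hp; omega
  obtain ⟨Ψ, h0, h1, -⟩ := exists_local_section p 0 (e₀ := 0) (t₀ := t₀) hi
    (fun j => by simpa using hz.eval_root j) (fun j => by simpa using hz.derivative_ne_zero ha hi j)
  have hd : ∀ t : ℂ, DifferentiableAt ℂ (fun t : ℂ => (t, (0 : ℂ))) t := fun t => by fun_prop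
  have h2 := (hd t₀).continuousAt.eventually h1
  obtain ⟨r, hr, h3⟩ := Metric.eventually_nhds_iff_ball.1 h2
  refine ⟨fun t => Ψ (t, 0), r, hr, h0, fun t ht => ?_⟩
  obtain ⟨h4, h5, h6⟩ := h3 t ht
  refine ⟨DifferentiableAt.comp t h4 (hd t), h5, rootTuple_of_injective hp hN h5 fun j => ?_⟩
  simpa using h6 j

lemma joinedIn_section {p : ℂ[X]} {N : ℕ} (ha : p.leadingCoeff ≠ 0) {r : ℝ} {c : ℂ}
    {Ψ : ℂ → Fin N → ℂ} {t t' : ℂ}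
    (h : ∀ t ∈ Metric.ball c r, DifferentiableAt ℂ Ψ t ∧ Function.Injective (Ψ t) ∧
        RootTuple p p.leadingCoeff t (Ψ t)) (ht : t ∈ Metric.ball c r) (ht' : t' ∈ Metric.ball c r) :
    JoinedIn (regularTuples p N) (Ψ t) (Ψ t') := by
  have hpc : IsPathConnected (Metric.ball c r) :=
    (convex_ball c r).isPathConnected ⟨t, ht⟩
  have hcont : ContinuousOn Ψ (Metric.ball c r) := fun s hs =>
    (h s hs).1.continuousAt.continuousWithinAt
  refine ((hpc.image' hcont).joinedIn _ ⟨t, ht, rfl⟩ _ ⟨t', ht', rfl⟩).mono ?_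
  rintro _ ⟨s, hs, rfl⟩
  exact (h s hs).2.2.mem_regularTuples ha (h s hs).2.1

lemma JoinedIn.comp_perm {p : ℂ[X]} {k : ℕ} {z z' : Fin k → ℂ}
    (h : JoinedIn (regularTuples p k) z z') (ρ : Equiv.Perm (Fin k)) :
    JoinedIn (regularTuples p k) (z ∘ ρ) (z' ∘ ρ) := by
  obtain ⟨γ, hγ⟩ := h
  refine ⟨γ.map (f := fun z : Fin k → ℂ => z ∘ ρ) (by fun_prop), fun s => ?_⟩
  obtain ⟨h1, t, h2, h3⟩ := hγ s
  exact ⟨h1.comp ρ.injective, t, h2, fun j => h3 _⟩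

/-- Each fibre of `p`, of degree `N`, has at most one multiple point, and this is a double point. -/
def IsMorse (p : ℂ[X]) (N : ℕ) : Prop :=
  ∀ (t : ℂ) (Z : Fin N → ℂ), RootTuple p p.leadingCoeff t Z → ∀ i j k l, i ≠ j → k ≠ l →
    Z i = Z j → Z k = Z l → (i = k ∧ j = l) ∨ (i = l ∧ j = k)

lemma finite_criticalValues {p : ℂ[X]} (hp : p.derivative ≠ 0) : (criticalValues p).Finite := by
  refine ((p.derivative.roots.toFinset.finite_toSet).image fun c => p.eval c).subset ?_
  rintro t ⟨c, hc, rfl⟩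
  exact ⟨c, by simp [hp, hc], rfl⟩

lemma derivative_ne_zero_of_natDegree {p : ℂ[X]} (hp : 0 < p.natDegree) : p.derivative ≠ 0 := by
  intro h
  have := derivative_eq_zero.1 h
  omega

lemma leadingCoeff_ne_zero_of_natDegree {p : ℂ[X]} (hp : 0 < p.natDegree) :
    p.leadingCoeff ≠ 0 := by
  rw [Ne, leadingCoeff_eq_zero]; rintro rfl; simp at hp

lemma finite_setOf_eval_eq {p : ℂ[X]} (hp : 0 < p.natDegree) (t : ℂ) :
    {x | p.eval x = t}.Finite := by
  have h0 : p - C t ≠ 0 := fun h => by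
    rw [sub_eq_zero.1 h, natDegree_C] at hp; omega
  refine ((p - C t).roots.toFinset.finite_toSet).subset fun x hx => ?_
  have hx' : p.eval x = t := hx
  simp [h0, hx']

lemma finite_critical_fibres {p : ℂ[X]} (hp : 0 < p.natDegree) :
    {x | p.eval x ∈ criticalValues p}.Finite := by
  have : {x | p.eval x ∈ criticalValues p} = ⋃ t ∈ criticalValues p, {x | p.eval x = t} := by
    ext x; simp
  rw [this]
  exact (finite_criticalValues (derivative_ne_zero_of_natDegree hp)).biUnion
    fun t _ => finite_setOf_eval_eq hp t

/-- The only possible critical value of `a X^N` is 0, and over 0 the whole tuple vanishes. Nonzero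
limits of rescaled fibres are therefore genuine polygons. -/
lemma RootTuple.pow_injective {a T : ℂ} {N : ℕ} {v : Fin N → ℂ} (ha : a ≠ 0)
    (h : RootTuple (C a * X ^ N) a T v) (hv : v ≠ 0) : Function.Injective v ∧ T ≠ 0 := by
  have hN : 0 < N := by
    rcases Nat.eq_zero_or_pos N with rfl | h0
    · exact absurd (Subsingleton.elim v 0) hv
    · exact h0
  have hT : T ≠ 0 := by
    rintro rfl
    apply hv
    funext i
    have := h.eval_root i
    simpa [ha, hN.ne'] using this
  refine ⟨(h.injective_iff ha).2 ?_, hT⟩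
  rintro ⟨c, hc, hcT⟩
  simp only [derivative_mul, derivative_C, zero_mul, zero_add, derivative_X_pow, eval_mul, eval_C,
    eval_pow, eval_X] at hc hcT
  have hN' : (N : ℂ) ≠ 0 := by exact_mod_cast hN.ne'
  have hc0 : c = 0 := by
    have := (mul_eq_zero.1 ((mul_eq_zero.1 hc).resolve_left ha)).resolve_left hN'
    exact eq_zero_of_pow_eq_zero this
  rw [hc0, zero_pow hN.ne', mul_zero] at hcT
  exact hT hcT.symm

/-! ### Removable singularities -/

lemma exists_differentiable_extension {U : Set ℂ} (hU : IsOpen U) (F : Finset ℂ) : ∀ h : ℂ → ℂ,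
    (∀ x ∈ U, x ∉ F → DifferentiableAt ℂ h x) →
    (∀ c ∈ U, ∃ B : ℝ, ∀ᶠ x in 𝓝[≠] c, ‖h x‖ ≤ B) →
    ∃ H : ℂ → ℂ, (∀ x ∈ U, DifferentiableAt ℂ H x) ∧ ∀ x ∉ F, H x = h x := by
  classical
  induction F using Finset.induction_on with
  | empty => exact fun h hd _ => ⟨h, fun x hx => hd x hx (by simp), fun _ _ => rfl⟩
  | insert b F hb ih =>
    intro h hd hB
    set h1 := Function.update h b (limUnder (𝓝[≠] b) h) with hh1
    have hFo : IsOpen (U ∩ (F : Set ℂ)ᶜ) := hU.inter F.finite_toSet.isClosed.isOpen_compl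
    have hdo : DifferentiableOn ℂ h1 (U ∩ (F : Set ℂ)ᶜ) := by
      by_cases hbU : b ∈ U
      · obtain ⟨B, hB'⟩ := hB b hbU
        refine Complex.differentiableOn_update_limUnder_of_isLittleO
          (hFo.mem_nhds ⟨hbU, by simpa using hb⟩) ?_ (IsBoundedUnder.isLittleO_sub_self_inv
            ⟨B + ‖h b‖, eventually_map.2 (hB'.mono fun z hz => norm_sub_le_of_le hz le_rfl)⟩)
        rintro x ⟨hx, hxb⟩
        refine (hd x hx.1 ?_).differentiableWithinAt
        simp only [Finset.mem_insert, not_or]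
        exact ⟨hxb, by simpa using hx.2⟩
      · intro x hx
        have hxb : x ≠ b := fun h => hbU (h ▸ hx.1)
        refine DifferentiableAt.differentiableWithinAt ?_
        refine (hd x hx.1 ?_).congr_of_eventuallyEq ?_
        · simp only [Finset.mem_insert, not_or]
          exact ⟨hxb, by simpa using hx.2⟩
        · filter_upwards [isOpen_ne.mem_nhds hxb] with y hy
          rw [hh1, Function.update_of_ne hy]
    have := ih h1 (fun x hxU hx => (hdo x ⟨hxU, by simpa using hx⟩).differentiableAt
      (hFo.mem_nhds ⟨hxU, by simpa using hx⟩)) ?_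
    · obtain ⟨H, hH, hHe⟩ := this
      refine ⟨H, hH, fun x hx => ?_⟩
      simp only [Finset.mem_insert, not_or] at hx
      rw [hHe x hx.2, hh1, Function.update_of_ne hx.1]
    · intro c hcU
      obtain ⟨B, hB'⟩ := hB c hcU
      refine ⟨B, ?_⟩
      by_cases hcb : c = b
      · subst hcb
        filter_upwards [hB', self_mem_nhdsWithin] with x hx hxc
        rwa [hh1, Function.update_of_ne hxc]
      · filter_upwards [hB', nhdsWithin_le_nhds (isOpen_ne.mem_nhds hcb)] with x hx hxb
        rwa [hh1, Function.update_of_ne hxb]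

/-! ### Monodromy by transpositions -/

/-- The transposition of the entries `i` and `j` of `Z` is realised by a path of regular tuples. -/
def SwapJoined (p : ℂ[X]) {N : ℕ} (Z : Fin N → ℂ) (i j : Fin N) : Prop :=
  JoinedIn (regularTuples p N) Z (Z ∘ Equiv.swap i j)

namespace SwapJoined

variable {p : ℂ[X]} {N : ℕ} {Z Z' : Fin N → ℂ} {i j k : Fin N}

lemma refl (hZ : Z ∈ regularTuples p N) : SwapJoined p Z i i := by
  simpa [SwapJoined] using JoinedIn.refl hZ

lemma symm (h : SwapJoined p Z i j) : SwapJoined p Z j i := by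
  rwa [SwapJoined, Equiv.swap_comm]

/-- Conjugating the transposition of `j`, `k` by that of `i`, `j` gives the transposition of `i`,
`k`. -/
lemma trans (h : SwapJoined p Z i j) (h' : SwapJoined p Z j k) (hjk : j ≠ k) (hik : i ≠ k) :
    SwapJoined p Z i k := by
  have e : Equiv.swap i k = Equiv.swap i j * Equiv.swap j k * Equiv.swap i j := by
    rw [Equiv.swap_comm i j, Equiv.swap_comm j k, Equiv.swap_mul_swap_mul_swap hjk.symm hik.symm]
  have h1 : JoinedIn (regularTuples p N) (Z ∘ Equiv.swap i j)
      (Z ∘ Equiv.swap j k ∘ Equiv.swap i j) := JoinedIn.comp_perm h' (Equiv.swap i j)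
  have h2 : JoinedIn (regularTuples p N) (Z ∘ Equiv.swap j k ∘ Equiv.swap i j)
      (Z ∘ Equiv.swap i j ∘ Equiv.swap j k ∘ Equiv.swap i j) :=
    JoinedIn.comp_perm h (Equiv.swap j k * Equiv.swap i j)
  have h3 := (JoinedIn.trans h h1).trans h2
  rw [SwapJoined, e]
  exact h3

lemma of_comp (h : SwapJoined p Z i j) (ρ : Equiv.Perm (Fin N)) :
    SwapJoined p (Z ∘ ρ) (ρ.symm i) (ρ.symm j) := by
  have h1 := JoinedIn.comp_perm h ρ
  have : (Z ∘ Equiv.swap i j) ∘ ρ = (Z ∘ ρ) ∘ Equiv.swap (ρ.symm i) (ρ.symm j) := by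
    have e := Equiv.mul_swap_eq_swap_mul ρ (ρ.symm i) (ρ.symm j)
    rw [Equiv.apply_symm_apply, Equiv.apply_symm_apply] at e
    funext l
    exact congrArg Z (DFunLike.congr_fun e.symm l)
  rw [SwapJoined, ← this]
  exact h1

/-- The loop is conjugated by the path from `Z` to `Z'`. Which pairs can be exchanged is therefore
constant along continuation. -/
lemma transport (h : SwapJoined p Z i j) (hZ : JoinedIn (regularTuples p N) Z Z') :
    SwapJoined p Z' i j :=
  (hZ.symm.trans h).trans (JoinedIn.comp_perm hZ (Equiv.swap i j))

end SwapJoined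

lemma joinedIn_perm_of_swapJoined {p : ℂ[X]} {N : ℕ} {Z : Fin N → ℂ} (hZ : Z ∈ regularTuples p N)
    (h : ∀ i j, SwapJoined p Z i j) (ρ : Equiv.Perm (Fin N)) :
    JoinedIn (regularTuples p N) Z (Z ∘ ρ) := by
  induction ρ using Equiv.Perm.swap_induction_on with
  | one => simpa using JoinedIn.refl hZ
  | swap_mul ρ i j hij ih =>
    have := JoinedIn.comp_perm (h i j) ρ
    exact ih.trans this


lemma swapJoined_iff_comp {p : ℂ[X]} {N : ℕ} {Z : Fin N → ℂ} {i j : Fin N}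
    (ρ : Equiv.Perm (Fin N)) :
    SwapJoined p (Z ∘ ρ) i j ↔ SwapJoined p Z (ρ i) (ρ j) := by
  constructor
  · intro h
    simpa [Function.comp_assoc] using h.of_comp ρ.symm
  · intro h
    simpa using h.of_comp ρ

lemma eventually_injOn_of_derivative_ne_zero {p : ℂ[X]} {c : ℂ} (hc : p.derivative.eval c ≠ 0) :
    ∃ V ∈ 𝓝 c, Set.InjOn (fun x => p.eval x) V := by
  obtain ⟨ψ, -, -, h⟩ := exists_local_root p 0 (x₀ := c) (e₀ := 0) rfl (by simpa using hc)
  have hcont : ContinuousAt (fun x : ℂ => (x, (0 : ℂ))) c := by fun_prop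
  refine ⟨_, hcont.eventually h, fun x hx y hy hxy => ?_⟩
  have hx' : ψ (p.eval x, 0) = x := by simpa using hx
  have hy' : ψ (p.eval y, 0) = y := by simpa using hy
  have hxy' : p.eval x = p.eval y := hxy
  rw [← hx', ← hy', hxy']

/-- An analytic square root of `q`, with its local primitive coordinate `(x - c) √q(x)`. -/
lemma exists_sqrt_coordinate (q : ℂ[X]) {c : ℂ} (hq : q.eval c ≠ 0) :
    ∃ Θ : OpenPartialHomeomorph ℂ ℂ, c ∈ Θ.source ∧ Θ c = 0 ∧
      ∀ᶠ x in 𝓝 c, Θ x ^ 2 = (x - c) ^ 2 * q.eval x := by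
  obtain ⟨κ, hκ⟩ := IsAlgClosed.exists_pow_nat_eq (q.eval c) (n := 2) two_pos
  have hκ0 : κ ≠ 0 := by rintro rfl; apply hq; rw [← hκ]; simp
  -- The quotient is 1 at `c`, so the principal logarithm is analytic there, and `s` is an analytic
  -- root of `q` near `c`.
  set s : ℂ → ℂ := fun x => κ * Complex.exp (Complex.log (q.eval x / q.eval c) / 2) with hs
  have hqa : AnalyticAt ℂ (fun x => q.eval x / q.eval c) c :=
    (AnalyticAt.aeval_polynomial analyticAt_id q).div analyticAt_const hq
  have hsa : AnalyticAt ℂ s c := by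
    refine analyticAt_const.mul (AnalyticAt.cexp (AnalyticAt.div (hqa.clog ?_) analyticAt_const
      two_ne_zero))
    rw [div_self hq]; exact Complex.one_mem_slitPlane
  have hsc : s c = κ := by simp [hs, div_self hq]
  set φ : ℂ → ℂ := fun x => (x - c) * s x with hφ
  have hφa : AnalyticAt ℂ φ c := (analyticAt_id.sub analyticAt_const).mul hsa
  have hφd : HasDerivAt φ κ c := by
    have := ((hasDerivAt_id c).sub_const c).mul hsa.differentiableAt.hasDerivAt
    simp only [id, sub_self, zero_mul, add_zero, one_mul, hsc] at this
    exact this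
  have hst : HasStrictDerivAt φ κ c := by
    have := hφa.hasStrictDerivAt
    rwa [hφd.deriv] at this
  have hsf := hst.hasStrictFDerivAt_equiv hκ0
  refine ⟨hsf.toOpenPartialHomeomorph φ, hsf.mem_toOpenPartialHomeomorph_source, ?_, ?_⟩
  · rw [hsf.toOpenPartialHomeomorph_coe]; simp [hφ]
  · have hne : ∀ᶠ x in 𝓝 c, q.eval x / q.eval c ≠ 0 :=
      hqa.continuousAt.eventually_ne (by rw [div_self hq]; exact one_ne_zero)
    filter_upwards [hne] with x hx
    rw [hsf.toOpenPartialHomeomorph_coe]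
    simp only [hφ, hs]
    have e : Complex.exp (Complex.log (q.eval x / q.eval c) / 2) ^ 2 = q.eval x / q.eval c := by
      rw [← Complex.exp_nat_mul]
      have : ((2 : ℕ) : ℂ) * (Complex.log (q.eval x / q.eval c) / 2) =
          Complex.log (q.eval x / q.eval c) := by push_cast; ring
      rw [this, Complex.exp_log hx]
    rw [mul_pow, mul_pow, e, hκ]
    field_simp

/-- Near a critical point `c` of a Morse polynomial, there are full fibres `Y τ`, continuous in the
square root `τ` of the shifted value, in which two entries are `χ τ` and `χ (-τ)`. -/
lemma swapJoined_of_near_critical {p : ℂ[X]} {N : ℕ} (hp : p.natDegree = N) (hN : 0 < N)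
    (hM : IsMorse p N) {c : ℂ} (hc : p.derivative.eval c = 0) :
    ∃ V ∈ 𝓝 c, ∀ (t : ℂ) (Z : Fin N → ℂ), RootTuple p p.leadingCoeff t Z → Function.Injective Z →
      ∀ i j, i ≠ j → Z i ∈ V → Z j ∈ V → SwapJoined p Z i j := by
  classical
  have ha : p.leadingCoeff ≠ 0 := leadingCoeff_ne_zero_of_natDegree (hp ▸ hN)
  set a := p.leadingCoeff with ha'
  set t₀ := p.eval c with ht₀
  obtain ⟨W, hW⟩ := exists_rootTuple hp hN t₀
  have hWn : ¬ Function.Injective W := fun h =>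
    ((hW.injective_iff ha).1 h) ⟨c, hc, rfl⟩
  obtain ⟨i₁, hi₁⟩ := hW.exists_index ha (x := c) rfl
  obtain ⟨j₁, hj₁, hij⟩ : ∃ j₁, W j₁ = c ∧ i₁ ≠ j₁ := by
    rw [← hi₁, hW.eval_derivative] at hc
    obtain ⟨j, hj, hz⟩ := Finset.prod_eq_zero_iff.1 ((mul_eq_zero.1 hc).resolve_left ha)
    exact ⟨j, by rw [← hi₁]; exact (sub_eq_zero.1 hz).symm, (Finset.mem_erase.1 hj).1.symm⟩
  have hWne : ∀ k l, k ≠ l → W k = W l → (k = i₁ ∧ l = j₁) ∨ (k = j₁ ∧ l = i₁) :=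
    fun k l hkl h => hM t₀ W hW k l i₁ j₁ hkl hij h (by rw [hi₁, hj₁])
  set S : Finset (Fin N) := (Finset.univ.erase i₁).erase j₁ with hS
  have hSmem : ∀ k, k ∈ S ↔ k ≠ i₁ ∧ k ≠ j₁ := fun k => by simp [hS, and_comm]
  set q : ℂ[X] := C a * ∏ k ∈ S, (X - C (W k)) with hq
  have hqe : ∀ x, p.eval x - t₀ = (x - c) ^ 2 * q.eval x := by
    intro x
    have h1 := hW x
    rw [← Finset.mul_prod_erase _ _ (Finset.mem_univ i₁),
      ← Finset.mul_prod_erase _ _ (Finset.mem_erase.2 ⟨hij.symm, Finset.mem_univ j₁⟩),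
      hi₁, hj₁] at h1
    rw [h1, hq]
    simp only [eval_mul, eval_C, eval_prod, eval_sub, eval_X, hS]
    ring
  have hWc : ∀ k ∈ S, W k ≠ c := by
    intro k hk h
    obtain ⟨h1, h2⟩ := (hSmem k).1 hk
    rcases hWne k i₁ h1 (h.trans hi₁.symm) with h3 | h3
    · exact h1 h3.1
    · exact h2 h3.1
  have hqc : q.eval c ≠ 0 := by
    simp only [hq, eval_mul, eval_C, eval_prod, eval_sub, eval_X]
    exact mul_ne_zero ha (Finset.prod_ne_zero_iff.2 fun k hk => sub_ne_zero.2 (hWc k hk).symm)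
  obtain ⟨Θ, hΘs, hΘc, hΘ⟩ := exists_sqrt_coordinate q hqc
  have hd : ∀ k ∈ S, p.derivative.eval (W k) ≠ 0 := by
    intro k hk
    rw [hW.eval_derivative]
    refine mul_ne_zero ha (Finset.prod_ne_zero_iff.2 fun l hl => sub_ne_zero.2 fun h => ?_)
    obtain ⟨h1, h2⟩ := (hSmem k).1 hk
    rcases hWne k l (Finset.mem_erase.1 hl).1.symm h with h3 | h3
    · exact h1 h3.1
    · exact h2 h3.1
  have hψ : ∀ k, ∃ ψ : ℂ → ℂ, k ∈ S → ψ t₀ = W k ∧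
      ∀ᶠ t in 𝓝 t₀, ContinuousAt ψ t ∧ p.eval (ψ t) = t := by
    intro k
    by_cases hk : k ∈ S
    · obtain ⟨ψ, h1, h2, -⟩ := exists_local_root p 0 (x₀ := W k) (e₀ := 0) (t₀ := t₀)
        (by simpa using hW.eval_root k) (by simpa using hd k hk)
      have hct : ∀ t : ℂ, ContinuousAt (fun t : ℂ => (t, (0 : ℂ))) t := fun t => by fun_prop
      refine ⟨fun t => ψ (t, 0), fun _ => ⟨h1, ?_⟩⟩
      filter_upwards [(hct t₀).eventually h2] with t ht
      exact ⟨ContinuousAt.comp (f := fun t : ℂ => (t, (0 : ℂ))) ht.1.continuousAt (hct t),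
        by simpa using ht.2⟩
    · exact ⟨0, fun h => absurd h hk⟩
  choose ψ hψ using hψ
  set χ := Θ.symm with hχ
  have hΘt : (0 : ℂ) ∈ Θ.target := by rw [← hΘc]; exact Θ.map_source hΘs
  have hχ0 : χ 0 = c := by rw [← hΘc]; exact Θ.left_inv hΘs
  -- With `t = t₀ + τ²` the two colliding roots are `χ τ` and `χ (-τ)`, and the others depend on
  -- `τ²` only. Hence `τ ↦ -τ` exchanges exactly these two.
  set Y : ℂ → Fin N → ℂ := fun τ k => if k = i₁ then χ τ else if k = j₁ then χ (-τ) else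
    ψ k (t₀ + τ ^ 2) with hY
  have hYS : ∀ τ, ∀ k ∈ S, Y τ k = ψ k (t₀ + τ ^ 2) := fun τ k hk => by
    simp [hY, ((hSmem k).1 hk).1, ((hSmem k).1 hk).2]
  have hYi : ∀ τ, Y τ i₁ = χ τ := fun τ => by simp [hY]
  have hYj : ∀ τ, Y τ j₁ = χ (-τ) := fun τ => by simp [hY, hij.symm]
  have hcase : ∀ k, k = i₁ ∨ k = j₁ ∨ k ∈ S := fun k => by
    rw [hSmem]; tauto
  have hY0 : Y 0 = W := by
    funext k
    rcases hcase k with rfl | rfl | hk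
    · rw [hYi, hχ0, hi₁]
    · rw [hYj, neg_zero, hχ0, hj₁]
    · rw [hYS 0 k hk]; simpa using (hψ k hk).1
  have hsq : Tendsto (fun τ : ℂ => t₀ + τ ^ 2) (𝓝 0) (𝓝 t₀) := by
    have : ContinuousAt (fun τ : ℂ => t₀ + τ ^ 2) 0 := by fun_prop
    simpa [ContinuousAt] using this
  have hneg : Tendsto (fun τ : ℂ => -τ) (𝓝 0) (𝓝 0) := by
    simpa using (continuous_neg (G := ℂ)).tendsto 0
  have hχcont : ∀ᶠ τ in 𝓝 (0 : ℂ), ContinuousAt χ τ ∧ p.eval (χ τ) = t₀ + τ ^ 2 ∧ τ ∈ Θ.target := by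
    have h1 : ContinuousAt χ 0 := Θ.symm.continuousAt hΘt
    have h2 := h1.eventually (p := fun x => Θ x ^ 2 = (x - c) ^ 2 * q.eval x) (by rw [hχ0]; exact hΘ)
    filter_upwards [h2, Θ.open_target.mem_nhds hΘt] with τ hτ hτt
    refine ⟨Θ.symm.continuousAt hτt, ?_, hτt⟩
    rw [Θ.right_inv hτt, ← hqe] at hτ
    rw [hτ]; ring
  have hYgood : ∀ᶠ τ in 𝓝 (0 : ℂ), ContinuousAt Y τ ∧ ∀ k, p.eval (Y τ k) = t₀ + τ ^ 2 := by
    have h3 : ∀ᶠ τ in 𝓝 (0 : ℂ), ∀ k ∈ S, ContinuousAt (ψ k) (t₀ + τ ^ 2) ∧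
        p.eval (ψ k (t₀ + τ ^ 2)) = t₀ + τ ^ 2 := by
      rw [Filter.eventually_all_finset]
      exact fun k hk => hsq.eventually (hψ k hk).2
    filter_upwards [hχcont, hneg.eventually hχcont, h3] with τ h4 h5 h6
    have hk : ∀ k, ContinuousAt (fun τ => Y τ k) τ ∧ p.eval (Y τ k) = t₀ + τ ^ 2 := by
      intro k
      rcases hcase k with rfl | rfl | hk
      · simp_rw [hYi]; exact ⟨h4.1, h4.2.1⟩
      · simp_rw [hYj]
        refine ⟨ContinuousAt.comp (g := χ) (f := fun τ : ℂ => -τ) h5.1 continuousAt_neg, ?_⟩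
        rw [h5.2.1]; ring
      · simp_rw [fun τ => hYS τ k hk]
        exact ⟨ContinuousAt.comp (g := ψ k) (f := fun τ : ℂ => t₀ + τ ^ 2) (h6 k hk).1
          (by fun_prop), (h6 k hk).2⟩
    exact ⟨continuousAt_pi.2 fun k => (hk k).1, fun k => (hk k).2⟩
  have hYinj : ∀ᶠ τ in 𝓝 (0 : ℂ), τ ≠ 0 → Function.Injective (Y τ) := by
    have h1 : ∀ᶠ τ in 𝓝 (0 : ℂ), ∀ k l, W k ≠ W l → Y τ k ≠ Y τ l := by
      rw [eventually_all]; intro k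
      rw [eventually_all]; intro l
      by_cases h : W k = W l
      · simp [h]
      · have hk := (continuousAt_pi.1 hYgood.self_of_nhds.1) k
        have hl := (continuousAt_pi.1 hYgood.self_of_nhds.1) l
        have hkl0 : ((fun y => Y y k) - fun y => Y y l) 0 ≠ 0 := by
          change Y 0 k - Y 0 l ≠ 0
          rw [hY0]; exact sub_ne_zero.2 h
        have := (hk.sub hl).eventually_ne hkl0
        filter_upwards [this] with τ hτ _
        exact sub_ne_zero.1 hτ
    filter_upwards [h1, hχcont, hneg.eventually hχcont] with τ h2 h3 h4 hτ k l hkl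
    by_contra hne
    have hWkl : W k = W l := by
      by_contra hW'
      exact h2 k l hW' hkl
    have hχne : χ τ ≠ χ (-τ) := by
      intro he
      have := Θ.symm.injOn h3.2.2 h4.2.2 he
      apply hτ
      have h5 : τ + τ = 0 := by nth_rewrite 1 [this]; ring
      simpa using h5
    rcases hWne k l hne hWkl with ⟨rfl, rfl⟩ | ⟨rfl, rfl⟩
    · rw [hYi, hYj] at hkl; exact hχne hkl
    · rw [hYi, hYj] at hkl; exact hχne hkl.symm
  obtain ⟨ρ, hρ, hball⟩ := Metric.eventually_nhds_iff_ball.1 (hYgood.and hYinj)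
  have hreg : ∀ τ ∈ Metric.ball (0 : ℂ) ρ, τ ≠ 0 → Y τ ∈ regularTuples p N := fun τ hτ h0 =>
    (mem_regularTuples_iff hp hN).2 ⟨(hball τ hτ).2 h0, _, (hball τ hτ).1.2⟩
  have hflip : ∀ τ ∈ Metric.ball (0 : ℂ) ρ, τ ≠ 0 → SwapJoined p (Y τ) i₁ j₁ := by
    intro τ hτ h0
    -- The circle through `τ` contains `-τ` and avoids 0, where the fibre degenerates.
    have hsph : IsPathConnected (Metric.sphere (0 : ℂ) ‖τ‖) :=
      isPathConnected_sphere (by rw [Complex.rank_real_complex]; norm_num) 0 (norm_nonneg _)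
    have hsub : ∀ σ ∈ Metric.sphere (0 : ℂ) ‖τ‖, σ ∈ Metric.ball (0 : ℂ) ρ ∧ σ ≠ 0 := by
      intro σ hσ
      simp only [mem_sphere_zero_iff_norm, mem_ball_zero_iff] at hσ hτ ⊢
      refine ⟨hσ ▸ hτ, ?_⟩
      rw [← norm_pos_iff, hσ]; exact norm_pos_iff.2 h0
    have hco : ContinuousOn Y (Metric.sphere (0 : ℂ) ‖τ‖) := fun σ hσ =>
      (hball σ (hsub σ hσ).1).1.1.continuousWithinAt
    have hj := (hsph.image' hco).joinedIn (Y τ) ⟨τ, by simp, rfl⟩ (Y (-τ)) ⟨-τ, by simp, rfl⟩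
    have he : Y (-τ) = Y τ ∘ Equiv.swap i₁ j₁ := by
      funext k
      rcases hcase k with rfl | rfl | hk
      · simp [hYi, hYj]
      · simp [hYi, hYj]
      · rw [Function.comp_apply, Equiv.swap_apply_of_ne_of_ne ((hSmem k).1 hk).1
          ((hSmem k).1 hk).2, hYS _ k hk, hYS _ k hk, neg_sq]
    rw [SwapJoined, ← he]
    refine hj.mono ?_
    rintro _ ⟨σ, hσ, rfl⟩
    exact hreg σ (hsub σ hσ).1 (hsub σ hσ).2
  have hVmem : ∀ᶠ x in 𝓝 c, x ∈ Θ.source ∧ Θ x ∈ Metric.ball (0 : ℂ) ρ ∧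
      Θ x ^ 2 = (x - c) ^ 2 * q.eval x := by
    filter_upwards [Θ.open_source.mem_nhds hΘs, (Θ.continuousAt hΘs).eventually
      (by rw [hΘc]; exact Metric.ball_mem_nhds 0 hρ), hΘ] with x h1 h2 h3 using ⟨h1, h2, h3⟩
  refine ⟨_, hVmem, fun t Z hZ hZi i j hij' hi hj => ?_⟩
  obtain ⟨hi1, hi2, hi3⟩ := hi
  obtain ⟨hj1, hj2, hj3⟩ := hj
  rw [← hqe, hZ.eval_root] at hi3 hj3
  have hne : Θ (Z i) ≠ Θ (Z j) := fun h => hij' (hZi (Θ.injOn hi1 hj1 h))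
  -- Both coordinates have square `t - t₀`, and they differ.
  have hneg' : Θ (Z j) = -Θ (Z i) :=
    ((sq_eq_sq_iff_eq_or_eq_neg.1 (hj3.trans hi3.symm))).resolve_left hne.symm
  have hτ0 : Θ (Z i) ≠ 0 := by
    intro h; rw [h, neg_zero] at hneg'; exact hne (h.trans hneg'.symm)
  set τ := Θ (Z i) with hτ
  have hYZi : Y τ i₁ = Z i := by rw [hYi]; exact Θ.left_inv hi1
  have hYZj : Y τ j₁ = Z j := by rw [hYj, ← hneg']; exact Θ.left_inv hj1
  have ht : t = t₀ + τ ^ 2 := by rw [hi3]; ring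
  have hRY : RootTuple p a t (Y τ) := rootTuple_of_injective hp hN ((hball τ hi2).2 hτ0)
    (by rw [ht]; exact (hball τ hi2).1.2)
  obtain ⟨π, hπ⟩ := hRY.exists_perm ha hZ
  rw [hπ, swapJoined_iff_comp]
  have h1 : π i = i₁ := (hball τ hi2).2 hτ0 (by rw [hYZi, hπ]; rfl)
  have h2 : π j = j₁ := (hball τ hi2).2 hτ0 (by rw [hYZj, hπ]; rfl)
  rw [h1, h2]
  exact hflip τ hi2 hτ0

/-- Distinct points of a fibre that are close to each other can be exchanged. -/
lemma swapJoined_of_near {p : ℂ[X]} {N : ℕ} (hp : p.natDegree = N) (hN : 0 < N)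
    (hM : IsMorse p N) (c : ℂ) :
    ∃ V ∈ 𝓝 c, ∀ (t : ℂ) (Z : Fin N → ℂ), RootTuple p p.leadingCoeff t Z → Function.Injective Z →
      ∀ i j, i ≠ j → Z i ∈ V → Z j ∈ V → SwapJoined p Z i j := by
  by_cases hc : p.derivative.eval c = 0
  · exact swapJoined_of_near_critical hp hN hM hc
  · obtain ⟨V, hV, hinj⟩ := eventually_injOn_of_derivative_ne_zero hc
    refine ⟨V, hV, fun t Z hZ hZi i j hij hi hj => absurd (hZi (hinj hi hj ?_)) hij⟩
    simp only [hZ.eval_root]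

/-- The points of a fibre over a value near infinity are far apart. -/
lemma eventually_far_apart {p : ℂ[X]} {N : ℕ} (hp : p.natDegree = N) (hN : 0 < N) (K : ℝ) :
    ∀ᶠ x in cocompact ℂ, ∀ (t : ℂ) (Z : Fin N → ℂ), RootTuple p p.leadingCoeff t Z →
      ∀ i j, i ≠ j → Z i = x → K ≤ ‖x - Z j‖ := by
  have ha : p.leadingCoeff ≠ 0 := leadingCoeff_ne_zero_of_natDegree (hp ▸ hN)
  refine eventually_of_forall_ultrafilter fun U hU hbad => ?_
  push Not at hbad
  have hbad' : ∀ᶠ x in (U : Filter ℂ), ∃ w : (Fin N → ℂ) × Fin N × Fin N × ℂ,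
      RootTuple p p.leadingCoeff w.2.2.2 w.1 ∧ w.2.1 ≠ w.2.2.1 ∧ w.1 w.2.1 = x ∧
        ‖x - w.1 w.2.2.1‖ < K :=
    hbad.mono fun x ⟨t, Z, hZ, i, j, hij, h1, h2⟩ => ⟨(Z, i, j, t), hZ, hij, h1, h2⟩
  obtain ⟨w, hw⟩ := hbad'.choice
  obtain ⟨⟨i, j⟩, hij⟩ := eventually_eq_of_finite U fun x => ((w x).2.1, (w x).2.2.1)
  have hnorm : Tendsto (fun x : ℂ => ‖(w x).1‖) U atTop := by
    refine tendsto_atTop_mono' _ ?_ (tendsto_norm_cocompact_atTop.mono_left hU)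
    filter_upwards [hw] with x hx
    exact (congrArg norm hx.2.2.1).symm.le.trans (norm_le_pi_norm (w x).1 _)
  -- Rescaled by its norm, the fibre tends to a tuple of distinct points, whereas two points at
  -- bounded distance would have the same limit.
  set lam : ℂ → ℂ := fun x => ((‖(w x).1‖⁻¹ : ℝ) : ℂ) with hlam
  have hlt : Tendsto lam U (𝓝 0) := by
    have := hnorm.inv_tendsto_atTop
    simpa [Function.comp_def, hlam] using (Complex.continuous_ofReal.tendsto 0).comp this
  have hl0 : ∀ᶠ x in (U : Filter ℂ), lam x ≠ 0 := by
    filter_upwards [hnorm.eventually_gt_atTop 0] with x hx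
    simp only [hlam]; exact_mod_cast (inv_pos.2 hx).ne'
  have hn1 : ∀ᶠ x in (U : Filter ℂ), ‖lam x • (w x).1‖ = 1 := by
    filter_upwards [hnorm.eventually_gt_atTop 0] with x hx
    rw [norm_smul, hlam, Complex.norm_real, norm_inv, norm_norm, inv_mul_cancel₀ hx.ne']
  obtain ⟨v, hv⟩ := exists_tendsto_of_norm_le U (fun x => lam x • (w x).1) 1
    (hn1.mono fun x hx => hx.le)
  have hvn : ‖v‖ = 1 := tendsto_nhds_unique hv.norm (tendsto_const_nhds.congr' (hn1.mono fun x hx =>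
    hx.symm))
  have hP : PolyTendsto (fun _ : ℂ => p) (U : Filter ℂ) p N :=
    ⟨fun i => tendsto_const_nhds, Eventually.of_forall fun _ => hp.le, hp.le⟩
  obtain ⟨T₀, -, hT₀⟩ := RootTuple.of_tendsto_scaled (A := fun _ => p.leadingCoeff)
    (T := fun x => (w x).2.2.2) hP tendsto_const_nhds
    (Eventually.of_forall fun _ => by rw [leadingCoeff, hp]) hl0 hlt hv (hw.mono fun x hx => hx.1)
  have hinj := (hT₀.pow_injective ha (by rintro rfl; simp at hvn)).1
  have hne : i ≠ j := by
    obtain ⟨x, hx1, hx2⟩ := (hw.and hij).exists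
    simp only [Prod.mk.injEq] at hx2
    rw [← hx2.1, ← hx2.2]; exact hx1.2.1
  have h1 : Tendsto (fun x => lam x * (x - (w x).1 j)) U (𝓝 (v i - v j)) := by
    refine (((tendsto_pi_nhds.1 hv) i).sub ((tendsto_pi_nhds.1 hv) j)).congr' ?_
    filter_upwards [hw, hij] with x hx hx2
    simp only [Prod.mk.injEq] at hx2
    have := hx.2.2.1
    rw [hx2.1] at this
    simp only [Pi.smul_apply, smul_eq_mul, this]; ring
  have h2 : Tendsto (fun x => lam x * (x - (w x).1 j)) U (𝓝 0) := by
    refine hlt.zero_mul_isBoundedUnder_le ⟨K, eventually_map.2 ?_⟩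
    filter_upwards [hw, hij] with x hx hx2
    simp only [Prod.mk.injEq] at hx2
    have := hx.2.2.2
    rw [hx2.2] at this
    exact this.le
  exact hne (hinj (sub_eq_zero.1 (tendsto_nhds_unique h1 h2)))

/-- The regular points of `p` over which every exchange with a point of the fibre is possible are
not absent: otherwise the product of the `(x - y)⁻¹` over the points `y` of the fibre of `x` that
cannot be exchanged with `x` would be a nonzero entire function that tends to `0` at infinity. -/
lemma exists_all_swapJoined {p : ℂ[X]} {N : ℕ} (hp : p.natDegree = N) (hN : 0 < N)
    (hM : IsMorse p N) :
    ∃ (t : ℂ) (Z : Fin N → ℂ) (i : Fin N), RootTuple p p.leadingCoeff t Z ∧ Function.Injective Z ∧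
      ∀ j, SwapJoined p Z i j := by
  classical
  by_contra! hcon
  have ha : p.leadingCoeff ≠ 0 := leadingCoeff_ne_zero_of_natDegree (hp ▸ hN)
  have hp0 : 0 < p.natDegree := hp ▸ hN
  set F := (finite_critical_fibres hp0).toFinset with hF
  have hFmem : ∀ x, x ∉ F ↔ p.eval x ∉ criticalValues p := fun x => by simp [hF]
  have hex : ∀ x, ∃ w : (Fin N → ℂ) × Fin N, x ∉ F →
      RootTuple p p.leadingCoeff (p.eval x) w.1 ∧ Function.Injective w.1 ∧ w.1 w.2 = x := by
    intro x
    obtain ⟨Z, hZ⟩ := exists_rootTuple hp hN (p.eval x)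
    obtain ⟨i, hi⟩ := hZ.exists_index ha (x := x) rfl
    exact ⟨(Z, i), fun hx => ⟨hZ, (hZ.injective_iff ha).2 ((hFmem x).1 hx), hi⟩⟩
  choose w hw using hex
  set h : ℂ → ℂ := fun x => ∏ j ∈ Finset.univ.filter (fun j => ¬ SwapJoined p (w x).1 (w x).2 j),
    (x - (w x).1 j)⁻¹ with hh
  -- The value `h x` depends only on `x`, not on the chosen labelling of its fibre. Near a regular
  -- point the labelling may thus be replaced by a holomorphic one.
  have hinv : ∀ x ∉ F, ∀ (Z : Fin N → ℂ) (i : Fin N), RootTuple p p.leadingCoeff (p.eval x) Z →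
      Z i = x → h x = ∏ j ∈ Finset.univ.filter (fun j => ¬ SwapJoined p Z i j), (x - Z j)⁻¹ := by
    intro x hx Z i hZ hi
    obtain ⟨h1, h2, h3⟩ := hw x hx
    obtain ⟨π, rfl⟩ := h1.exists_perm ha hZ
    have hπi : π i = (w x).2 := h2 (by rw [h3]; exact hi)
    simp only [hh]
    symm
    refine Finset.prod_bij (fun j _ => π j) (fun j hj => ?_) (fun j _ k _ hjk => π.injective hjk)
      (fun j hj => ⟨π.symm j, ?_, π.apply_symm_apply j⟩) (fun j _ => rfl)
    · simp only [Finset.mem_filter, Finset.mem_univ, true_and, swapJoined_iff_comp, hπi] at hj ⊢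
      exact hj
    · simp only [Finset.mem_filter, Finset.mem_univ, true_and, swapJoined_iff_comp, hπi,
        Equiv.apply_symm_apply] at hj ⊢
      exact hj
  have hrefl : ∀ x ∉ F, ∀ j, ¬ SwapJoined p (w x).1 (w x).2 j → (w x).2 ≠ j := by
    rintro x hx j hj rfl
    exact hj (SwapJoined.refl ((hw x hx).1.mem_regularTuples ha (hw x hx).2.1))
  -- holomorphy
  have hdiff : ∀ x ∉ F, DifferentiableAt ℂ h x := by
    intro x₀ hx₀
    obtain ⟨hZ, hZi, hi⟩ := hw x₀ hx₀
    set Z := (w x₀).1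
    set i := (w x₀).2
    obtain ⟨Ψ, r, hr, hΨ0, hΨ⟩ := exists_section hp hN hZ hZi
    have hpc : Tendsto (fun x => p.eval x) (𝓝 x₀) (𝓝 (p.eval x₀)) := p.continuous.tendsto x₀
    have hc0 := Metric.mem_ball_self (x := p.eval x₀) hr
    have hΨd : DifferentiableAt ℂ (fun x => Ψ (p.eval x)) x₀ :=
      DifferentiableAt.comp x₀ (hΨ _ hc0).1 p.differentiableAt
    have hk : ∀ k, k ≠ i → ∀ᶠ x in 𝓝 x₀, x ≠ Ψ (p.eval x) k := by
      intro k hki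
      have h1 : ContinuousAt (fun x => x - Ψ (p.eval x) k) x₀ :=
        continuousAt_id.sub (continuousAt_pi.1 hΨd.continuousAt k)
      have h2 : x₀ - Ψ (p.eval x₀) k ≠ 0 := by
        rw [hΨ0, sub_ne_zero, ← hi]
        exact fun h => hki (hZi h).symm
      filter_upwards [h1.eventually_ne h2] with x hx using sub_ne_zero.1 hx
    have hk' : ∀ᶠ x in 𝓝 x₀, ∀ k, k ≠ i → x ≠ Ψ (p.eval x) k := by
      rw [eventually_all]; intro k
      by_cases hki : k = i
      · simp [hki]
      · simpa [hki] using hk k hki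
    have hlocal : ∀ᶠ x in 𝓝 x₀, h x =
        ∏ j ∈ Finset.univ.filter (fun j => ¬ SwapJoined p Z i j), (x - Ψ (p.eval x) j)⁻¹ := by
      filter_upwards [hk', hpc.eventually (Metric.ball_mem_nhds _ hr)] with x hx1 hx2
      obtain ⟨-, hinj, hRT⟩ := hΨ _ hx2
      have hxF : x ∉ F := (hFmem x).2 ((hRT.injective_iff ha).1 hinj)
      have hxi : Ψ (p.eval x) i = x := by
        obtain ⟨k, hk⟩ := hRT.exists_index ha (x := x) rfl
        by_cases hki : k = i
        · rw [← hki]; exact hk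
        · exact absurd hk.symm (hx1 k hki)
      rw [hinv x hxF _ i hRT hxi]
      refine Finset.prod_congr ?_ fun _ _ => rfl
      ext j
      have hj : JoinedIn (regularTuples p N) Z (Ψ (p.eval x)) := by
        rw [← hΨ0]
        exact joinedIn_section ha hΨ hc0 hx2
      simp only [Finset.mem_filter, Finset.mem_univ, true_and, not_iff_not]
      exact ⟨fun h => h.transport hj.symm, fun h => h.transport hj⟩
    refine DifferentiableAt.congr_of_eventuallyEq ?_ hlocal
    refine DifferentiableAt.fun_finsetProd fun j hj => ?_
    refine (differentiableAt_id.sub (differentiableAt_pi.1 hΨd j)).inv ?_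
    have hj' : ¬ SwapJoined p Z i j := (Finset.mem_filter.1 hj).2
    change x₀ - Ψ (p.eval x₀) j ≠ 0
    rw [hΨ0, sub_ne_zero]
    intro he
    exact hrefl x₀ hx₀ j hj' (hZi (hi.trans he))
  have hnorm : ∀ x, ‖h x‖ = ∏ j ∈ Finset.univ.filter
      (fun j => ¬ SwapJoined p (w x).1 (w x).2 j), ‖x - (w x).1 j‖⁻¹ := fun x => by
    simp only [hh, norm_prod, norm_inv]
  have hbound : ∀ {δ : ℝ}, 0 < δ → ∀ x, (∀ j, ¬ SwapJoined p (w x).1 (w x).2 j →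
      δ ≤ ‖x - (w x).1 j‖) → ‖h x‖ ≤ (δ⁻¹) ^ (Finset.univ.filter
        (fun j => ¬ SwapJoined p (w x).1 (w x).2 j)).card := by
    intro δ hδ x hx
    rw [hnorm]
    refine (Finset.prod_le_prod (fun _ _ => by positivity) (fun j hj =>
      inv_anti₀ hδ (hx j (Finset.mem_filter.1 hj).2))).trans_eq ?_
    rw [Finset.prod_const]
  -- local boundedness
  have hF' : ∀ c : ℂ, ∀ᶠ x in 𝓝[≠] c, x ∉ F := by
    intro c
    have : IsClosed ((F : Set ℂ) \ {c}) := (F.finite_toSet.sdiff).isClosed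
    have h1 : ((F : Set ℂ) \ {c})ᶜ ∈ 𝓝 c := this.isOpen_compl.mem_nhds (by simp)
    filter_upwards [nhdsWithin_le_nhds h1, self_mem_nhdsWithin] with x hx hxc hxF
    exact hx ⟨hxF, hxc⟩
  -- Near `c`, points of a fibre that are close to each other can be exchanged, so every factor left
  -- in the product has `‖x - y‖ ≥ δ / 2`.
  have hbdd : ∀ c, ∃ B : ℝ, ∀ᶠ x in 𝓝[≠] c, ‖h x‖ ≤ B := by
    intro c
    obtain ⟨V, hV, hswap⟩ := swapJoined_of_near hp hN hM c
    obtain ⟨δ, hδ, hball⟩ := Metric.mem_nhds_iff.1 hV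
    refine ⟨max 1 (δ / 2)⁻¹ ^ N, ?_⟩
    filter_upwards [hF' c, nhdsWithin_le_nhds (Metric.ball_mem_nhds c (half_pos hδ))] with x hx hxc
    obtain ⟨hZ, hZi, hi⟩ := hw x hx
    refine (hbound (half_pos hδ) x fun j hj => ?_).trans ?_
    · by_contra! hlt
      refine hj (hswap _ _ hZ hZi _ j (hrefl x hx j hj) (hball ?_) (hball ?_))
      · rw [hi]; exact Metric.ball_subset_ball (half_le_self hδ.le) hxc
      · rw [Metric.mem_ball] at hxc ⊢
        calc dist ((w x).1 j) c ≤ dist ((w x).1 j) x + dist x c := dist_triangle _ _ _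
          _ < δ / 2 + δ / 2 := by
            refine add_lt_add ?_ hxc
            rw [dist_comm, dist_eq_norm]; exact hlt
          _ = δ := by ring
    · refine (pow_le_pow_left₀ (by positivity) (le_max_right 1 (δ / 2)⁻¹) _).trans ?_
      refine pow_le_pow_right₀ (le_max_left _ _) ?_
      exact (Finset.card_filter_le _ _).trans (by simp)
  obtain ⟨H, hHd, hHh⟩ := exists_differentiable_extension isOpen_univ F h
    (fun x _ => hdiff x) (fun c _ => hbdd c)
  replace hHd : Differentiable ℂ H := fun x => hHd x trivial
  have hFc : ∀ᶠ x in cocompact ℂ, x ∉ F :=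
    F.finite_toSet.isCompact.compl_mem_cocompact
  -- The hypothesis `hcon` guarantees at least one factor, and all factors are small at infinity.
  -- Liouville's theorem then gives `H = 0`, although no factor vanishes.
  have hH0 : Tendsto H (cocompact ℂ) (𝓝 0) := by
    rw [Metric.tendsto_nhds]
    intro ε hε
    filter_upwards [eventually_far_apart hp hN (max 1 (2 / ε)), hFc] with x hx hxF
    rw [hHh x hxF, dist_zero_right]
    obtain ⟨hZ, hZi, hi⟩ := hw x hxF
    have hK : (0 : ℝ) < max 1 (2 / ε) := lt_max_of_lt_left one_pos
    refine (hbound hK x fun j hj => hx _ _ hZ _ j (hrefl x hxF j hj) hi).trans_lt ?_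
    obtain ⟨j, hj⟩ := hcon (p.eval x) (w x).1 (w x).2 hZ hZi
    have hcard : 1 ≤ (Finset.univ.filter (fun j => ¬ SwapJoined p (w x).1 (w x).2 j)).card :=
      Finset.card_pos.2 ⟨j, Finset.mem_filter.2 ⟨Finset.mem_univ _, hj⟩⟩
    have hK1 : (max 1 (2 / ε))⁻¹ ≤ 1 := inv_le_one_of_one_le₀ (le_max_left _ _)
    refine (pow_le_of_le_one (inv_nonneg.2 hK.le) hK1 (by omega)).trans_lt ?_
    rw [inv_lt_comm₀ hK hε]
    refine lt_of_lt_of_le ?_ (le_max_right _ _)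
    rw [inv_eq_one_div]
    gcongr
    norm_num
  obtain ⟨x, hx⟩ := hFc.exists
  have h1 := hHd.apply_eq_of_tendsto_cocompact x hH0
  rw [hHh x hx] at h1
  obtain ⟨j, hj, hj0⟩ := Finset.prod_eq_zero_iff.1 h1
  have hj' := (Finset.mem_filter.1 hj).2
  rw [inv_eq_zero, sub_eq_zero] at hj0
  exact hrefl x hx j hj' ((hw x hx).2.1 ((hw x hx).2.2.trans hj0))

/-- The ordered regular fibres of a Morse polynomial form a path connected space. -/
theorem IsMorse.joinedIn {p : ℂ[X]} {N : ℕ} (hp : p.natDegree = N) (hN : 0 < N)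
    (hM : IsMorse p N) {z z' : Fin N → ℂ} (hz : z ∈ regularTuples p N)
    (hz' : z' ∈ regularTuples p N) : JoinedIn (regularTuples p N) z z' := by
  have ha : p.leadingCoeff ≠ 0 := leadingCoeff_ne_zero_of_natDegree (hp ▸ hN)
  have hp0 : 0 < p.natDegree := hp ▸ hN
  obtain ⟨t, Z, i, hZ, hZi, hall⟩ := exists_all_swapJoined hp hN hM
  have hZm := hZ.mem_regularTuples ha hZi
  have hperm : ∀ ρ : Equiv.Perm (Fin N), JoinedIn (regularTuples p N) Z (Z ∘ ρ) := by
    refine joinedIn_perm_of_swapJoined hZm fun j k => ?_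
    by_cases hjk : j = k
    · rw [hjk]; exact SwapJoined.refl hZm
    by_cases hik : i = k
    · rw [← hik]; exact (hall j).symm
    · exact (hall j).symm.trans (hall k) hik hjk
  suffices h : ∀ z ∈ regularTuples p N, JoinedIn (regularTuples p N) Z z from
    (h z hz).symm.trans (h z' hz')
  -- The values reachable from `Z` form an open set, closed relative to the connected complement of
  -- the finitely many critical values. The labelling of the fibre reached is then corrected by
  -- `hperm`.
  set T : Set ℂ := {t | ∃ z, RootTuple p p.leadingCoeff t z ∧ JoinedIn (regularTuples p N) Z z}
  have hinj : ∀ {z}, JoinedIn (regularTuples p N) Z z → Function.Injective z := fun h =>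
    h.target_mem.1
  have hTo : IsOpen T := by
    rw [isOpen_iff_mem_nhds]
    rintro s ⟨z, hz, hj⟩
    obtain ⟨Ψ, r, hr, hΨ0, hΨ⟩ := exists_section hp hN hz (hinj hj)
    filter_upwards [Metric.ball_mem_nhds s hr] with u hu
    refine ⟨Ψ u, (hΨ u hu).2.2, hj.trans ?_⟩
    rw [← hΨ0]
    exact joinedIn_section ha hΨ (Metric.mem_ball_self hr) hu
  have hpre : IsPreconnected ((criticalValues p)ᶜ) :=
    ((finite_criticalValues (derivative_ne_zero_of_natDegree hp0)).countable
      |>.isConnected_compl_of_one_lt_rank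
        (by rw [Complex.rank_real_complex]; norm_num)).isPreconnected
  have hsub : (criticalValues p)ᶜ ⊆ T := by
    refine hpre.subset_of_closure_inter_subset hTo
      ⟨t, (hZ.injective_iff ha).1 hZi, Z, hZ, JoinedIn.refl hZm⟩ ?_
    rintro s ⟨hs, hsc⟩
    obtain ⟨z, hz⟩ := exists_rootTuple hp hN s
    obtain ⟨Ψ, r, hr, hΨ0, hΨ⟩ := exists_section hp hN hz ((hz.injective_iff ha).2 hsc)
    obtain ⟨u, hu, ⟨z₁, hz₁, hj₁⟩⟩ := mem_closure_iff_nhds.1 hs _ (Metric.ball_mem_nhds s hr)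
    obtain ⟨ρ, rfl⟩ := (hΨ u hu).2.2.exists_perm ha hz₁
    refine ⟨z ∘ ρ, hz.comp_perm ρ, hj₁.trans (JoinedIn.comp_perm ?_ ρ)⟩
    rw [← hΨ0]
    exact joinedIn_section ha hΨ hu (Metric.mem_ball_self hr)
  intro z hz
  obtain ⟨s, hs, hsc⟩ := rootTuple_of_mem_regularTuples hp hN hz
  obtain ⟨z₁, hz₁, hj₁⟩ := hsub hsc
  obtain ⟨ρ, rfl⟩ := hz₁.exists_perm ha hs
  exact (hperm ρ).trans (JoinedIn.comp_perm hj₁ ρ)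

/-! ### Symmetric functions of the roots -/

lemma rootTuple_iff_eq {p : ℂ[X]} {a t : ℂ} {N : ℕ} {Z : Fin N → ℂ} :
    RootTuple p a t Z ↔ p - C t = C a * ∏ i, (X - C (Z i)) := by
  refine ⟨RootTuple.eq_poly, fun h x => ?_⟩
  have := congrArg (eval x) h
  simpa [eval_prod] using this

/-- A symmetric function of the roots of a polynomial is a polynomial function of the coefficients,
up to a power of the leading coefficient. -/
lemma exists_eval_symmetric {R : Type*} [CommRing R] {N : ℕ} (p : R[X])
    (Φ : MvPolynomial (Fin N) R) (hΦ : Φ.IsSymmetric) :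
    ∃ (k : ℕ) (r : R), ∀ (φ : R →+* ℂ) (Z : Fin N → ℂ),
      p.map φ = C (φ (p.coeff N)) * ∏ i, (X - C (Z i)) →
        φ r = φ (p.coeff N) ^ k * Φ.eval₂ φ Z := by
  obtain ⟨Ψ, hΨ⟩ := MvPolynomial.esymmAlgHom_surjective (σ := Fin N) (R := R) (n := N)
    (by simp) ⟨Φ, hΦ⟩
  have hΨ' : MvPolynomial.aeval (fun i : Fin N => MvPolynomial.esymm (Fin N) R (i + 1)) Ψ = Φ := by
    rw [← MvPolynomial.esymmAlgHom_apply, hΨ]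
  rw [← hΨ']
  clear hΨ' hΨ hΦ Φ
  -- By Vieta each elementary symmetric function costs one factor of the leading coefficient. In a
  -- sum, each summand is multiplied by the other's power to equalise the exponents.
  induction Ψ using MvPolynomial.induction_on with
  | C c => exact ⟨0, c, fun φ Z _ => by simp⟩
  | add A B hA hB =>
    obtain ⟨k, r, h⟩ := hA
    obtain ⟨l, s, h'⟩ := hB
    refine ⟨k + l, r * p.coeff N ^ l + s * p.coeff N ^ k, fun φ Z hZ => ?_⟩
    rw [map_add, map_mul, map_mul, h φ Z hZ, h' φ Z hZ, map_add, MvPolynomial.eval₂_add]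
    simp only [map_pow]
    ring
  | mul_X A i hA =>
    obtain ⟨k, r, h⟩ := hA
    refine ⟨k + 1, r * ((-1) ^ (i + 1 : ℕ) * p.coeff (N - (i + 1))), fun φ Z hZ => ?_⟩
    have h1 : φ (p.coeff (N - (i + 1))) = φ (p.coeff N) * ((-1) ^ (i + 1 : ℕ) *
        (MvPolynomial.esymm (Fin N) R (i + 1)).eval₂ φ Z) := by
      have h2 := congrArg (fun q => coeff q (N - (i + 1))) hZ
      simp only [coeff_map, coeff_C_mul] at h2
      rw [h2]
      have h3 : ∏ i, (X - C (Z i)) = (Multiset.map (fun a => X - C a)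
          (Multiset.map Z Finset.univ.val)).prod := by
        rw [Multiset.map_map]; rfl
      rw [h3, Multiset.prod_X_sub_C_coeff _ (by simp)]
      have h4 : (MvPolynomial.esymm (Fin N) R (i + 1)).eval₂ φ Z =
          (Multiset.map Z Finset.univ.val).esymm (i + 1) := by
        rw [Finset.esymm_map_val, MvPolynomial.esymm, MvPolynomial.eval₂_sum]
        refine Finset.sum_congr rfl fun s _ => ?_
        rw [MvPolynomial.eval₂_prod]
        simp
      rw [h4]
      simp only [Multiset.card_map, Finset.card_val, Finset.card_univ, Fintype.card_fin]
      have : N - (N - (i + 1)) = i + 1 := by have := i.2; omega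
      rw [this]
    rw [map_mul, h φ Z hZ, map_mul, map_mul, MvPolynomial.eval₂_mul, map_pow, map_neg, map_one, h1,
      MvPolynomial.aeval_X]
    have h5 : ((-1 : ℂ) ^ ((i : ℕ) + 1)) * (-1) ^ ((i : ℕ) + 1) = 1 := by
      rw [← mul_pow]; norm_num
    linear_combination (φ (p.coeff N) ^ k *
      (MvPolynomial.eval₂ φ Z
        (MvPolynomial.aeval (fun i : Fin N => MvPolynomial.esymm (Fin N) R (i + 1)) A)) *
      (φ (p.coeff N) * (MvPolynomial.esymm (Fin N) R (i + 1)).eval₂ φ Z)) * h5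

/-- The product over all `κ`-tuples of distinct roots of `p - s` of the integral of `q` is a
polynomial in `s`. -/
lemma exists_product_polynomial {R κ : Type*} [CommRing R] [Fintype κ] [DecidableEq κ] (N : ℕ)
    (hN : 0 < N) (p q : R[X]) (ω : κ → ℤ) :
    ∃ (k : ℕ) (Ξ : R[X]), ∀ (φ : R →+* ℂ) (t : ℂ) (Z : Fin N → ℂ),
      RootTuple (p.map φ) (φ (p.coeff N)) t Z →
        (Ξ.map φ).eval t = φ (p.coeff N) ^ k *
          ∏ σ : κ ↪ Fin N, ∑ i, (ω i : ℂ) * (q.map φ).eval (Z (σ i)) := by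
  set Φ : MvPolynomial (Fin N) R[X] := ∏ σ : κ ↪ Fin N, ∑ i,
    MvPolynomial.C (ω i : R[X]) * (Polynomial.aeval (MvPolynomial.X (σ i)) (q.map C)) with hΦ
  have hsym : Φ.IsSymmetric := by
    intro e
    rw [hΦ, map_prod]
    symm
    rw [← Equiv.prod_comp (Equiv.embeddingCongr (Equiv.refl κ) e)]
    refine Finset.prod_congr rfl fun σ _ => ?_
    symm
    rw [map_sum]
    refine Finset.sum_congr rfl fun i _ => ?_
    rw [map_mul, MvPolynomial.rename_C, ← Polynomial.aeval_algHom_apply, MvPolynomial.rename_X]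
    rfl
  -- The coefficient ring is `R[X]`, whose variable plays the part of the value `t`; the fibre over
  -- `t` consists of the roots of `p - t`.
  obtain ⟨k, Ξ, h⟩ := exists_eval_symmetric (p.map C - C X) Φ hsym
  refine ⟨k, Ξ, fun φ t Z hZ => ?_⟩
  set ψ : R[X] →+* ℂ := eval₂RingHom φ t with hψ
  have hc : (p.map C - C X).coeff N = C (p.coeff N) := by
    rw [coeff_sub, coeff_map, coeff_C_of_ne_zero hN.ne', sub_zero]
  have hψC : ψ.comp C = φ := by ext r; simp [hψ]
  have h1 : (p.map C - C X).map ψ = p.map φ - C t := by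
    rw [Polynomial.map_sub, Polynomial.map_map, hψC, Polynomial.map_C]
    simp [hψ]
  have h2 : ψ (C (p.coeff N)) = φ (p.coeff N) := by simp [hψ]
  have h3 := h ψ Z (by rw [h1, hc, h2]; exact hZ.eq_poly)
  rw [hc, h2] at h3
  rw [eval_map]
  refine h3.trans ?_
  congr 1
  rw [hΦ, MvPolynomial.eval₂_prod]
  refine Finset.prod_congr rfl fun σ _ => ?_
  rw [MvPolynomial.eval₂_sum]
  refine Finset.sum_congr rfl fun i _ => ?_
  rw [MvPolynomial.eval₂_mul, MvPolynomial.eval₂_C, map_intCast]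
  congr 1
  rw [← MvPolynomial.coe_eval₂Hom, Polynomial.aeval_def, Polynomial.hom_eval₂, eval₂_map, eval_map]
  congr 1
  · ext r; simp [hψ, MvPolynomial.algebraMap_eq]
  · simp

/-- The product over all critical points of a polynomial function of the critical values. -/
lemma exists_product_critical {R : Type*} [CommRing R] (N : ℕ) (p Ξ : R[X]) :
    ∃ (k : ℕ) (r : R), ∀ (φ : R →+* ℂ) (c : Fin N → ℂ),
      (p.map φ).derivative = C (φ (p.derivative.coeff N)) * ∏ i, (X - C (c i)) →
        φ r = φ (p.derivative.coeff N) ^ k *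
          ∏ i, (Ξ.map φ).eval ((p.map φ).eval (c i)) := by
  set Φ : MvPolynomial (Fin N) R := ∏ i, Polynomial.aeval (MvPolynomial.X i) (Ξ.comp p) with hΦ
  have hsym : Φ.IsSymmetric := by
    intro e
    rw [hΦ, map_prod, ← Equiv.prod_comp e (fun i => Polynomial.aeval (MvPolynomial.X i) _)]
    refine Finset.prod_congr rfl fun i _ => ?_
    rw [← Polynomial.aeval_algHom_apply, MvPolynomial.rename_X]
  obtain ⟨k, r, h⟩ := exists_eval_symmetric p.derivative Φ hsym
  refine ⟨k, r, fun φ c hc => ?_⟩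
  rw [h φ c (by rw [← derivative_map]; exact hc), hΦ, MvPolynomial.eval₂_prod]
  congr 1
  refine Finset.prod_congr rfl fun i _ => ?_
  rw [← MvPolynomial.coe_eval₂Hom, Polynomial.aeval_def, Polynomial.hom_eval₂]
  have : (MvPolynomial.eval₂Hom φ c).comp (algebraMap R (MvPolynomial (Fin N) R)) = φ := by
    ext r; simp [MvPolynomial.algebraMap_eq]
  rw [this, MvPolynomial.coe_eval₂Hom, MvPolynomial.eval₂_X, ← eval_comp, ← map_comp, eval_map]

/-- The product of the differences of the critical values. -/
lemma exists_product_critical_differences {R : Type*} [CommRing R] (N : ℕ) (p : R[X]) :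
    ∃ (k : ℕ) (r : R), ∀ (φ : R →+* ℂ) (c : Fin N → ℂ),
      (p.map φ).derivative = C (φ (p.derivative.coeff N)) * ∏ i, (X - C (c i)) →
        φ r = φ (p.derivative.coeff N) ^ k *
          ∏ i : Fin 2 ↪ Fin N, ((p.map φ).eval (c (i 0)) - (p.map φ).eval (c (i 1))) := by
  set Φ : MvPolynomial (Fin N) R := ∏ i : Fin 2 ↪ Fin N, (Polynomial.aeval (MvPolynomial.X (i 0)) p -
    Polynomial.aeval (MvPolynomial.X (i 1)) p) with hΦ
  have hsym : Φ.IsSymmetric := by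
    intro e
    rw [hΦ, map_prod]
    symm
    rw [← Equiv.prod_comp (Equiv.embeddingCongr (Equiv.refl (Fin 2)) e)]
    refine Finset.prod_congr rfl fun σ _ => ?_
    symm
    rw [map_sub, ← Polynomial.aeval_algHom_apply, MvPolynomial.rename_X,
      ← Polynomial.aeval_algHom_apply, MvPolynomial.rename_X]
    rfl
  obtain ⟨k, r, h⟩ := exists_eval_symmetric p.derivative Φ hsym
  refine ⟨k, r, fun φ c hc => ?_⟩
  rw [h φ c (by rw [← derivative_map]; exact hc), hΦ, MvPolynomial.eval₂_prod]
  congr 1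
  refine Finset.prod_congr rfl fun i _ => ?_
  have : (MvPolynomial.eval₂Hom φ c).comp (algebraMap R (MvPolynomial (Fin N) R)) = φ := by
    ext r; simp [MvPolynomial.algebraMap_eq]
  rw [MvPolynomial.eval₂_sub, ← MvPolynomial.coe_eval₂Hom, Polynomial.aeval_def,
    Polynomial.hom_eval₂, Polynomial.aeval_def, Polynomial.hom_eval₂, this,
    MvPolynomial.coe_eval₂Hom, MvPolynomial.eval₂_X, MvPolynomial.eval₂_X, eval_map, eval_map]

/-- A polynomial of degree `N + 1` whose critical points have distinct values is Morse. -/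
lemma isMorse_of_critical {p : ℂ[X]} {N : ℕ} (hp : p.natDegree = N + 1) {a : ℂ} {c : Fin N → ℂ}
    (ha : a ≠ 0) (hc : p.derivative = C a * ∏ i, (X - C (c i)))
    (hv : ∀ i j, i ≠ j → p.eval (c i) ≠ p.eval (c j)) : IsMorse p (N + 1) := by
  intro t Z hZ i j k l hij hkl h1 h2
  have hdp : ∀ x, p.derivative.eval x = a * ∏ i, (x - c i) := fun x => by
    rw [hc]; simp [eval_prod]
  have hcrit : ∀ x, p.derivative.eval x = 0 → ∃ i, x = c i := fun x hx => by
    rw [hdp] at hx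
    obtain ⟨i, -, hi⟩ := Finset.prod_eq_zero_iff.1 ((mul_eq_zero.1 hx).resolve_left ha)
    exact ⟨i, sub_eq_zero.1 hi⟩
  have hder : ∀ i j, i ≠ j → Z i = Z j → p.derivative.eval (Z i) = 0 := by
    intro i j hij h
    rw [hZ.eval_derivative, Finset.prod_eq_zero (Finset.mem_erase.2 ⟨Ne.symm hij,
      Finset.mem_univ j⟩) (sub_eq_zero.2 h), mul_zero]
  obtain ⟨u, hu⟩ := hcrit _ (hder i j hij h1)
  obtain ⟨v, hv'⟩ := hcrit _ (hder k l hkl h2)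
  have huv : u = v := by
    by_contra hne
    apply hv u v hne
    rw [← hu, ← hv', hZ.eval_root, hZ.eval_root]
  have hik : Z i = Z k := by rw [hu, hv', huv]
  have hlead : p.leadingCoeff ≠ 0 := leadingCoeff_ne_zero_of_natDegree (by omega)
  -- a triple point of the fibre would be a double critical point
  have htriple : ∀ b, b ≠ i → b ≠ j → Z b ≠ Z i := by
    intro b hbi hbj hb
    -- Distinct critical values force distinct critical points, so each is a simple zero of `p'`.
    have hdd : p.derivative.derivative.eval (Z i) ≠ 0 := by
      rw [hc, derivative_C_mul, ← Finset.mul_prod_erase _ _ (Finset.mem_univ u)]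
      simp only [derivative_mul, derivative_sub, derivative_X, derivative_C, sub_zero, one_mul,
        eval_mul, eval_C, eval_add, eval_sub, eval_X, eval_prod, hu, sub_self, zero_mul, add_zero]
      refine mul_ne_zero ha (Finset.prod_ne_zero_iff.2 fun w hw => sub_ne_zero.2 fun h => ?_)
      exact hv u w (Finset.mem_erase.1 hw).1.symm (by rw [h])
    apply hdd
    have h3 : p = C t + C p.leadingCoeff * ((X - C (Z i)) * ((X - C (Z i)) * ((X - C (Z i)) *
        ∏ w ∈ ((Finset.univ.erase i).erase j).erase b, (X - C (Z w))))) := by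
      have := hZ.eq_poly
      rw [← Finset.mul_prod_erase _ _ (Finset.mem_univ i),
        ← Finset.mul_prod_erase (Finset.univ.erase i) _
          (Finset.mem_erase.2 ⟨Ne.symm hij, Finset.mem_univ j⟩),
        ← Finset.mul_prod_erase ((Finset.univ.erase i).erase j) _
          (Finset.mem_erase.2 ⟨hbj, Finset.mem_erase.2 ⟨hbi, Finset.mem_univ b⟩⟩), ← h1, hb] at this
      rw [← this]; ring
    rw [h3]
    simp
  have hk : k = i ∨ k = j := by
    by_contra! h
    exact htriple k h.1 h.2 hik.symm
  have hl : l = i ∨ l = j := by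
    by_contra! h
    exact htriple l h.1 h.2 (h2 ▸ hik.symm)
  rcases hk with rfl | rfl <;> rcases hl with rfl | rfl
  · exact absurd rfl hkl
  · exact Or.inl ⟨rfl, rfl⟩
  · exact Or.inr ⟨rfl, rfl⟩
  · exact absurd rfl hkl

/-! ### Functions that are polynomial along lines -/

/-- The continuous functions on `E` that are polynomial along complex lines. -/
def lineFun (E : Type*) [AddCommGroup E] [Module ℂ E] [TopologicalSpace E] :
    Subalgebra ℂ (E → ℂ) where
  carrier := {F | Continuous F ∧ ∀ x y, ∃ Q : ℂ[X], ∀ u : ℂ, F (x + u • y) = Q.eval u}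
  mul_mem' := by
    rintro F G ⟨hF, hF'⟩ ⟨hG, hG'⟩
    refine ⟨hF.mul hG, fun x y => ?_⟩
    obtain ⟨Q, hQ⟩ := hF' x y
    obtain ⟨S, hS⟩ := hG' x y
    exact ⟨Q * S, fun u => by rw [Pi.mul_apply, hQ, hS, eval_mul]⟩
  add_mem' := by
    rintro F G ⟨hF, hF'⟩ ⟨hG, hG'⟩
    refine ⟨hF.add hG, fun x y => ?_⟩
    obtain ⟨Q, hQ⟩ := hF' x y
    obtain ⟨S, hS⟩ := hG' x y
    exact ⟨Q + S, fun u => by rw [Pi.add_apply, hQ, hS, eval_add]⟩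
  algebraMap_mem' := fun r => ⟨continuous_const, fun x y => ⟨C r, fun u => by simp⟩⟩

section lineFun

variable {E : Type*} [AddCommGroup E] [Module ℂ E] [TopologicalSpace E]

/-- Evaluation at a point. -/
def lineFun.evalAt (e : E) : lineFun E →+* ℂ :=
  (Pi.evalRingHom (fun _ : E => ℂ) e).comp (lineFun E).val.toRingHom

lemma lineFun.evalAt_apply (e : E) (F : lineFun E) : lineFun.evalAt e F = F.1 e := rfl

/-- A continuous linear form. -/
noncomputable def lineFun.ofLinear (L : E →L[ℂ] ℂ) : lineFun E :=
  ⟨L, L.continuous, fun x y => ⟨C (L x) + C (L y) * X, fun u => by simp; ring⟩⟩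

lemma eventually_eval_ne_zero {Q : ℂ[X]} (hQ : Q ≠ 0) (a : ℂ) : ∀ᶠ u in 𝓝[≠] a, Q.eval u ≠ 0 := by
  have : IsClosed ((Q.roots.toFinset : Set ℂ) \ {a}) :=
    (Q.roots.toFinset.finite_toSet.sdiff).isClosed
  have h1 : ((Q.roots.toFinset : Set ℂ) \ {a})ᶜ ∈ 𝓝 a := this.isOpen_compl.mem_nhds (by simp)
  filter_upwards [nhdsWithin_le_nhds h1, self_mem_nhdsWithin] with x hx hxc h0
  exact hx ⟨by simp [hQ, h0], hxc⟩

/-- Restricted to a line the function is a one-variable polynomial, not zero at `u₀`, so its zeros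
are finite in number. No other property of polynomial functions on coefficient space is used for
density. -/
lemma lineFun.eventually_ne_zero (F : lineFun E) {x y : E} {u₀ : ℂ}
    (h : lineFun.evalAt (x + u₀ • y) F ≠ 0) (a : ℂ) :
    ∀ᶠ u in 𝓝[≠] a, lineFun.evalAt (x + u • y) F ≠ 0 := by
  obtain ⟨Q, hQ⟩ := F.2.2 x y
  have hQ0 : Q ≠ 0 := by
    rintro rfl
    apply h
    rw [lineFun.evalAt_apply, hQ, eval_zero]
  filter_upwards [eventually_eval_ne_zero hQ0 a] with u hu
  rw [lineFun.evalAt_apply, hQ]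
  exact hu

variable [IsTopologicalAddGroup E] [ContinuousSMul ℂ E]

lemma lineFun.dense (F : lineFun E) {e : E} (he : lineFun.evalAt e F ≠ 0) :
    Dense {x | lineFun.evalAt x F ≠ 0} := by
  intro x
  have h := lineFun.eventually_ne_zero F (x := x) (y := e - x) (u₀ := 1) (by simpa using he) 0
  have ht : Tendsto (fun u : ℂ => x + u • (e - x)) (𝓝[≠] 0) (𝓝 x) := by
    have : Continuous fun u : ℂ => x + u • (e - x) := by fun_prop
    have := this.tendsto 0
    simp only [zero_smul, add_zero] at this
    exact this.mono_left nhdsWithin_le_nhds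
  exact mem_closure_of_tendsto ht h

end lineFun

/-! ### Genericity -/

lemma Generic.and {E : Type*} [TopologicalSpace E] {P Q : E → Prop} (hP : Generic P)
    (hQ : Generic Q) : Generic fun x => P x ∧ Q x := by
  obtain ⟨U, hU, hUd, hUP⟩ := hP
  obtain ⟨V, hV, hVd, hVQ⟩ := hQ
  exact ⟨U ∩ V, hU.inter hV, hUd.inter_of_isOpen_left hVd hU, fun x hx =>
    ⟨hUP x hx.1, hVQ x hx.2⟩⟩

lemma Generic.mono {E : Type*} [TopologicalSpace E] {P Q : E → Prop} (hP : Generic P)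
    (h : ∀ x, P x → Q x) : Generic Q := by
  obtain ⟨U, hU, hUd, hUP⟩ := hP
  exact ⟨U, hU, hUd, fun x hx => h x (hUP x hx)⟩

lemma Generic.of_forall {E : Type*} [TopologicalSpace E] {P : E → Prop} (h : ∀ x, P x) :
    Generic P := ⟨Set.univ, isOpen_univ, dense_univ, fun x _ => h x⟩

/-- The space of pairs of coefficient vectors. -/
abbrev CoeffPairs (m n : ℕ) : Type := (Fin (m + 1) → ℂ) × (Fin (n + 1) → ℂ)

lemma Generic.of_lineFun {m n : ℕ} (F : lineFun (CoeffPairs m n)) {e : CoeffPairs m n}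
    (he : lineFun.evalAt e F ≠ 0) :
    Generic fun x : PolySpace m × PolySpace n => lineFun.evalAt (x.1.1, x.2.1) F ≠ 0 := by
  have ho : ∀ d : ℕ, IsOpen {a : Fin (d + 1) → ℂ | a (Fin.last d) ≠ 0} := fun d =>
    isOpen_ne_fun (continuous_apply _) continuous_const
  refine ⟨Prod.map Subtype.val Subtype.val ⁻¹' {x | lineFun.evalAt x F ≠ 0}, ?_, ?_, fun x hx => hx⟩
  · exact (isOpen_ne_fun F.2.1 continuous_const).preimage
      (continuous_subtype_val.prodMap continuous_subtype_val)
  · exact (lineFun.dense F he).preimage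
      ((ho m).isOpenMap_subtype_val.prodMap (ho n).isOpenMap_subtype_val)

/-- The polynomial with given coefficients. -/
noncomputable def vecPoly {R : Type*} [CommRing R] {d : ℕ} (a : Fin (d + 1) → R) : R[X] :=
  ∑ i, C (a i) * X ^ (i : ℕ)

lemma poly_eq_vecPoly {d : ℕ} (a : PolySpace d) : a.poly = vecPoly a.1 := rfl

lemma vecPoly_map {R S : Type*} [CommRing R] [CommRing S] (φ : R →+* S) {d : ℕ}
    (a : Fin (d + 1) → R) : (vecPoly a).map φ = vecPoly fun i => φ (a i) := by
  simp [vecPoly, Polynomial.map_sum]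

lemma natDegree_vecPoly_le {R : Type*} [CommRing R] {d : ℕ} (a : Fin (d + 1) → R) :
    (vecPoly a).natDegree ≤ d := by
  refine natDegree_sum_le_of_forall_le _ _ fun i _ => ?_
  exact (natDegree_C_mul_X_pow_le _ _).trans (Nat.lt_succ_iff.1 i.2)

lemma coeff_vecPoly {R : Type*} [CommRing R] {d : ℕ} (a : Fin (d + 1) → R) (i : Fin (d + 1)) :
    (vecPoly a).coeff i = a i := by
  rw [vecPoly, finsetSum_coeff, Finset.sum_eq_single i]
  · simp
  · intro j _ hj
    rw [coeff_C_mul, coeff_X_pow, if_neg, mul_zero]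
    exact fun h => hj (Fin.ext h.symm)
  · simp

lemma vecPoly_coeff {R : Type*} [CommRing R] {d : ℕ} {p : R[X]} (hp : p.natDegree ≤ d) :
    vecPoly (fun i : Fin (d + 1) => p.coeff i) = p := by
  conv_rhs => rw [p.as_sum_range' (d + 1) (Nat.lt_succ_of_le hp)]
  rw [vecPoly, Finset.sum_range]
  simp [C_mul_X_pow_eq_monomial]

lemma vecPoly_smul {R : Type*} [CommRing R] {d : ℕ} (c : R) (a : Fin (d + 1) → R) :
    vecPoly (c • a) = C c * vecPoly a := by
  simp [vecPoly, Finset.mul_sum, mul_assoc]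

lemma natDegree_poly {d : ℕ} (a : PolySpace d) : a.poly.natDegree = d := by
  refine le_antisymm (natDegree_vecPoly_le _) (le_natDegree_of_ne_zero ?_)
  have := coeff_vecPoly a.1 (Fin.last d)
  rw [Fin.val_last] at this
  rw [poly_eq_vecPoly, this]
  exact a.2

/-- The universal first polynomial. -/
noncomputable def universalFst (m n : ℕ) : (lineFun (CoeffPairs m n))[X] :=
  vecPoly fun i : Fin (m + 1) => lineFun.ofLinear
    ((ContinuousLinearMap.proj i).comp (ContinuousLinearMap.fst ℂ _ _))

/-- The universal second polynomial. -/
noncomputable def universalSnd (m n : ℕ) : (lineFun (CoeffPairs m n))[X] :=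
  vecPoly fun i : Fin (n + 1) => lineFun.ofLinear
    ((ContinuousLinearMap.proj i).comp (ContinuousLinearMap.snd ℂ _ _))

lemma map_universalFst {m n : ℕ} (e : CoeffPairs m n) :
    (universalFst m n).map (lineFun.evalAt e) = vecPoly e.1 := by
  rw [universalFst, vecPoly_map]; rfl

lemma map_universalSnd {m n : ℕ} (e : CoeffPairs m n) :
    (universalSnd m n).map (lineFun.evalAt e) = vecPoly e.2 := by
  rw [universalSnd, vecPoly_map]; rfl

/-! ### Conditions on critical fibres -/

/-- No integral of `q` along a divisor with weights `ω` in a critical fibre of `p` vanishes. -/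
def NoCriticalZero {κ : Type*} [Fintype κ] (p q : ℂ[X]) (ω : κ → ℤ) (N : ℕ) : Prop :=
  ∀ (t : ℂ) (Z : Fin N → ℂ), RootTuple p p.leadingCoeff t Z → ¬ Function.Injective Z →
    ∀ σ : κ ↪ Fin N, ∑ i, (ω i : ℂ) * q.eval (Z (σ i)) ≠ 0

lemma leadingCoeff_map_eq {R : Type*} [CommRing R] {N : ℕ} {p : R[X]} (hp : p.natDegree ≤ N)
    {φ : R →+* ℂ} (h : φ (p.coeff N) ≠ 0) :
    (p.map φ).natDegree = N ∧ (p.map φ).leadingCoeff = φ (p.coeff N) := by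
  have h1 : (p.map φ).natDegree = N :=
    le_antisymm (natDegree_map_le.trans hp) (le_natDegree_of_ne_zero (by rwa [coeff_map]))
  exact ⟨h1, by rw [leadingCoeff, h1, coeff_map]⟩

lemma exists_critical_points {R : Type*} [CommRing R] {N : ℕ} (hN : 0 < N) {p : R[X]}
    (hp : p.natDegree ≤ N + 1) {φ : R →+* ℂ} (h : φ (p.coeff (N + 1)) ≠ 0) :
    φ (p.derivative.coeff N) ≠ 0 ∧ ∃ c : Fin N → ℂ,
      (p.map φ).derivative = C (φ (p.derivative.coeff N)) * ∏ i, (X - C (c i)) := by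
  have h1 : φ (p.derivative.coeff N) ≠ 0 := by
    rw [coeff_derivative, map_mul]
    refine mul_ne_zero h ?_
    rw [map_add, map_natCast, map_one]
    exact Nat.cast_add_one_ne_zero N
  refine ⟨h1, ?_⟩
  obtain ⟨h2, h3⟩ := leadingCoeff_map_eq (N := N) (p := p.derivative)
    ((natDegree_derivative_le p).trans (by omega)) h1
  obtain ⟨c, hc⟩ := exists_rootTuple h2 hN 0
  refine ⟨c, ?_⟩
  rw [derivative_map, ← h3]
  simpa using hc.eq_poly

/-- A resultant: the product of the integrals over all injections is a polynomial in the value, and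
`r` is its product over the critical values, up to powers of leading coefficients. The equivalence
lets one example prove that `r` is not identically zero. -/
lemma exists_noCriticalZero_iff {R κ : Type*} [CommRing R] [Fintype κ] {N : ℕ} (hN : 0 < N)
    (p q : R[X]) (hp : p.natDegree ≤ N + 1) (ω : κ → ℤ) :
    ∃ r : R, ∀ φ : R →+* ℂ, φ (p.coeff (N + 1)) ≠ 0 →
      (φ r ≠ 0 ↔ NoCriticalZero (p.map φ) (q.map φ) ω (N + 1)) := by
  classical
  obtain ⟨k, Ξ, hΞ⟩ := exists_product_polynomial (N + 1) N.succ_pos p q ω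
  obtain ⟨l, r, hr⟩ := exists_product_critical N p Ξ
  refine ⟨r, fun φ h => ?_⟩
  obtain ⟨h1, h2⟩ := leadingCoeff_map_eq hp h
  obtain ⟨h3, c, hc⟩ := exists_critical_points hN hp h
  have hcv : ∀ t, t ∈ criticalValues (p.map φ) ↔ ∃ i, (p.map φ).eval (c i) = t := by
    intro t
    constructor
    · rintro ⟨x, hx, rfl⟩
      rw [hc] at hx
      simp only [eval_mul, eval_C, eval_prod, eval_sub, eval_X, mul_eq_zero, h3, false_or] at hx
      obtain ⟨i, -, hi⟩ := Finset.prod_eq_zero_iff.1 hx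
      exact ⟨i, by rw [sub_eq_zero.1 hi]⟩
    · rintro ⟨i, rfl⟩
      refine ⟨c i, ?_, rfl⟩
      rw [hc]
      simp only [eval_mul, eval_C, eval_prod, eval_sub, eval_X, mul_eq_zero]
      exact Or.inr (Finset.prod_eq_zero (Finset.mem_univ i) (sub_self _))
  have hl0 : (p.map φ).leadingCoeff ≠ 0 := by rw [h2]; exact h
  rw [hr φ c hc]
  simp only [ne_eq, mul_eq_zero, not_or, Finset.prod_eq_zero_iff, Finset.mem_univ, true_and,
    not_exists]
  constructor
  · rintro ⟨-, h5⟩ t Z hZ hinj σ h0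
    rw [hZ.injective_iff hl0, not_not, hcv] at hinj
    obtain ⟨i, rfl⟩ := hinj
    apply h5 i
    rw [hΞ φ _ Z (by rw [← h2]; exact hZ), Finset.prod_eq_zero (Finset.mem_univ σ) h0, mul_zero]
  · intro h5
    refine ⟨fun h => h3 (eq_zero_of_pow_eq_zero h), fun i => ?_⟩
    obtain ⟨Z, hZ⟩ := exists_rootTuple h1 N.succ_pos ((p.map φ).eval (c i))
    rw [hΞ φ _ Z (by rw [← h2]; exact hZ)]
    refine mul_ne_zero (pow_ne_zero _ h) (Finset.prod_ne_zero_iff.2 fun σ _ => h5 _ Z hZ ?_ σ)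
    rw [hZ.injective_iff hl0, not_not, hcv]
    exact ⟨i, rfl⟩

/-- Here `r` is the product of the differences of the critical values, up to a power of the leading
coefficient. The second clause is the example showing that it is not identically zero: the critical
points of `X^(N+1) - X` are the `N` distinct solutions of `(N+1) c^N = 1`, and their values are
proportional to them. -/
lemma exists_isMorse {R : Type*} [CommRing R] {N : ℕ} (hN : 0 < N)
    (p : R[X]) (hp : p.natDegree ≤ N + 1) :
    ∃ r : R, (∀ φ : R →+* ℂ, φ (p.coeff (N + 1)) ≠ 0 → φ r ≠ 0 → IsMorse (p.map φ) (N + 1)) ∧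
      ∀ φ : R →+* ℂ, p.map φ = X ^ (N + 1) - X → φ r ≠ 0 := by
  classical
  obtain ⟨k, r, hr⟩ := exists_product_critical_differences N p
  refine ⟨r, fun φ h h0 => ?_, fun φ h => ?_⟩
  · obtain ⟨h1, h2⟩ := leadingCoeff_map_eq hp h
    obtain ⟨h3, c, hc⟩ := exists_critical_points hN hp h
    rw [hr φ c hc] at h0
    refine isMorse_of_critical h1 h3 hc fun i j hij he => ?_
    have hinj : Function.Injective ![i, j] := by
      intro a b hab
      fin_cases a <;> fin_cases b <;> simp_all
    have := Finset.prod_ne_zero_iff.1 (right_ne_zero_of_mul h0) ⟨![i, j], hinj⟩ (Finset.mem_univ _)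
    apply this
    simp [he]
  · have hlc : φ (p.coeff (N + 1)) = 1 := by
      rw [← coeff_map, h, coeff_sub, coeff_X_pow, if_pos rfl, coeff_X, if_neg (by omega), sub_zero]
    obtain ⟨h3, c, hc⟩ := exists_critical_points hN hp (φ := φ) (by rw [hlc]; exact one_ne_zero)
    rw [hr φ c hc]
    have hd : ∀ x : ℂ, (p.map φ).derivative.eval x = (N + 1 : ℂ) * x ^ N - 1 := by
      intro x; rw [h]; simp
    have hci : ∀ i, (N + 1 : ℂ) * c i ^ N = 1 := by
      intro i
      have : (p.map φ).derivative.eval (c i) = 0 := by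
        rw [hc]
        simp only [eval_mul, eval_C, eval_prod, eval_sub, eval_X, mul_eq_zero]
        exact Or.inr (Finset.prod_eq_zero (Finset.mem_univ i) (sub_self _))
      rw [hd] at this
      exact sub_eq_zero.1 this
    have hcinj : Function.Injective c := by
      have hRT : RootTuple (p.map φ).derivative (φ (p.derivative.coeff N)) 0 c :=
        rootTuple_iff_eq.2 (by rw [C_0, sub_zero]; exact hc)
      rw [hRT.injective_iff h3]
      rintro ⟨x, hx, hx0⟩
      rw [hd] at hx0
      have h5 : (p.map φ).derivative.derivative.eval x = (N + 1 : ℂ) * (N * x ^ (N - 1)) := by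
        rw [h]; simp [derivative_X_pow]
      rw [h5] at hx
      have hN' : (N : ℂ) ≠ 0 := by exact_mod_cast hN.ne'
      have hN1 : (N + 1 : ℂ) ≠ 0 := Nat.cast_add_one_ne_zero N
      have hx' : x = 0 := by
        have := (mul_eq_zero.1 ((mul_eq_zero.1 hx).resolve_left hN1)).resolve_left hN'
        exact eq_zero_of_pow_eq_zero this
      rw [hx', zero_pow hN.ne'] at hx0
      norm_num at hx0
    have hval : ∀ i, (p.map φ).eval (c i) * (N + 1) = -N * c i := by
      intro i
      rw [h]
      simp only [eval_sub, eval_pow, eval_X]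
      rw [pow_succ]
      linear_combination c i * hci i
    refine mul_ne_zero (pow_ne_zero _ h3) (Finset.prod_ne_zero_iff.2 fun σ _ => ?_)
    intro h0
    have h6 := hval (σ 0)
    rw [sub_eq_zero.1 h0, hval (σ 1)] at h6
    have hN' : (N : ℂ) ≠ 0 := by exact_mod_cast hN.ne'
    have h7 : c (σ 0) = c (σ 1) := mul_left_cancel₀ (neg_ne_zero.2 hN') h6.symm
    exact absurd (σ.injective (hcinj h7)) (by norm_num)

/-- There is a polynomial with no vanishing linear combination `∑ ωᵢ Zᵢ` in its critical fibres. -/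
lemma exists_noCriticalZero_X {κ : Type*} [Fintype κ] [Nonempty κ] (ω : κ → ℤ)
    (hω : ∀ i j, ∃ k, k ≠ i ∧ k ≠ j ∧ ω k ≠ 0) {N : ℕ} (hN : 0 < N) :
    ∃ p : ℂ[X], p.natDegree = N ∧ NoCriticalZero p X ω N := by
  classical
  -- the parametrisation of the exceptional polynomials
  set L : (Fin N × Fin N) × (κ ↪ Fin N) → ((Fin N → ℂ) →ₗ[ℂ] ℂ × ℂ) := fun d =>
    LinearMap.prod ((LinearMap.proj d.1.1 : (Fin N → ℂ) →ₗ[ℂ] ℂ) - LinearMap.proj d.1.2)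
      (∑ i, (ω i : ℂ) • (LinearMap.proj (d.2 i) : (Fin N → ℂ) →ₗ[ℂ] ℂ)) with hL
  have hLapp : ∀ d Z, L d Z = (Z d.1.1 - Z d.1.2, ∑ i, (ω i : ℂ) * Z (d.2 i)) := by
    intro d Z
    simp [hL]
  -- An exceptional monic polynomial is `∏ (X - Zᵢ) + t` with `Z` satisfying two linear conditions:
  -- a coincidence `Z_a = Z_b` and a vanishing combination. With `t` this gives `N - 1` complex
  -- parameters for `N` coefficients, so the images have too small a Hausdorff dimension to fill the
  -- space.
  set G : ∀ d : (Fin N × Fin N) × (κ ↪ Fin N), (LinearMap.ker (L d)) × ℂ → (Fin N → ℂ) :=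
    fun d u k => ((∏ i, (X - C (u.1.1 i))) + C u.2 : ℂ[X]).coeff k with hG
  have hsmooth : ∀ d, ContDiff ℝ 1 (G d) := by
    intro d
    rw [contDiff_pi]
    intro k
    have h1 : ∀ (s : Finset (Fin N)) (k : ℕ),
        ContDiff ℝ 1 fun u : (LinearMap.ker (L d)) × ℂ => (∏ i ∈ s, (X - C (u.1.1 i))).coeff k := by
      intro s
      induction s using Finset.induction_on with
      | empty => intro k; simpa using contDiff_const
      | insert a s ha ih =>
        intro k
        simp_rw [Finset.prod_insert ha, coeff_mul]
        refine ContDiff.sum fun x _ => ContDiff.mul ?_ (ih _)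
        simp_rw [coeff_sub, coeff_C]
        refine contDiff_const.sub ?_
        split_ifs
        · have : ContDiff ℝ 1 fun u : (LinearMap.ker (L d)) × ℂ => (u.1 : Fin N → ℂ) :=
            ((LinearMap.ker (L d)).subtypeL.restrictScalars ℝ).contDiff.comp contDiff_fst
          exact (contDiff_pi.1 this) a
        · exact contDiff_const
    simp only [hG, coeff_add, coeff_C]
    refine (h1 _ _).add ?_
    split_ifs
    · exact contDiff_snd
    · exact contDiff_const
  have hdim : ∀ d : (Fin N × Fin N) × (κ ↪ Fin N), d.1.1 ≠ d.1.2 →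
      dimH (Set.range (G d)) ≤ ((2 * N - 2 : ℕ) : ENNReal) := by
    intro d hd
    refine (hsmooth d).dimH_range_le.trans ?_
    have hsurj : LinearMap.range (L d) = ⊤ := by
      rw [LinearMap.range_eq_top]
      -- A nonzero weight placed at neither of the two coinciding entries makes the two conditions
      -- independent.
      obtain ⟨k, hka, hkb, hk0⟩ : ∃ k, d.2 k ≠ d.1.1 ∧ d.2 k ≠ d.1.2 ∧ ω k ≠ 0 := by
        by_cases h1 : ∃ i, d.2 i = d.1.1
        · obtain ⟨i, hi⟩ := h1
          by_cases h2 : ∃ j, d.2 j = d.1.2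
          · obtain ⟨j, hj⟩ := h2
            obtain ⟨k, h3, h4, h5⟩ := hω i j
            exact ⟨k, fun h => h3 (d.2.injective (h.trans hi.symm)),
              fun h => h4 (d.2.injective (h.trans hj.symm)), h5⟩
          · push Not at h2
            obtain ⟨k, h3, -, h5⟩ := hω i i
            exact ⟨k, fun h => h3 (d.2.injective (h.trans hi.symm)), h2 k, h5⟩
        · push Not at h1
          by_cases h2 : ∃ j, d.2 j = d.1.2
          · obtain ⟨j, hj⟩ := h2
            obtain ⟨k, -, h4, h5⟩ := hω j j
            exact ⟨k, h1 k, fun h => h4 (d.2.injective (h.trans hj.symm)), h5⟩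
          · push Not at h2
            obtain ⟨i⟩ := ‹Nonempty κ›
            obtain ⟨k, -, -, h5⟩ := hω i i
            exact ⟨k, h1 k, h2 k, h5⟩
      rintro ⟨x, y⟩
      have hk0' : (ω k : ℂ) ≠ 0 := by exact_mod_cast hk0
      refine ⟨Pi.single d.1.1 x + Pi.single (d.2 k) ((y - ∑ i, (ω i : ℂ) *
        (Pi.single d.1.1 x : Fin N → ℂ) (d.2 i)) / ω k), ?_⟩
      rw [hLapp]
      simp only [Pi.add_apply, mul_add, Finset.sum_add_distrib]
      refine Prod.ext ?_ ?_
      · simp [Pi.single_apply, hka.symm, hkb.symm, hd.symm]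
      · have : ∀ i, (ω i : ℂ) * (Pi.single (d.2 k) ((y - ∑ i, (ω i : ℂ) *
            (Pi.single d.1.1 x : Fin N → ℂ) (d.2 i)) / ω k) : Fin N → ℂ) (d.2 i) =
            if i = k then (y - ∑ i, (ω i : ℂ) *
            (Pi.single d.1.1 x : Fin N → ℂ) (d.2 i)) else 0 := by
          intro i
          by_cases hik : i = k
          · subst hik
            simp only [Pi.single_eq_same, if_true]
            field_simp
          · rw [if_neg hik, Pi.single_apply, if_neg (fun h => hik (d.2.injective h)), mul_zero]
        simp only [this]
        simp
    have h1 := LinearMap.finrank_range_add_finrank_ker (L d)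
    rw [hsurj, finrank_top, Module.finrank_prod, Module.finrank_self, Module.finrank_fin_fun] at h1
    rw [Module.finrank_prod, finrank_real_of_complex, Complex.finrank_real_complex]
    gcongr
    omega
  have hbad : dimH (⋃ d : {d : (Fin N × Fin N) × (κ ↪ Fin N) // d.1.1 ≠ d.1.2},
      Set.range (G d.1)) < Module.finrank ℝ (Fin N → ℂ) := by
    rw [dimH_iUnion]
    refine lt_of_le_of_lt (iSup_le fun d => hdim d.1 d.2) ?_
    rw [finrank_real_of_complex, Module.finrank_fin_fun]
    exact_mod_cast (by omega : 2 * N - 2 < 2 * N)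
  obtain ⟨c, hc⟩ := (dense_compl_of_dimH_lt_finrank hbad).nonempty
  have hq : (∑ i : Fin N, C (c i) * X ^ (i : ℕ)).degree < (N : WithBot ℕ) := by
    refine (Finset.sup_lt_iff (WithBot.bot_lt_coe N)).2 ?_ |>.trans_le' (degree_sum_le _ _)
    intro i _
    exact (degree_C_mul_X_pow_le _ _).trans_lt (WithBot.coe_lt_coe.2 i.2)
  set p : ℂ[X] := X ^ N + ∑ i : Fin N, C (c i) * X ^ (i : ℕ) with hp
  have hmon : p.Monic := monic_X_pow_add hq
  have hdeg : p.natDegree = N := by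
    rw [hp, natDegree_add_eq_left_of_degree_lt (by rwa [degree_X_pow]), natDegree_X_pow]
  refine ⟨p, hdeg, fun t Z hZ hinj σ h0 => ?_⟩
  simp only [Function.Injective, not_forall] at hinj
  obtain ⟨a, b, hab, hne⟩ := hinj
  apply hc
  rw [Set.mem_iUnion]
  refine ⟨⟨((a, b), σ), hne⟩, ⟨⟨Z, ?_⟩, t⟩, ?_⟩
  · rw [LinearMap.mem_ker, hLapp]
    simp only [eval_X] at h0
    simp [hab, h0]
  · funext k
    have h1 : ∏ i, (X - C (Z i)) + C t = p := by
      have := hZ.eq_poly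
      rw [hmon.leadingCoeff, C_1, one_mul] at this
      rw [← this]; ring
    simp only [hG]
    rw [h1, hp, coeff_add, coeff_X_pow, if_neg (by have := k.2; omega), zero_add, finsetSum_coeff,
      Finset.sum_eq_single k]
    · simp
    · intro j _ hj
      rw [coeff_C_mul, coeff_X_pow, if_neg, mul_zero]
      exact fun h => hj (Fin.ext h.symm)
    · simp

/-! ### Transfer of the conditions to generic pairs. -/

lemma NoCriticalZero.of_C_mul {κ : Type*} [Fintype κ] {p q : ℂ[X]} {ω : κ → ℤ} {N : ℕ} {c : ℂ}
    (h : NoCriticalZero p (C c * q) ω N) : NoCriticalZero p q ω N := by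
  intro t Z hZ hi σ h0
  apply h t Z hZ hi σ
  simp only [eval_mul, eval_C]
  have : ∑ i, (ω i : ℂ) * (c * q.eval (Z (σ i))) = c * ∑ i, (ω i : ℂ) * q.eval (Z (σ i)) := by
    rw [Finset.mul_sum]
    exact Finset.sum_congr rfl fun i _ => by ring
  rw [this, h0, mul_zero]

/-- On a fibre `p` is constant and the weights sum to 0, so adding `p` does not change the integral.
-/
lemma NoCriticalZero.add_self {κ : Type*} [Fintype κ] {p q : ℂ[X]} {ω : κ → ℤ} {N : ℕ}
    (hω : ∑ i, ω i = 0) (h : NoCriticalZero p q ω N) : NoCriticalZero p (p + q) ω N := by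
  intro t Z hZ hi σ h0
  apply h t Z hZ hi σ
  rw [← h0]
  simp only [eval_add, mul_add, Finset.sum_add_distrib]
  simp_rw [hZ.eval_root]
  rw [← Finset.sum_mul]
  have : ∑ i, (ω i : ℂ) = 0 := by exact_mod_cast hω
  rw [this, zero_mul, zero_add]

/-- The polynomials `f + g`, for the universal pair `(f, g)`. -/
noncomputable def universalSum (m n : ℕ) : (lineFun (CoeffPairs m n))[X] :=
  universalFst m n + universalSnd m n

lemma map_universalSum {m n : ℕ} (e : CoeffPairs m n) :
    (universalSum m n).map (lineFun.evalAt e) = vecPoly e.1 + vecPoly e.2 := by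
  rw [universalSum, Polynomial.map_add, map_universalFst, map_universalSnd]

lemma natDegree_universalSum_le (m n : ℕ) : (universalSum m n).natDegree ≤ max m n :=
  natDegree_add_le_of_le (natDegree_vecPoly_le _) (natDegree_vecPoly_le _)

lemma deform_eq_vecPoly {m n : ℕ} (x : PolySpace m × PolySpace n) (ε : ℂ) :
    deform x.1.poly x.2.poly ε = vecPoly x.1.1 + vecPoly (ε • x.2.1) := by
  rw [deform, vecPoly_smul]; rfl

lemma natDegree_deform_poly {m n : ℕ} (hmn : m ≠ n) (x : PolySpace m × PolySpace n) {ε : ℂ}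
    (hε : ε ≠ 0) : (deform x.1.poly x.2.poly ε).natDegree = max m n := by
  have h1 := natDegree_poly x.1
  have h2 : (C ε * x.2.poly).natDegree = n := by rw [natDegree_C_mul hε, natDegree_poly]
  rw [deform]
  rcases lt_or_gt_of_ne hmn with h | h
  · rw [natDegree_add_eq_right_of_natDegree_lt (by omega), h2, max_eq_right h.le]
  · rw [natDegree_add_eq_left_of_natDegree_lt (by omega), h1, max_eq_left h.le]

lemma evalAt_coeff_ne_zero {m n : ℕ} (hmn : m ≠ n) (x : PolySpace m × PolySpace n) {ε : ℂ}
    (hε : ε ≠ 0) : lineFun.evalAt (x.1.1, ε • x.2.1) ((universalSum m n).coeff (max m n)) ≠ 0 := by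
  have h := natDegree_deform_poly hmn x hε
  rw [← coeff_map, map_universalSum, ← deform_eq_vecPoly, ← h]
  rw [Ne, coeff_natDegree, leadingCoeff_eq_zero]
  intro h0
  rw [h0, natDegree_zero] at h
  omega

/-- A function that is polynomial along lines and not identically zero does not vanish at `(f, ε g)`
for generic `(f, g)` and small `ε ≠ 0`. -/
lemma Generic.eventually_of_lineFun {m n : ℕ} (F : lineFun (CoeffPairs m n)) {e : CoeffPairs m n}
    (he : lineFun.evalAt e F ≠ 0) :
    Generic fun x : PolySpace m × PolySpace n =>
      ∀ᶠ ε in 𝓝[≠] (0 : ℂ), lineFun.evalAt (x.1.1, ε • x.2.1) F ≠ 0 := by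
  refine (Generic.of_lineFun F he).mono fun x hx => ?_
  -- The pairs `(f, ε g)` lie on the line through `(f, 0)` with direction `(0, g)`, and the function
  -- does not vanish at `ε = 1`.
  have h := lineFun.eventually_ne_zero F (x := (x.1.1, 0)) (y := (0, x.2.1)) (u₀ := 1)
    (by simpa using hx) 0
  filter_upwards [h] with ε hε
  simpa using hε

/-- The vector of coefficients of a polynomial. -/
def coeffVec (d : ℕ) (p : ℂ[X]) : Fin (d + 1) → ℂ := fun i => p.coeff i

lemma vecPoly_coeffVec {d : ℕ} {p : ℂ[X]} (hp : p.natDegree ≤ d) : vecPoly (coeffVec d p) = p :=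
  vecPoly_coeff hp

lemma natDegree_X_pow_sub_X {N : ℕ} (hN : 1 < N) : (X ^ N - X : ℂ[X]).natDegree = N := by
  rw [natDegree_sub_eq_left_of_natDegree_lt (by simpa using hN), natDegree_X_pow]

lemma generic_eventually_isMorse {m n : ℕ} (hmn : m ≠ n) (hN : 1 < max m n) :
    Generic fun x : PolySpace m × PolySpace n =>
      ∀ᶠ ε in 𝓝[≠] (0 : ℂ), IsMorse (deform x.1.poly x.2.poly ε) (max m n) := by
  obtain ⟨N, hN'⟩ : ∃ N, max m n = N + 1 := ⟨max m n - 1, by omega⟩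
  obtain ⟨r, hr, hr'⟩ := exists_isMorse (N := N) (by omega) (universalSum m n)
    (hN' ▸ natDegree_universalSum_le m n)
  -- The whole polynomial goes into the slot of larger degree. The example may leave the other slot
  -- zero, since `F` is defined on all coefficient vectors.
  obtain ⟨e, he⟩ : ∃ e : CoeffPairs m n, vecPoly e.1 + vecPoly e.2 = X ^ (N + 1) - X := by
    have hd := natDegree_X_pow_sub_X (N := N + 1) (by omega)
    rcases lt_or_gt_of_ne hmn with h | h
    · refine ⟨(coeffVec m 0, coeffVec n (X ^ (N + 1) - X)), ?_⟩
      rw [vecPoly_coeffVec (by simp), vecPoly_coeffVec (by omega), zero_add]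
    · refine ⟨(coeffVec m (X ^ (N + 1) - X), coeffVec n 0), ?_⟩
      rw [vecPoly_coeffVec (by omega), vecPoly_coeffVec (by simp), add_zero]
  refine (Generic.eventually_of_lineFun r (hr' _ ((map_universalSum e).trans he))).mono
    fun x hx => ?_
  filter_upwards [hx, self_mem_nhdsWithin] with ε hε hε0
  have := hr _ (hN' ▸ evalAt_coeff_ne_zero hmn x hε0) hε
  rw [map_universalSum, ← deform_eq_vecPoly] at this
  rwa [hN']

lemma generic_eventually_noCriticalZero {κ : Type*} [Fintype κ] [Nonempty κ] {ω : κ → ℤ}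
    (hω : ∀ i j, ∃ k, k ≠ i ∧ k ≠ j ∧ ω k ≠ 0) (hω0 : ∑ i, ω i = 0) {m n : ℕ} (hm : 0 < m)
    (hn : 0 < n) (hmn : m ≠ n) :
    Generic fun x : PolySpace m × PolySpace n =>
      ∀ᶠ ε in 𝓝[≠] (0 : ℂ),
        NoCriticalZero (deform x.1.poly x.2.poly ε) x.2.poly ω (max m n) := by
  obtain ⟨N, hN'⟩ : ∃ N, max m n = N + 1 := ⟨max m n - 1, by omega⟩
  obtain ⟨r, hr⟩ := exists_noCriticalZero_iff (N := N) (by omega) (universalSum m n)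
    (universalSnd m n) (hN' ▸ natDegree_universalSum_le m n) ω
  obtain ⟨p, hp, hpX⟩ := exists_noCriticalZero_X ω hω (N := N + 1) (by omega)
  -- If `m > n` the second polynomial is `X`. If `m < n` it must carry `p` as well, and `p + X` has
  -- the same integrals as `X` over the fibres of `p`.
  obtain ⟨e, he, he2⟩ : ∃ e : CoeffPairs m n, vecPoly e.1 + vecPoly e.2 = p ∧
      NoCriticalZero p (vecPoly e.2) ω (N + 1) := by
    have h1 := natDegree_sub_le p X
    have h2 := natDegree_add_le p X
    rw [natDegree_X] at h1 h2
    rcases lt_or_gt_of_ne hmn with h | h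
    · refine ⟨(coeffVec m (-X), coeffVec n (p + X)), ?_⟩
      rw [vecPoly_coeffVec (by rw [natDegree_neg, natDegree_X]; omega),
        vecPoly_coeffVec (by omega)]
      exact ⟨by ring, hpX.add_self hω0⟩
    · refine ⟨(coeffVec m (p - X), coeffVec n X), ?_⟩
      rw [vecPoly_coeffVec (by omega), vecPoly_coeffVec (by rw [natDegree_X]; omega)]
      exact ⟨by ring, hpX⟩
  have hne : lineFun.evalAt e r ≠ 0 := by
    refine (hr _ ?_).2 ?_
    · rw [← coeff_map, map_universalSum, he, ← hp, coeff_natDegree]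
      exact leadingCoeff_ne_zero_of_natDegree (by omega)
    · rw [map_universalSum, he, map_universalSnd]
      exact he2
  refine (Generic.eventually_of_lineFun r hne).mono fun x hx => ?_
  filter_upwards [hx, self_mem_nhdsWithin] with ε hε hε0
  have := (hr _ (hN' ▸ evalAt_coeff_ne_zero hmn x hε0)).1 hε
  rw [map_universalSum, ← deform_eq_vecPoly, map_universalSnd] at this
  rw [hN']
  have h3 : vecPoly (ε • x.2.1) = C ε * x.2.poly := vecPoly_smul _ _
  rw [h3] at this
  exact this.of_C_mul

lemma generic_isMorse_fst {m : ℕ} (n : ℕ) (hm : 1 < m) :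
    Generic fun x : PolySpace m × PolySpace n => IsMorse x.1.poly m := by
  obtain ⟨N, rfl⟩ : ∃ N, m = N + 1 := ⟨m - 1, by omega⟩
  obtain ⟨r, hr, hr'⟩ := exists_isMorse (N := N) (by omega) (universalFst (N + 1) n)
    (natDegree_vecPoly_le _)
  refine (Generic.of_lineFun r (e := (coeffVec _ (X ^ (N + 1) - X), 0)) (hr' _ ?_)).mono
    fun x hx => ?_
  · rw [map_universalFst, vecPoly_coeffVec (natDegree_X_pow_sub_X (by omega)).le]
  · have := hr _ ?_ hx
    · rwa [map_universalFst] at this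
    · rw [← coeff_map, map_universalFst]
      have h2 := coeff_vecPoly x.1.1 (Fin.last _)
      rw [Fin.val_last] at h2
      rw [h2]
      exact x.1.2

lemma generic_noCriticalZero_fst {κ : Type*} [Fintype κ] [Nonempty κ] {ω : κ → ℤ}
    (hω : ∀ i j, ∃ k, k ≠ i ∧ k ≠ j ∧ ω k ≠ 0) {m n : ℕ} (hm : 1 < m) (hn : 0 < n) :
    Generic fun x : PolySpace m × PolySpace n => NoCriticalZero x.1.poly x.2.poly ω m := by
  obtain ⟨N, rfl⟩ : ∃ N, m = N + 1 := ⟨m - 1, by omega⟩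
  obtain ⟨r, hr⟩ := exists_noCriticalZero_iff (N := N) (by omega) (universalFst (N + 1) n)
    (universalSnd (N + 1) n) (natDegree_vecPoly_le _) ω
  obtain ⟨p, hp, hpX⟩ := exists_noCriticalZero_X ω hω (N := N + 1) (by omega)
  refine (Generic.of_lineFun r (e := (coeffVec _ p, coeffVec _ X)) ((hr _ ?_).2 ?_)).mono
    fun x hx => ?_
  · rw [← coeff_map, map_universalFst, vecPoly_coeffVec hp.le, ← hp, coeff_natDegree]
    exact leadingCoeff_ne_zero_of_natDegree (by omega)
  · rw [map_universalFst, map_universalSnd, vecPoly_coeffVec hp.le,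
      vecPoly_coeffVec (by rw [natDegree_X]; omega)]
    exact hpX
  · have := (hr _ ?_).1 hx
    · rwa [map_universalFst, map_universalSnd] at this
    · rw [← coeff_map, map_universalFst]
      have h2 := coeff_vecPoly x.1.1 (Fin.last _)
      rw [Fin.val_last] at h2
      rw [h2]
      exact x.1.2

/-! ### Behaviour at infinity -/

/-- The polynomial `lⁿ q(x / l)`. -/
noncomputable def scalePoly (q : ℂ[X]) (n : ℕ) (l : ℂ) : ℂ[X] :=
  ∑ i ∈ Finset.range (n + 1), C (q.coeff i * l ^ (n - i)) * X ^ i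

lemma coeff_scalePoly (q : ℂ[X]) (n : ℕ) (l : ℂ) (k : ℕ) :
    (scalePoly q n l).coeff k = if k ∈ Finset.range (n + 1) then q.coeff k * l ^ (n - k) else 0 := by
  rw [scalePoly, finsetSum_coeff]
  simp_rw [coeff_C_mul, coeff_X_pow]
  simp

lemma natDegree_scalePoly_le (q : ℂ[X]) (n : ℕ) (l : ℂ) : (scalePoly q n l).natDegree ≤ n :=
  natDegree_sum_le_of_forall_le _ _ fun _ hi =>
    (natDegree_C_mul_X_pow_le _ _).trans (Nat.lt_succ_iff.1 (Finset.mem_range.1 hi))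

lemma eval_scalePoly {q : ℂ[X]} {n : ℕ} (hq : q.natDegree ≤ n) {l : ℂ} (hl : l ≠ 0) (x : ℂ) :
    (scalePoly q n l).eval x = l ^ n * q.eval (x / l) := by
  rw [scalePoly, eval_finsetSum, eval_eq_sum_range' (Nat.lt_succ_of_le hq), Finset.mul_sum]
  refine Finset.sum_congr rfl fun i hi => ?_
  have hi' : i ≤ n := Nat.lt_succ_iff.1 (Finset.mem_range.1 hi)
  have : l ^ n = l ^ i * l ^ (n - i) := by rw [← pow_add]; congr 1; omega
  simp only [eval_mul, eval_C, eval_pow, eval_X]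
  rw [this, div_pow]
  field_simp

lemma polyTendsto_scalePoly (q : ℂ[X]) (n : ℕ) :
    PolyTendsto (scalePoly q n) (𝓝 0) (C (q.coeff n) * X ^ n) n := by
  refine ⟨fun i => ?_, Eventually.of_forall fun l => natDegree_scalePoly_le q n l,
    natDegree_C_mul_X_pow_le _ _⟩
  simp_rw [coeff_scalePoly, coeff_C_mul, coeff_X_pow]
  rcases lt_trichotomy i n with h | rfl | h
  · have h1 : i ∈ Finset.range (n + 1) := Finset.mem_range.2 (by omega)
    simp only [h1, if_true, if_neg h.ne, mul_zero]
    have : Continuous fun l : ℂ => q.coeff i * l ^ (n - i) := by fun_prop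
    have := this.tendsto 0
    rwa [zero_pow (by omega), mul_zero] at this
  · simp
  · have h1 : i ∉ Finset.range (n + 1) := fun h2 => by have := Finset.mem_range.1 h2; omega
    simp only [h1, if_false, if_neg h.ne', mul_zero]
    exact tendsto_const_nhds

/-- Along rescaled points, a polynomial behaves as its leading term. -/
lemma tendsto_scaled_eval {α : Type*} {l : Filter α} {P : α → ℂ[X]} {p : ℂ[X]} {n : ℕ}
    (h : PolyTendsto P l p n) {lam x : α → ℂ} {v : ℂ} (hl0 : ∀ᶠ y in l, lam y ≠ 0)
    (hl : Tendsto lam l (𝓝 0)) (hx : Tendsto (fun y => lam y * x y) l (𝓝 v)) :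
    Tendsto (fun y => lam y ^ n * (P y).eval (x y)) l (𝓝 (p.coeff n * v ^ n)) := by
  have h1 : Tendsto (fun y => ∑ i ∈ Finset.range (n + 1),
      (P y).coeff i * (lam y * x y) ^ i * lam y ^ (n - i)) l
      (𝓝 (∑ i ∈ Finset.range (n + 1), p.coeff i * v ^ i * 0 ^ (n - i))) :=
    tendsto_finsetSum _ fun i _ => ((h.coeff i).mul (hx.pow _)).mul (hl.pow _)
  rw [Finset.sum_range_succ, Finset.sum_eq_zero, zero_add, Nat.sub_self, pow_zero, mul_one] at h1
  · refine h1.congr' ?_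
    filter_upwards [h.deg, hl0] with y hy hy0
    rw [eval_eq_sum_range' (Nat.lt_succ_of_le hy), Finset.mul_sum]
    refine Finset.sum_congr rfl fun i hi => ?_
    have hi' : i ≤ n := Nat.lt_succ_iff.1 (Finset.mem_range.1 hi)
    have : lam y ^ n = lam y ^ i * lam y ^ (n - i) := by rw [← pow_add]; congr 1; omega
    rw [this, mul_pow]
    ring
  · intro i hi
    rw [zero_pow (by have := Finset.mem_range.1 hi; omega), mul_zero]

lemma polyTendsto_const {α : Type*} {l : Filter α} {p : ℂ[X]} {n : ℕ} (h : p.natDegree ≤ n) :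
    PolyTendsto (fun _ : α => p) l p n :=
  ⟨fun _ => tendsto_const_nhds, Eventually.of_forall fun _ => h, h⟩

/-- The cone over the affine chart. -/
def affineCone {m : ℕ} (A : Set (Fin m → ℂ)) : Set ((Fin m → ℂ) × ℂ) :=
  {v | ∃ a ∈ A, ∃ l : ℂ, l ≠ 0 ∧ v = (l • a, l)}

lemma smul_mem_closure_affineCone {m : ℕ} {A : Set (Fin m → ℂ)} {x : (Fin m → ℂ) × ℂ}
    (hx : x ∈ closure (affineCone A)) {c : ℂ} (hc : c ≠ 0) : c • x ∈ closure (affineCone A) := by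
  refine map_mem_closure (continuous_const_smul c) hx ?_
  rintro _ ⟨a, ha, l, hl, rfl⟩
  exact ⟨a, ha, c * l, mul_ne_zero hc hl, by simp [smul_smul]⟩

lemma mk_mem_projectiveClosure {m : ℕ} {A : Set (Fin m → ℂ)} {x : (Fin m → ℂ) × ℂ}
    (hx : x ∈ closure (affineCone A)) (h0 : x ≠ 0) :
    Projectivization.mk ℂ x h0 ∈ projectiveClosure A := by
  obtain ⟨u, hu⟩ := Projectivization.exists_smul_eq_mk_rep ℂ x h0
  change (Projectivization.mk ℂ x h0).rep ∈ closure (affineCone A)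
  rw [← hu]
  exact smul_mem_closure_affineCone hx u.ne_zero

lemma RootTuple.smul_pow {a T c : ℂ} {m : ℕ} {v : Fin m → ℂ} (hc : c ≠ 0)
    (h : RootTuple (C a * X ^ m) a T v) : RootTuple (C a * X ^ m) a (c ^ m * T) (c • v) := by
  intro x
  have h1 := h (x / c)
  simp only [eval_mul, eval_C, eval_pow, eval_X] at h1 ⊢
  have h3 : ∏ i, (x - (c • v) i) = c ^ m * ∏ i, (x / c - v i) := by
    have : c ^ m = ∏ _i : Fin m, c := by simp
    rw [this, ← Finset.prod_mul_distrib]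
    refine Finset.prod_congr rfl fun i _ => ?_
    rw [Pi.smul_apply, smul_eq_mul]
    field_simp
  rw [h3]
  rw [div_pow] at h1
  have h4 : a * x ^ m - c ^ m * T = c ^ m * (a * (x ^ m / c ^ m) - T) := by
    have hcm : c ^ m ≠ 0 := pow_ne_zero _ hc
    field_simp
  rw [h4, h1]
  ring

/-- The power sums of the vertices of a regular polygon vanish. -/
lemma RootTuple.sum_pow_eq_zero {a T : ℂ} {m n : ℕ} (ha : a ≠ 0) (hm : 0 < m) {v : Fin m → ℂ}
    (h : RootTuple (C a * X ^ m) a T v) (hmn : ¬ m ∣ n) : ∑ j, v j ^ n = 0 := by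
  set ζ := Complex.exp (2 * Real.pi * Complex.I / m)
  have hζ : IsPrimitiveRoot ζ m := Complex.isPrimitiveRoot_exp m hm.ne'
  -- Rotation by `ζ` permutes the vertices and multiplies the power sum by `ζⁿ ≠ 1`.
  have h1 := h.smul_pow (c := ζ) (hζ.ne_zero hm.ne')
  rw [hζ.pow_eq_one, one_mul] at h1
  obtain ⟨ρ, hρ⟩ := h.exists_perm ha h1
  have h2 : ∑ j, (ζ • v) j ^ n = ∑ j, v j ^ n := by
    rw [hρ]
    exact Equiv.sum_comp ρ fun j => v j ^ n
  simp only [Pi.smul_apply, smul_eq_mul, mul_pow, ← Finset.mul_sum] at h2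
  have h3 : (ζ ^ n - 1) * ∑ j, v j ^ n = 0 := by rw [sub_mul, h2]; ring
  refine (mul_eq_zero.1 h3).resolve_left fun h4 => hmn ?_
  exact hζ.dvd_of_pow_eq_one n (sub_eq_zero.1 h4)

/-- The points at infinity of the connection curve. -/
lemma mem_closure_connection {p : ℂ[X]} {m : ℕ} (hp : p.natDegree = m) (hm : 0 < m) {T : ℂ}
    {v : Fin m → ℂ} (h : RootTuple (C p.leadingCoeff * X ^ m) p.leadingCoeff T v) (hv : v ≠ 0) :
    ((v, 0) : (Fin m → ℂ) × ℂ) ∈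
      closure (affineCone {z | Function.Injective z ∧ ∀ i j, p.eval (z i) = p.eval (z j)}) := by
  have ha : p.leadingCoeff ≠ 0 := leadingCoeff_ne_zero_of_natDegree (hp ▸ hm)
  have hac : p.coeff m = p.leadingCoeff := by rw [leadingCoeff, hp]
  have hdeg : ∀ l, (scalePoly p m l).coeff m = p.leadingCoeff := fun l => by
    rw [coeff_scalePoly, if_pos (Finset.mem_range.2 m.lt_succ_self), Nat.sub_self, pow_zero,
      mul_one, hac]
  have hnd : ∀ l, (scalePoly p m l).natDegree = m := fun l =>
    le_antisymm (natDegree_scalePoly_le p m l) (le_natDegree_of_ne_zero (by rw [hdeg]; exact ha))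
  have hlc : ∀ l, (scalePoly p m l).leadingCoeff = p.leadingCoeff := fun l => by
    rw [leadingCoeff, hnd, hdeg]
  -- The fibre over `T` of `lᵐ p(x / l)`: the points `l⁻¹ Y l` lie in one fibre of `p`, and as `l →
  -- 0` the cone points `(Y l, l)` accumulate at `(v, 0)` after a relabelling.
  choose Y hY using fun l => exists_rootTuple (hnd l) hm T
  have hPT := (polyTendsto_scalePoly p m).mono (nhdsWithin_le_nhds (s := {0}ᶜ))
  obtain ⟨R, hR⟩ := hPT.exists_bound hm (by simpa [hac] using ha) ‖T‖
  obtain ⟨U, hU⟩ := exists_ultrafilter_le (𝓝[≠] (0 : ℂ))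
  obtain ⟨v', hv'⟩ := exists_tendsto_of_norm_le U Y (max R 0) (by
    filter_upwards [hU hR] with l hl
    refine (pi_norm_le_iff_of_nonneg (le_max_right _ _)).2 fun i => ?_
    exact (hl (Y l i) T le_rfl ((hY l).eval_root i)).trans (le_max_left _ _))
  have hRT : RootTuple (C p.leadingCoeff * X ^ m) p.leadingCoeff T v' := by
    refine RootTuple.of_tendsto (P := scalePoly p m) (fun x => ?_) tendsto_const_nhds
      tendsto_const_nhds hv' (Eventually.of_forall fun l => ?_)
    · rw [← hac]; exact (hPT.mono hU).eval_const x
    · have := hY l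
      rwa [hlc] at this
  obtain ⟨ρ, rfl⟩ := hRT.exists_perm ha h
  have hvi := (h.pow_injective ha hv).1
  have hYρ : Tendsto (fun l => Y l ∘ ρ) U (𝓝 (v' ∘ ρ)) :=
    tendsto_pi_nhds.2 fun i => (tendsto_pi_nhds.1 hv') (ρ i)
  have hlim : Tendsto (fun l => (Y l ∘ ρ, l)) U (𝓝 (v' ∘ ρ, (0 : ℂ))) :=
    hYρ.prodMk_nhds (tendsto_id.mono_left (hU.trans nhdsWithin_le_nhds))
  refine mem_closure_of_tendsto hlim ?_
  have h1 : ∀ᶠ l in (U : Filter ℂ), Function.Injective (Y l ∘ ρ) :=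
    hYρ.eventually (isOpen_setOf_injective.mem_nhds hvi)
  filter_upwards [h1, hU self_mem_nhdsWithin] with l hl hl0
  have hl0' : l ≠ 0 := hl0
  refine ⟨l⁻¹ • (Y l ∘ ρ), ⟨fun i j hij => hl ?_, fun i j => ?_⟩, l, hl0', ?_⟩
  · simpa [hl0'] using hij
  · have h2 : ∀ k, l ^ m * p.eval ((l⁻¹ • (Y l ∘ ρ)) k) = T := fun k => by
      rw [← (hY l).eval_root (ρ k), eval_scalePoly hp.le hl0']
      simp [div_eq_inv_mul]
    exact mul_left_cancel₀ (pow_ne_zero m hl0') ((h2 i).trans (h2 j).symm)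
  · rw [smul_smul, mul_inv_cancel₀ hl0', one_smul]

/-- The points at infinity of the zero hypersurface. -/
lemma mem_closure_zero {q : ℂ[X]} {m n : ℕ} (hq : q.natDegree = n) (hn : 0 < n) {w : Fin m → ℤ}
    {j₀ : Fin m} (hw : w j₀ ≠ 0) {v : Fin m → ℂ} (hv : ∑ j, (w j : ℂ) * v j ^ n = 0) :
    ((v, 0) : (Fin m → ℂ) × ℂ) ∈ closure (affineCone {z | integral w q z = 0}) := by
  classical
  have hb : q.leadingCoeff ≠ 0 := leadingCoeff_ne_zero_of_natDegree (hq ▸ hn)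
  have hbc : q.coeff n = q.leadingCoeff := by rw [leadingCoeff, hq]
  have hdeg : ∀ l, (scalePoly q n l).coeff n = q.leadingCoeff := fun l => by
    rw [coeff_scalePoly, if_pos (Finset.mem_range.2 n.lt_succ_self), Nat.sub_self, pow_zero,
      mul_one, hbc]
  have hnd : ∀ l, (scalePoly q n l).natDegree = n := fun l =>
    le_antisymm (natDegree_scalePoly_le q n l) (le_natDegree_of_ne_zero (by rw [hdeg]; exact hb))
  have hlc : ∀ l, (scalePoly q n l).leadingCoeff = q.leadingCoeff := fun l => by
    rw [leadingCoeff, hnd, hdeg]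
  have hw' : (w j₀ : ℂ) ≠ 0 := by exact_mod_cast hw
  -- All coordinates of `v` but the one at `j₀` are kept. `S l` is the value that the rescaled
  -- polynomial must take at the remaining one for the integral to vanish.
  set S : ℂ → ℂ := fun l => -(∑ j ∈ Finset.univ.erase j₀, (w j : ℂ) * (scalePoly q n l).eval (v j)) /
    w j₀ with hS
  choose Y hY using fun l => exists_rootTuple (hnd l) hn (S l)
  have hPT := (polyTendsto_scalePoly q n).mono (nhdsWithin_le_nhds (s := {0}ᶜ))
  have hS0 : Tendsto S (𝓝[≠] 0) (𝓝 (q.leadingCoeff * v j₀ ^ n)) := by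
    have h1 : Tendsto S (𝓝[≠] 0) (𝓝 (-(∑ j ∈ Finset.univ.erase j₀, (w j : ℂ) *
        (C (q.coeff n) * X ^ n).eval (v j)) / w j₀)) :=
      ((tendsto_finsetSum _ fun j _ => (hPT.eval_const (v j)).const_mul _).neg).div_const _
    convert h1 using 2
    rw [← Finset.add_sum_erase _ _ (Finset.mem_univ j₀)] at hv
    simp only [eval_mul, eval_C, eval_pow, eval_X, hbc]
    rw [eq_div_iff hw']
    have : ∑ j ∈ Finset.univ.erase j₀, (w j : ℂ) * (q.leadingCoeff * v j ^ n) =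
        q.leadingCoeff * ∑ j ∈ Finset.univ.erase j₀, (w j : ℂ) * v j ^ n := by
      rw [Finset.mul_sum]
      exact Finset.sum_congr rfl fun j _ => by ring
    rw [this]
    linear_combination q.leadingCoeff * hv
  obtain ⟨R, hR⟩ := hPT.exists_bound hn (by simpa [hbc] using hb) (‖q.leadingCoeff * v j₀ ^ n‖ + 1)
  obtain ⟨U, hU⟩ := exists_ultrafilter_le (𝓝[≠] (0 : ℂ))
  have hSb : ∀ᶠ l in 𝓝[≠] (0 : ℂ), ‖S l‖ ≤ ‖q.leadingCoeff * v j₀ ^ n‖ + 1 :=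
    (hS0.norm.eventually (gt_mem_nhds (lt_add_one _))).mono fun l hl => hl.le
  obtain ⟨y, hy⟩ := exists_tendsto_of_norm_le U Y (max R 0) (by
    filter_upwards [hU hR, hU hSb] with l hl hl2
    refine (pi_norm_le_iff_of_nonneg (le_max_right _ _)).2 fun i => ?_
    exact (hl (Y l i) _ hl2 ((hY l).eval_root i)).trans (le_max_left _ _))
  have hRT : RootTuple (C q.leadingCoeff * X ^ n) q.leadingCoeff (q.leadingCoeff * v j₀ ^ n) y := by
    refine RootTuple.of_tendsto (P := scalePoly q n) (fun x => ?_) tendsto_const_nhds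
      (hS0.mono_left hU) hy (Eventually.of_forall fun l => ?_)
    · rw [← hbc]; exact (hPT.mono hU).eval_const x
    · have := hY l
      rwa [hlc] at this
  obtain ⟨k, hk⟩ := hRT.exists_index hb (x := v j₀) (by simp)
  have hlim : Tendsto (fun l => (Function.update v j₀ (Y l k), l)) U (𝓝 (v, (0 : ℂ))) := by
    refine Tendsto.prodMk_nhds ?_ (tendsto_id.mono_left (hU.trans nhdsWithin_le_nhds))
    have h1 : Tendsto (fun l => Function.update v j₀ (Y l k)) U
        (𝓝 (Function.update v j₀ (v j₀))) :=
      tendsto_const_nhds.update j₀ (hk ▸ (tendsto_pi_nhds.1 hy) k)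
    rwa [Function.update_eq_self] at h1
  refine mem_closure_of_tendsto hlim ?_
  filter_upwards [hU self_mem_nhdsWithin] with l hl0
  have hl0' : l ≠ 0 := hl0
  refine ⟨l⁻¹ • Function.update v j₀ (Y l k), ?_, l, hl0', ?_⟩
  · change integral w q _ = 0
    have h1 : l ^ n * integral w q (l⁻¹ • Function.update v j₀ (Y l k)) = 0 := by
      rw [integral, Finset.mul_sum]
      have h2 : ∀ j, l ^ n * ((w j : ℂ) * q.eval ((l⁻¹ • Function.update v j₀ (Y l k)) j)) =
          (w j : ℂ) * (scalePoly q n l).eval (Function.update v j₀ (Y l k) j) := fun j => by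
        rw [eval_scalePoly hq.le hl0', Pi.smul_apply, smul_eq_mul, div_eq_inv_mul]; ring
      simp_rw [h2]
      rw [← Finset.add_sum_erase _ _ (Finset.mem_univ j₀), Function.update_self,
        (hY l).eval_root k, hS]
      have h3 : ∑ j ∈ Finset.univ.erase j₀, (w j : ℂ) *
          (scalePoly q n l).eval (Function.update v j₀ (Y l k) j) =
          ∑ j ∈ Finset.univ.erase j₀, (w j : ℂ) * (scalePoly q n l).eval (v j) :=
        Finset.sum_congr rfl fun j hj => by
          rw [Function.update_of_ne (Finset.mem_erase.1 hj).1]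
      rw [h3]
      field_simp
      ring
    exact (mul_eq_zero.1 h1).resolve_left (pow_ne_zero n hl0')
  · rw [smul_smul, mul_inv_cancel₀ hl0', one_smul]

/-- Regularity at infinity means that there are no common points at infinity. -/
theorem RegularAtInfinity.sum_pow_ne_zero {p q : ℂ[X]} {m n : ℕ} {w : Fin m → ℤ}
    (hR : RegularAtInfinity p q w) (hp : p.natDegree = m) (hm : 0 < m) (hq : q.natDegree = n)
    (hn : 0 < n) (hmn : ¬ m ∣ n) {j₁ : Fin m} (hw : w j₁ ≠ 0) {T : ℂ} {v : Fin m → ℂ}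
    (h : RootTuple (C p.leadingCoeff * X ^ m) p.leadingCoeff T v) (hv : v ≠ 0) :
    ∑ j, (w j : ℂ) * v j ^ n ≠ 0 := by
  classical
  intro h0
  have ha : p.leadingCoeff ≠ 0 := leadingCoeff_ne_zero_of_natDegree (hp ▸ hm)
  have hac : p.coeff m = p.leadingCoeff := by rw [leadingCoeff, hp]
  have hb : q.coeff n ≠ 0 := by
    rw [← hq, coeff_natDegree]; exact leadingCoeff_ne_zero_of_natDegree (hq ▸ hn)
  set j₀ : Fin m := ⟨0, hm⟩
  -- The competing cycle. At a polygon `u` its sum is `m u_{j₀}ⁿ - ∑ uⱼⁿ = m u_{j₀}ⁿ ≠ 0`, so it has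
  -- no point at infinity and the minimal number is 0.
  set w' : Fin m → ℤ := fun j => if j = j₀ then (m : ℤ) - 1 else -1 with hw'
  have hw'm : ∀ F : Fin m → ℂ, ∑ j, (w' j : ℂ) * F j = m * F j₀ - ∑ j, F j := by
    intro F
    have : ∀ j, (w' j : ℂ) * F j = (if j = j₀ then m * F j else 0) - F j := by
      intro j
      simp only [hw']
      split_ifs
      · push_cast; ring
      · push_cast; ring
    simp_rw [this, Finset.sum_sub_distrib]
    simp
  have hw'0 : ∑ j, w' j = 0 := by
    have := hw'm fun _ => 1
    simp only [mul_one, Finset.sum_const, Finset.card_univ, Fintype.card_fin, nsmul_eq_mul,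
      sub_self] at this
    exact_mod_cast this
  have hempty : connectionCurve p m ∩ zeroHypersurface w' q ∩ hyperplaneAtInfinity m = ∅ := by
    rw [Set.eq_empty_iff_forall_notMem]
    rintro P ⟨⟨h1, h2⟩, h3⟩
    change P.rep ∈ closure (affineCone _) at h1
    change P.rep ∈ closure (affineCone _) at h2
    change P.rep.2 = 0 at h3
    set u := P.rep.1 with hu
    have hrep : P.rep = (u, 0) := Prod.ext rfl h3
    have hu0 : u ≠ 0 := by
      intro h4
      apply P.rep_nonzero
      rw [hrep, h4]; rfl
    rw [hrep, mem_closure_iff_ultrafilter] at h1 h2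
    have hcone : ∀ (A : Set (Fin m → ℂ)) (V : Ultrafilter ((Fin m → ℂ) × ℂ)),
        affineCone A ∈ V → ↑V ≤ 𝓝 ((u, 0) : (Fin m → ℂ) × ℂ) →
        (∀ᶠ y in (V : Filter ((Fin m → ℂ) × ℂ)), y.2 ≠ 0) ∧ Tendsto (fun y : (Fin m → ℂ) × ℂ => y.2) V (𝓝 0) ∧
        Tendsto (fun y : (Fin m → ℂ) × ℂ => y.2 • (y.2⁻¹ • y.1)) V (𝓝 u) ∧
        ∀ᶠ y in (V : Filter ((Fin m → ℂ) × ℂ)), y.2⁻¹ • y.1 ∈ A := by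
      intro A V hA hV
      have hA' : ∀ᶠ y in (V : Filter ((Fin m → ℂ) × ℂ)), y ∈ affineCone A := hA
      have hne : ∀ᶠ y in (V : Filter ((Fin m → ℂ) × ℂ)), y.2 ≠ 0 := by
        filter_upwards [hA'] with y hy
        obtain ⟨a, ha, l, hl, rfl⟩ := hy
        exact hl
      refine ⟨hne, (continuous_snd.tendsto _).mono_left hV, ?_, ?_⟩
      · refine ((continuous_fst.tendsto _).mono_left hV).congr' ?_
        filter_upwards [hne] with y hy
        rw [smul_smul, mul_inv_cancel₀ hy, one_smul]
      · filter_upwards [hA'] with y hy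
        obtain ⟨a, ha, l, hl, rfl⟩ := hy
        simpa [smul_smul, hl] using ha
    obtain ⟨V, hV, hVn⟩ := h1
    obtain ⟨g1, g2, g3, g4⟩ := hcone _ V hV hVn
    obtain ⟨T₀, -, hT₀⟩ := RootTuple.of_tendsto_scaled (a := p.leadingCoeff)
      (A := fun _ => p.leadingCoeff)
      (T := fun y : (Fin m → ℂ) × ℂ => p.eval ((y.2⁻¹ • y.1) j₀))
      (polyTendsto_const hp.le) tendsto_const_nhds (Eventually.of_forall fun _ => hac) g1 g2 g3
      (g4.mono fun y hy => rootTuple_of_injective hp hm hy.1 fun i => hy.2 i j₀)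
    obtain ⟨V', hV', hVn'⟩ := h2
    obtain ⟨f1, f2, f3, f4⟩ := hcone _ V' hV' hVn'
    have h5 : Tendsto (fun y : (Fin m → ℂ) × ℂ => ∑ j, (w' j : ℂ) *
        (y.2 ^ n * q.eval ((y.2⁻¹ • y.1) j))) V' (𝓝 (∑ j, (w' j : ℂ) * (q.coeff n * u j ^ n))) :=
      tendsto_finsetSum _ fun j _ => (tendsto_scaled_eval (polyTendsto_const hq.le) f1 f2
        ((tendsto_pi_nhds.1 f3) j)).const_mul _
    have h6 : ∑ j, (w' j : ℂ) * (q.coeff n * u j ^ n) = 0 := by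
      refine tendsto_nhds_unique h5 (tendsto_const_nhds.congr' ?_)
      filter_upwards [f4] with y hy
      have hy' : ∑ j, (w' j : ℂ) * q.eval ((y.2⁻¹ • y.1) j) = 0 := hy
      calc (0 : ℂ) = y.2 ^ n * ∑ j, (w' j : ℂ) * q.eval ((y.2⁻¹ • y.1) j) := by rw [hy', mul_zero]
        _ = _ := by
          rw [Finset.mul_sum]
          exact Finset.sum_congr rfl fun j _ => by ring
    rw [hw'm, ← Finset.mul_sum, hT₀.sum_pow_eq_zero ha hm hmn, mul_zero, sub_zero] at h6
    have hm' : (m : ℂ) ≠ 0 := by exact_mod_cast hm.ne'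
    have h7 : u j₀ = 0 :=
      eq_zero_of_pow_eq_zero ((mul_eq_zero.1 ((mul_eq_zero.1 h6).resolve_left hm')).resolve_left hb)
    have h8 := hT₀.eval_root j₀
    rw [h7] at h8
    apply (hT₀.pow_injective ha hu0).2
    rw [← h8]
    simp [hm.ne']
  have hle := hR w' hw'0
  rw [hempty, Set.encard_empty, nonpos_iff_eq_zero, Set.encard_eq_zero] at hle
  have hx0 : ((v, 0) : (Fin m → ℂ) × ℂ) ≠ 0 := fun h => hv (congrArg Prod.fst h)
  have hmem : Projectivization.mk ℂ _ hx0 ∈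
      connectionCurve p m ∩ zeroHypersurface w q ∩ hyperplaneAtInfinity m := by
    refine ⟨⟨mk_mem_projectiveClosure (mem_closure_connection hp hm h hv) hx0,
      mk_mem_projectiveClosure (mem_closure_zero hq hn hw h0) hx0⟩, ?_⟩
    obtain ⟨u, hu⟩ := Projectivization.exists_smul_eq_mk_rep ℂ _ hx0
    change (Projectivization.mk ℂ _ hx0).rep.2 = 0
    rw [← hu]
    simp
  rw [hle] at hmem
  exact hmem

/-! ### Zeros of a polynomial family are locally unique outside finitely many parameters -/

/-- The polynomial `P(e, ·)`. -/
noncomputable def specialize (P : ℂ[X][X]) (e : ℂ) : ℂ[X] := P.map (evalRingHom e)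

/-- Since `D` is continuous in all three variables, a nonzero derivative at one point excludes two
nearby zeros for every nearby parameter. -/
lemma exists_continuous_divided_difference (P : ℂ[X][X]) :
    ∃ D : ℂ × ℂ × ℂ → ℂ, Continuous D ∧
      (∀ e x y, (specialize P e).eval x - (specialize P e).eval y = (x - y) * D (e, x, y)) ∧
      ∀ e x, D (e, x, x) = (specialize P e).derivative.eval x := by
  refine ⟨fun u => ∑ i ∈ Finset.range (P.natDegree + 1), (P.coeff i).eval u.1 *
    ∑ k ∈ Finset.range i, u.2.1 ^ k * u.2.2 ^ (i - 1 - k), ?_, fun e x y => ?_, fun e x => ?_⟩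
  · refine continuous_finsetSum _ fun i _ => ?_
    exact ((P.coeff i).continuous.comp continuous_fst).mul
      (continuous_finsetSum _ fun k _ => by fun_prop)
  · have h : ∀ x, (specialize P e).eval x =
        ∑ i ∈ Finset.range (P.natDegree + 1), (P.coeff i).eval e * x ^ i := fun x => by
      rw [specialize, eval_map, eval₂_eq_sum_range]; rfl
    rw [h, h, ← Finset.sum_sub_distrib, Finset.mul_sum]
    refine Finset.sum_congr rfl fun i _ => ?_
    have := (Commute.all x y).geom_sum₂_mul i
    rw [← mul_sub, ← this]
    ring
  · have h : (specialize P e).derivative.eval x =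
        ∑ i ∈ Finset.range (P.natDegree + 1), (P.coeff i).eval e * (i * x ^ (i - 1)) := by
      have h1 : specialize P e =
          ∑ i ∈ Finset.range (P.natDegree + 1), C ((P.coeff i).eval e) * X ^ i := by
        conv_lhs => rw [specialize, P.as_sum_range]
        simp [Polynomial.map_sum, ← C_mul_X_pow_eq_monomial]
      rw [h1, derivative_sum, eval_finsetSum]
      refine Finset.sum_congr rfl fun i _ => ?_
      simp [derivative_X_pow]
    rw [h]
    refine Finset.sum_congr rfl fun i _ => ?_
    congr 1
    rw [Finset.sum_congr rfl (g := fun _ => x ^ (i - 1))]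
    · simp
    · intro k hk
      have := Finset.mem_range.1 hk
      change x ^ k * x ^ (i - 1 - k) = _
      rw [← pow_add]; congr 1; omega

lemma exists_clear_denominators (Q : (FractionRing ℂ[X])[X]) :
    ∃ (d : ℂ[X]) (Q₀ : ℂ[X][X]), d ≠ 0 ∧
      Q₀.map (algebraMap ℂ[X] (FractionRing ℂ[X])) = C (algebraMap _ _ d) * Q := by
  obtain ⟨b, hbM, hb⟩ := IsLocalization.integerNormalization_spec (nonZeroDivisors ℂ[X]) Q
  refine ⟨b, _, nonZeroDivisors.ne_zero hbM, hb.trans ?_⟩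
  rw [Algebra.smul_def, Polynomial.algebraMap_apply]

/-- The zeros of `P(e, ·)` are locally unique, uniformly in `e`, outside finitely many values of
the parameter. -/
theorem exists_finite_locally_unique {P : ℂ[X][X]} (hP : P ≠ 0) :
    ∃ F : Finset ℂ, ∀ e₀ ∉ F, ∀ t₀ : ℂ, ∀ᶠ u : ℂ × ℂ × ℂ in 𝓝 (e₀, t₀, t₀),
      (specialize P u.1).eval u.2.1 = 0 → (specialize P u.1).eval u.2.2 = 0 → u.2.1 = u.2.2 := by
  classical
  set K := FractionRing ℂ[X]
  set φ := algebraMap ℂ[X] K with hφ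
  have hinj : Function.Injective φ := IsFractionRing.injective _ _
  have hminj : Function.Injective (Polynomial.map φ) := Polynomial.map_injective _ hinj
  have : CharZero K := charZero_of_injective_algebraMap hinj
  set PK := P.map φ
  have hPK : PK ≠ 0 := (Polynomial.map_ne_zero_iff hinj).2 hP
  -- The squarefree part of `P` over the field of rational functions of the parameter. It is
  -- separable in characteristic 0, so a Bézout identity `u S + v S' = 1` holds.
  set S := UniqueFactorizationMonoid.radical PK with hS
  have hsep : S.Separable :=
    PerfectField.separable_iff_squarefree.2 UniqueFactorizationMonoid.squarefree_radical
  obtain ⟨N, A, hA⟩ := UniqueFactorizationMonoid.exists_dvd_radical_self_pow hPK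
  obtain ⟨u, v, huv⟩ := hsep
  obtain ⟨d, S₀, hd, hS₀⟩ := exists_clear_denominators S
  obtain ⟨a, A₀, ha, hA₀⟩ := exists_clear_denominators A
  obtain ⟨b, U₀, hb, hU₀⟩ := exists_clear_denominators u
  obtain ⟨c, V₀, hc, hV₀⟩ := exists_clear_denominators v
  change S₀.map φ = C (φ d) * S at hS₀
  change A₀.map φ = C (φ a) * A at hA₀
  change U₀.map φ = C (φ b) * u at hU₀
  change V₀.map φ = C (φ c) * v at hV₀
  have e1 : P * A₀ * C (d ^ N) = C a * S₀ ^ N := by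
    apply hminj
    simp only [Polynomial.map_mul, Polynomial.map_pow, hA₀, hS₀, Polynomial.map_C, mul_pow,
      map_pow]
    change PK * (C (φ a) * A) * C (φ d) ^ N = C (φ a) * (C (φ d) ^ N * S ^ N)
    rw [hA]; ring
  have e2 : C c * U₀ * S₀ + C b * V₀ * derivative S₀ = C (b * c * d) := by
    apply hminj
    simp only [Polynomial.map_mul, Polynomial.map_add, hU₀, hS₀, hV₀, Polynomial.map_C,
      ← derivative_map, derivative_C_mul, map_mul]
    change C (φ c) * (C (φ b) * u) * (C (φ d) * S) +
      C (φ b) * (C (φ c) * v) * (C (φ d) * derivative S) = C (φ b) * C (φ c) * C (φ d)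
    linear_combination C (φ b) * C (φ c) * C (φ d) * huv
  -- Away from the roots of the denominators cleared, `e1` turns zeros of `P` into zeros of `S₀`,
  -- and `e2` makes these simple.
  refine ⟨(a * b * c * d).roots.toFinset, fun e₀ he₀ t₀ => ?_⟩
  have hne : (a * b * c * d).eval e₀ ≠ 0 := by
    intro h
    apply he₀
    rw [Multiset.mem_toFinset, mem_roots (by simp [ha, hb, hc, hd])]
    exact h
  have hae : ∀ᶠ w : ℂ × ℂ × ℂ in 𝓝 (e₀, t₀, t₀), a.eval w.1 ≠ 0 := by
    have : ContinuousAt (fun w : ℂ × ℂ × ℂ => a.eval w.1) (e₀, t₀, t₀) :=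
      (a.continuous.comp continuous_fst).continuousAt
    refine this.eventually_ne ?_
    simp only [eval_mul] at hne
    exact left_ne_zero_of_mul (left_ne_zero_of_mul (left_ne_zero_of_mul hne))
  have hzero : ∀ e t, a.eval e ≠ 0 → (specialize P e).eval t = 0 →
      (specialize S₀ e).eval t = 0 := by
    intro e t h1 h2
    have h3 := congrArg (fun Q => (specialize Q e).eval t) e1
    simp only [specialize, Polynomial.map_mul, Polynomial.map_pow, Polynomial.map_C, eval_mul,
      eval_pow, eval_C, coe_evalRingHom] at h3 h2 ⊢
    rw [h2, zero_mul, zero_mul] at h3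
    exact eq_zero_of_pow_eq_zero ((mul_eq_zero.1 h3.symm).resolve_left h1)
  obtain ⟨D, hD, hD1, hD2⟩ := exists_continuous_divided_difference S₀
  by_cases h0 : (specialize S₀ e₀).eval t₀ = 0
  · have hDne : D (e₀, t₀, t₀) ≠ 0 := by
      rw [hD2]
      intro h4
      have h3 := congrArg (fun Q => (specialize Q e₀).eval t₀) e2
      simp only [specialize, Polynomial.map_mul, Polynomial.map_add, Polynomial.map_C, eval_mul,
        eval_add, eval_C, coe_evalRingHom, ← derivative_map] at h3 h4 h0 hne
      rw [h4, h0, mul_zero, mul_zero, add_zero] at h3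
      apply hne
      linear_combination -(eval e₀ a) * h3
    filter_upwards [hae, hD.continuousAt.eventually_ne hDne] with w h1 h2 h3 h4
    have h5 := hD1 w.1 w.2.1 w.2.2
    rw [hzero _ _ h1 h3, hzero _ _ h1 h4, sub_zero] at h5
    exact sub_eq_zero.1 ((mul_eq_zero.1 h5.symm).resolve_right h2)
  · have hcont : ContinuousAt (fun w : ℂ × ℂ × ℂ => (specialize S₀ w.1).eval w.2.1)
        (e₀, t₀, t₀) := by
      have : (fun w : ℂ × ℂ × ℂ => (specialize S₀ w.1).eval w.2.1) =
          fun w => ∑ i ∈ Finset.range (S₀.natDegree + 1), (S₀.coeff i).eval w.1 * w.2.1 ^ i := by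
        funext w
        rw [specialize, eval_map, eval₂_eq_sum_range]; rfl
      rw [this]
      refine Continuous.continuousAt (continuous_finsetSum _ fun i _ => ?_)
      exact ((S₀.coeff i).continuous.comp continuous_fst).mul (by fun_prop)
    filter_upwards [hae, hcont.eventually_ne h0] with w h1 h2 h3 _
    exact absurd (hzero _ _ h1 h3) h2

/-! ### Lifting of rays -/

/-- Around one limit point a sphere of small radius avoids the finite set `A`. For small `s` the
curve does not meet the sphere, and it is sometimes inside, so by the intermediate value theorem it
stays inside. -/
lemma exists_tendsto_of_finite_limits {V : Type*} [NormedAddCommGroup V] [ProperSpace V]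
    {Z : ℝ → V} {R : ℝ} {A : Set V} (hc : ContinuousOn Z (Set.Ioc 0 1))
    (hb : ∀ s ∈ Set.Ioc (0 : ℝ) 1, ‖Z s‖ ≤ R) (hA : A.Finite)
    (h : ∀ (U : Ultrafilter ℝ) (z : V), ↑U ≤ 𝓝[>] (0 : ℝ) → Tendsto Z U (𝓝 z) → z ∈ A) :
    ∃ z ∈ A, Tendsto Z (𝓝[>] 0) (𝓝 z) := by
  have hIoc : ∀ᶠ s in 𝓝[>] (0 : ℝ), s ∈ Set.Ioc (0 : ℝ) 1 := Ioc_mem_nhdsGT one_pos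
  have hlim : ∀ U : Ultrafilter ℝ, ↑U ≤ 𝓝[>] (0 : ℝ) → ∃ z ∈ A, Tendsto Z U (𝓝 z) := by
    intro U hU
    obtain ⟨z, hz⟩ := exists_tendsto_of_norm_le U Z R (hU (hIoc.mono hb))
    exact ⟨z, h U z hU hz, hz⟩
  obtain ⟨U₀, hU₀⟩ := exists_ultrafilter_le (𝓝[>] (0 : ℝ))
  obtain ⟨a, ha, hZa⟩ := hlim U₀ hU₀
  refine ⟨a, ha, ?_⟩
  rw [Metric.tendsto_nhds]
  intro δ hδ
  obtain ⟨r, hr, hrA⟩ : ∃ r ∈ Set.Ioo 0 δ, r ∉ (fun x => dist x a) '' A := by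
    by_contra! hcon
    exact (Set.Ioo_infinite hδ) ((hA.image _).subset hcon)
  have hne : ∀ᶠ s in 𝓝[>] (0 : ℝ), dist (Z s) a ≠ r := by
    refine eventually_of_forall_ultrafilter fun U hU hbad => ?_
    obtain ⟨z, hz, hZz⟩ := hlim U hU
    apply hrA
    refine ⟨z, hz, ?_⟩
    refine tendsto_nhds_unique (hZz.dist tendsto_const_nhds) (tendsto_const_nhds.congr' ?_)
    filter_upwards [hbad] with s hs
    exact (not_not.1 hs).symm
  obtain ⟨η, hη, hηs⟩ := mem_nhdsGT_iff_exists_Ioo_subset.1 (hne.and hIoc)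
  obtain ⟨s₁, hs₁, hs₁'⟩ : ∃ s ∈ Set.Ioo 0 η, dist (Z s) a < r := by
    have h1 : ∀ᶠ s in (U₀ : Filter ℝ), dist (Z s) a < r :=
      (Metric.tendsto_nhds.1 hZa) r hr.1
    have h2 : ∀ᶠ s in (U₀ : Filter ℝ), s ∈ Set.Ioo 0 η := hU₀ (Ioo_mem_nhdsGT hη)
    obtain ⟨s, hs⟩ := (h2.and h1).exists
    exact ⟨s, hs⟩
  filter_upwards [Ioo_mem_nhdsGT hη] with s hs
  refine lt_of_not_ge fun hge => ?_
  have hcd : ContinuousOn (fun s => dist (Z s) a) (Set.Ioo 0 η) :=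
    continuous_dist.comp_continuousOn
      ((hc.mono fun s hs => (hηs hs).2).prodMk continuousOn_const)
  obtain ⟨s₂, hs₂, hs₂'⟩ := isPreconnected_Ioo.intermediate_value hs₁ hs hcd
    ⟨hs₁'.le, hr.2.le.trans hge⟩
  exact (hηs hs₂).1 hs₂'

/-- Rays in the parameter plane can be lifted to a set that is proper, open and locally injective
over a punctured disc. -/
theorem exists_lift_ray {V : Type*} [NormedAddCommGroup V] [ProperSpace V] {S : Set (V × ℂ)}
    {ρ R : ℝ} (hbdd : ∀ x ∈ S, ‖x.2‖ < ρ → ‖x.1‖ ≤ R)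
    (hclosed : ∀ x ∈ closure S, ‖x.2‖ < ρ → x ∈ S)
    (hopen : ∀ x ∈ S, 0 < ‖x.2‖ → ‖x.2‖ < ρ → ∀ W ∈ 𝓝 x.1, ∀ᶠ e in 𝓝 x.2, ∃ z ∈ W, (z, e) ∈ S)
    (hinj : ∀ x ∈ S, 0 < ‖x.2‖ → ‖x.2‖ < ρ → ∃ W ∈ 𝓝 x, ∀ y ∈ W ∩ S, ∀ y' ∈ W ∩ S,
      y.2 = y'.2 → y = y')
    (hfin : ∀ e : ℂ, ‖e‖ < ρ → {z | (z, e) ∈ S}.Finite) {z : V} {ε : ℂ} (hz : (z, ε) ∈ S)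
    (hε : ε ≠ 0) (hερ : ‖ε‖ < ρ) :
    ∃ Z : ℝ → V, ContinuousOn Z (Set.Icc 0 1) ∧ Z 1 = z ∧
      ∀ s ∈ Set.Icc (0 : ℝ) 1, (Z s, (s : ℂ) * ε) ∈ S := by
  set T := {x : V × ℂ // x ∈ S ∧ 0 < ‖x.2‖ ∧ ‖x.2‖ < ρ}
  set B := {e : ℂ // 0 < ‖e‖ ∧ ‖e‖ < ρ}
  set π : T → B := fun x => ⟨x.1.2, x.2.2⟩ with hπ
  have hcont : Continuous π :=
    Continuous.subtype_mk (continuous_snd.comp continuous_subtype_val) _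
  have hproper : IsProperMap π := by
    rw [isProperMap_iff_ultrafilter_of_t2]
    refine ⟨hcont, fun U b hb => ?_⟩
    obtain ⟨v, hv⟩ := exists_tendsto_of_norm_le U (fun x : T => x.1.1) R
      (Eventually.of_forall fun x => hbdd _ x.2.1 x.2.2.2)
    have hb' : Tendsto (fun x : T => x.1.2) U (𝓝 b.1) :=
      (continuous_subtype_val.tendsto b).comp hb
    have hlim : Tendsto (fun x : T => x.1) U (𝓝 (v, b.1)) := hv.prodMk_nhds hb'
    have hS : (v, b.1) ∈ S := hclosed _ (mem_closure_of_tendsto hlim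
      (Eventually.of_forall fun x => x.2.1)) b.2.2
    refine ⟨⟨(v, b.1), hS, b.2⟩, ?_⟩
    have : Tendsto (id : T → T) U (𝓝 ⟨(v, b.1), hS, b.2⟩) := tendsto_subtype_rng.2 hlim
    exact this
  have hopenmap : IsOpenMap π := by
    refine IsOpenMap.of_nhds_le fun x s hs => ?_
    have hs' : π ⁻¹' s ∈ 𝓝 x := hs
    obtain ⟨u, hu, hus⟩ := (mem_nhds_subtype _ x _).1 hs'
    rw [nhds_prod_eq, mem_prod_iff] at hu
    obtain ⟨W, hW, D, hD, hWD⟩ := hu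
    have h1 := (hopen x.1 x.2.1 x.2.2.1 x.2.2.2 W hW).and hD
    have h2 : Tendsto (fun b : B => b.1) (𝓝 (π x)) (𝓝 x.1.2) :=
      continuous_subtype_val.tendsto (π x)
    filter_upwards [h2.eventually h1] with b hb
    obtain ⟨⟨v, hv, hvS⟩, hbD⟩ := hb
    exact hus (a := ⟨(v, b.1), hvS, b.2⟩) (hWD ⟨hv, hbD⟩)
  have hlocal : IsLocalHomeomorph π := by
    rw [isLocalHomeomorph_iff_isOpenEmbedding_restrict]
    intro x
    obtain ⟨W, hW, hWinj⟩ := hinj x.1 x.2.1 x.2.2.1 x.2.2.2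
    obtain ⟨W', hW'W, hW'o, hxW'⟩ := mem_nhds_iff.1 hW
    have ho : IsOpen (Subtype.val ⁻¹' W' : Set T) := hW'o.preimage continuous_subtype_val
    refine ⟨Subtype.val ⁻¹' W', ho.mem_nhds hxW', ?_⟩
    refine Topology.IsOpenEmbedding.of_continuous_injective_isOpenMap
      (hcont.comp continuous_subtype_val) ?_ (hopenmap.domRestrict ho)
    intro y y' hyy
    have h1 : y.1.1.2 = y'.1.1.2 := congrArg Subtype.val hyy
    exact Subtype.ext (Subtype.ext (hWinj _ ⟨hW'W y.2, y.1.2.1⟩ _ ⟨hW'W y'.2, y'.1.2.1⟩ h1))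
  -- A closed local homeomorphism with finite fibres is a covering.
  have hcov : IsCoveringMap π := by
    rw [isCoveringMap_iff_isCoveringMapOn_univ]
    refine hproper.isClosedMap.isCoveringMapOn_of_isLocalHomeomorphOn (fun b _ => ?_)
      (isLocalHomeomorph_iff_isLocalHomeomorphOn_univ.1 hlocal)
    refine Set.Finite.of_finite_image (f := fun x : T => x.1.1)
      ((hfin b.1 b.2.2).subset ?_) ?_
    · rintro _ ⟨x, hx, rfl⟩
      have hx' : x.1.2 = b.1 := congrArg Subtype.val hx
      change (x.1.1, b.1) ∈ S
      rw [← hx']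
      exact x.2.1
    · intro x hx y hy hxy
      have hx' : x.1.2 = b.1 := congrArg Subtype.val hx
      have hy' : y.1.2 = b.1 := congrArg Subtype.val hy
      exact Subtype.ext (Prod.ext hxy (hx'.trans hy'.symm))
  have hexp : ∀ u : ℝ, ‖(Real.exp (-|u|) : ℂ) * ε‖ = Real.exp (-|u|) * ‖ε‖ := fun u => by
    rw [norm_mul, Complex.norm_real, Real.norm_eq_abs, Real.abs_exp]
  -- The ray `s ε` in the parameter `u = -log s`, extended evenly so that the domain is all of `ℝ`
  -- and the path stays in the punctured disc. Only `u ≥ 0` is used afterwards.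
  set γ : C(ℝ, B) := ⟨fun u => ⟨(Real.exp (-|u|) : ℂ) * ε, by
      rw [hexp]; exact mul_pos (Real.exp_pos _) (norm_pos_iff.2 hε), by
      rw [hexp]
      refine lt_of_le_of_lt (mul_le_of_le_one_left (norm_nonneg _) ?_) hερ
      exact Real.exp_le_one_iff.2 (neg_nonpos.2 (abs_nonneg u))⟩, by
      refine Continuous.subtype_mk ?_ _
      exact (Complex.continuous_ofReal.comp (by fun_prop)).mul continuous_const⟩ with hγ
  obtain ⟨F, ⟨hF0, hFπ⟩, -⟩ := hcov.existsUnique_continuousMap_lifts γ 0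
    (⟨(z, ε), hz, norm_pos_iff.2 hε, hερ⟩ : T) (by
      apply Subtype.ext
      simp [hπ, hγ])
  have hF2 : ∀ u, (F u).1.2 = (Real.exp (-|u|) : ℂ) * ε := fun u =>
    congrArg Subtype.val (congrFun hFπ u)
  set Z₀ : ℝ → V := fun s => (F (-Real.log s)).1.1 with hZ₀
  have hZS : ∀ s ∈ Set.Ioc (0 : ℝ) 1, (Z₀ s, (s : ℂ) * ε) ∈ S := by
    intro s hs
    have h1 := hF2 (-Real.log s)
    rw [abs_of_nonneg (neg_nonneg.2 (Real.log_nonpos hs.1.le hs.2)), neg_neg,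
      Real.exp_log hs.1] at h1
    rw [← h1]
    exact (F _).2.1
  have hnorm : ∀ s ∈ Set.Icc (0 : ℝ) 1, ‖(s : ℂ) * ε‖ < ρ := by
    intro s hs
    rw [norm_mul, Complex.norm_real, Real.norm_eq_abs, abs_of_nonneg hs.1]
    exact lt_of_le_of_lt (mul_le_of_le_one_left (norm_nonneg _) hs.2) hερ
  have hZc : ContinuousOn Z₀ (Set.Ioc 0 1) := by
    have h1 : ContinuousOn (fun s : ℝ => -Real.log s) (Set.Ioc 0 1) :=
      (Real.continuousOn_log.mono fun s hs => (ne_of_gt hs.1 : s ≠ 0)).neg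
    exact ((continuous_fst.comp continuous_subtype_val).comp F.continuous).comp_continuousOn h1
  have hρ : 0 < ρ := (norm_nonneg ε).trans_lt hερ
  -- Nothing is assumed about the branching of the set at the parameter 0. The lift still converges
  -- there, since its limit points lie in the finite fibre.
  obtain ⟨z₀, hz₀, hlim⟩ := exists_tendsto_of_finite_limits (R := R) (A := {z | (z, (0 : ℂ)) ∈ S})
    hZc (fun s hs => hbdd (Z₀ s, (s : ℂ) * ε) (hZS s hs) (hnorm s ⟨hs.1.le, hs.2⟩)) (hfin 0 (by simpa using hρ)) (by
      intro U v hU hv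
      have h2 : Tendsto (fun s : ℝ => (s : ℂ) * ε) U (𝓝 0) := by
        have : Continuous fun s : ℝ => (s : ℂ) * ε :=
          Complex.continuous_ofReal.mul continuous_const
        have := this.tendsto 0
        simp only [Complex.ofReal_zero, zero_mul] at this
        exact this.mono_left (hU.trans nhdsWithin_le_nhds)
      refine hclosed (v, 0) (mem_closure_of_tendsto (hv.prodMk_nhds h2) ?_) (by simpa using hρ)
      exact hU (mem_of_superset (Ioc_mem_nhdsGT one_pos) hZS))
  refine ⟨fun s => if s = 0 then z₀ else Z₀ s, ?_, ?_, fun s hs => ?_⟩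
  · intro s hs
    by_cases h0 : s = 0
    · subst h0
      have h1 : Tendsto (fun s : ℝ => if s = 0 then z₀ else Z₀ s) (𝓝[>] 0) (𝓝 z₀) := by
        refine hlim.congr' ?_
        filter_upwards [self_mem_nhdsWithin] with s hs
        rw [if_neg (ne_of_gt hs)]
      change Tendsto _ _ (𝓝 (if (0 : ℝ) = 0 then z₀ else Z₀ 0))
      rw [if_pos rfl]
      have h2 : 𝓝[Set.Icc 0 1] (0 : ℝ) ≤ 𝓝[≥] 0 := nhdsWithin_mono _ fun s hs => hs.1
      refine Tendsto.mono_left ?_ h2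
      rw [← Set.Ioi_union_left, nhdsWithin_union, nhdsWithin_singleton]
      exact h1.sup (by simpa using (tendsto_pure_nhds (fun s : ℝ => if s = 0 then z₀ else Z₀ s) 0))
    · have hs' : s ∈ Set.Ioc (0 : ℝ) 1 := ⟨lt_of_le_of_ne hs.1 (Ne.symm h0), hs.2⟩
      have h1 := hZc s hs'
      have h2 : ContinuousWithinAt Z₀ (Set.Icc 0 1) s := by
        refine h1.mono_of_mem_nhdsWithin ?_
        filter_upwards [self_mem_nhdsWithin, nhdsWithin_le_nhds (lt_mem_nhds hs'.1)] with x hx hx2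
        exact ⟨hx2, hx.2⟩
      refine h2.congr_of_eventuallyEq ?_ (if_neg h0)
      filter_upwards [nhdsWithin_le_nhds (lt_mem_nhds hs'.1)] with x hx
      exact if_neg (ne_of_gt hx)
  · simp only [one_ne_zero, if_false, hZ₀, Real.log_one, neg_zero]
    rw [hF0]
  · by_cases h0 : s = 0
    · simp only [h0, if_true, Complex.ofReal_zero, zero_mul]
      exact hz₀
    · simp only [h0, if_false]
      exact hZS s ⟨lt_of_le_of_ne hs.1 (Ne.symm h0), hs.2⟩

/-! ### Deformations -/

lemma polyTendsto_deform {f g : ℂ[X]} {N : ℕ} (hf : f.natDegree ≤ N) (hg : g.natDegree ≤ N)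
    (e : ℂ) : PolyTendsto (deform f g) (𝓝 e) (deform f g e) N := by
  have hdeg : ∀ ε, (deform f g ε).natDegree ≤ N := fun ε =>
    natDegree_add_le_of_degree_le hf ((natDegree_C_mul_le _ _).trans hg)
  refine ⟨fun i => ?_, Eventually.of_forall hdeg, hdeg e⟩
  have : Continuous fun ε => (deform f g ε).coeff i := by
    simp only [deform, coeff_add, coeff_C_mul]
    fun_prop
  exact this.tendsto e

lemma natDegree_deform_of_lt {f g : ℂ[X]} (h : g.natDegree < f.natDegree) (ε : ℂ) :
    (deform f g ε).natDegree = f.natDegree ∧ (deform f g ε).leadingCoeff = f.leadingCoeff := by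
  have h1 : (C ε * g).natDegree < f.natDegree := (natDegree_C_mul_le _ _).trans_lt h
  have h2 : (deform f g ε).natDegree = f.natDegree := natDegree_add_eq_left_of_natDegree_lt h1
  refine ⟨h2, ?_⟩
  rw [leadingCoeff, h2, deform, coeff_add, coeff_eq_zero_of_natDegree_lt h1, add_zero]
  rfl

/-- The left side is the integral of `f + ε g`, which is constant on the fibre. It removes the
factor `ε` from the infinitesimal problem. -/
lemma integral_deform_eq_zero {m : ℕ} {w : Fin m → ℤ} (hw : ∑ j, w j = 0) {f g : ℂ[X]} {ε t : ℂ}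
    {z : Fin m → ℂ} (hz : ∀ j, (deform f g ε).eval (z j) = t) :
    integral w f z + ε * integral w g z = 0 := by
  have h1 : integral w f z + ε * integral w g z = ∑ j, (w j : ℂ) * t := by
    simp only [integral, Finset.mul_sum, ← Finset.sum_add_distrib]
    refine Finset.sum_congr rfl fun j _ => ?_
    rw [← hz j, eval_deform]
    ring
  rw [h1, ← Finset.sum_mul, ← Int.cast_sum, hw, Int.cast_zero, zero_mul]

lemma continuous_integral {m : ℕ} (w : Fin m → ℤ) (q : ℂ[X]) :
    Continuous fun z : Fin m → ℂ => integral w q z :=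
  continuous_finsetSum _ fun j _ =>
    continuous_const.mul (q.continuous.comp (continuous_apply j))

lemma continuous_eval_deform (f g : ℂ[X]) :
    Continuous fun u : ℂ × ℂ => (deform f g u.2).eval u.1 := by
  simp only [eval_deform]
  exact (f.continuous.comp continuous_fst).add
    (continuous_snd.mul (g.continuous.comp continuous_fst))

/-! ### Boundedness of the zeros of an integral -/

/-- Zeros of unbounded norm, rescaled to norm 1, would tend to a nonzero polygon `v` with `∑ wⱼ vⱼⁿ
= 0`. -/
lemma exists_bound_of_sum_pow_ne_zero {α : Type*} {P : α → ℂ[X]} {l : Filter α} {f q : ℂ[X]}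
    {m n : ℕ} (hP : PolyTendsto P l f m) (hq : q.natDegree = n) (hq0 : q ≠ 0)
    {w : Fin m → ℤ} (hB : ∀ (T : ℂ) (v : Fin m → ℂ),
      RootTuple (C (f.coeff m) * X ^ m) (f.coeff m) T v → v ≠ 0 → ∑ j, (w j : ℂ) * v j ^ n ≠ 0) :
    ∃ R : ℝ, ∀ᶠ y in l, ∀ (t : ℂ) (Z : Fin m → ℂ), RootTuple (P y) ((P y).coeff m) t Z →
      integral w q Z = 0 → ‖Z‖ ≤ R := by
  -- The bound goes to infinity together with the parameter, so that a failure produces norms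
  -- tending to infinity and a single `R` can be read off at the end.
  have key : ∀ᶠ u in l ×ˢ (atTop : Filter ℝ), ∀ (t : ℂ) (Z : Fin m → ℂ),
      RootTuple (P u.1) ((P u.1).coeff m) t Z → integral w q Z = 0 → ‖Z‖ ≤ u.2 := by
    refine eventually_of_forall_ultrafilter fun U hU hbad => ?_
    push Not at hbad
    have hbad' : ∀ᶠ u in (U : Filter (α × ℝ)), ∃ x : (Fin m → ℂ) × ℂ,
        RootTuple (P u.1) ((P u.1).coeff m) x.2 x.1 ∧ integral w q x.1 = 0 ∧ u.2 < ‖x.1‖ :=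
      hbad.mono fun u ⟨t, Z, h⟩ => ⟨(Z, t), h⟩
    obtain ⟨x, hx⟩ := hbad'.choice
    have hU1 : Tendsto Prod.fst (U : Filter (α × ℝ)) l := tendsto_fst.mono_left hU
    have hU2 : Tendsto Prod.snd (U : Filter (α × ℝ)) atTop := tendsto_snd.mono_left hU
    have hnorm : Tendsto (fun u => ‖(x u).1‖) U atTop :=
      tendsto_atTop_mono' _ (hx.mono fun u hu => hu.2.2.le) hU2
    set lam : α × ℝ → ℂ := fun u => ((‖(x u).1‖⁻¹ : ℝ) : ℂ) with hlam
    have hlt : Tendsto lam U (𝓝 0) := by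
      have := hnorm.inv_tendsto_atTop
      simpa [Function.comp_def, hlam] using (Complex.continuous_ofReal.tendsto 0).comp this
    have hl0 : ∀ᶠ u in (U : Filter (α × ℝ)), lam u ≠ 0 := by
      filter_upwards [hnorm.eventually_gt_atTop 0] with u hu
      simp only [hlam]; exact_mod_cast (inv_pos.2 hu).ne'
    have hn1 : ∀ᶠ u in (U : Filter (α × ℝ)), ‖lam u • (x u).1‖ = 1 := by
      filter_upwards [hnorm.eventually_gt_atTop 0] with u hu
      rw [norm_smul, hlam, Complex.norm_real, norm_inv, norm_norm, inv_mul_cancel₀ hu.ne']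
    obtain ⟨v, hv⟩ := exists_tendsto_of_norm_le U (fun u => lam u • (x u).1) 1
      (hn1.mono fun u hu => hu.le)
    have hvn : ‖v‖ = 1 := tendsto_nhds_unique hv.norm
      (tendsto_const_nhds.congr' (hn1.mono fun u hu => hu.symm))
    have hPU : PolyTendsto (fun u : α × ℝ => P u.1) (U : Filter (α × ℝ)) f m :=
      ⟨fun i => (hP.coeff i).comp hU1, hU1.eventually hP.deg, hP.deg_lim⟩
    obtain ⟨T₀, -, hT₀⟩ := RootTuple.of_tendsto_scaled (A := fun u => (P u.1).coeff m)
      (T := fun u => (x u).2) hPU (hPU.coeff m) (Eventually.of_forall fun _ => rfl) hl0 hlt hv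
      (hx.mono fun u hu => hu.1)
    have hsum : Tendsto (fun u => ∑ j, (w j : ℂ) * (lam u ^ n * q.eval ((x u).1 j))) U
        (𝓝 (∑ j, (w j : ℂ) * (q.coeff n * v j ^ n))) := by
      refine tendsto_finsetSum _ fun j _ => tendsto_const_nhds.mul ?_
      exact tendsto_scaled_eval (polyTendsto_const hq.le) hl0 hlt (tendsto_pi_nhds.1 hv j)
    have hzero : ∀ᶠ u in (U : Filter (α × ℝ)),
        ∑ j, (w j : ℂ) * (lam u ^ n * q.eval ((x u).1 j)) = 0 := by
      filter_upwards [hx] with u hu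
      have h2 := hu.2.1
      rw [integral] at h2
      rw [← mul_zero (lam u ^ n), ← h2, Finset.mul_sum]
      exact Finset.sum_congr rfl fun j _ => by ring
    have h0 := tendsto_nhds_unique hsum (tendsto_const_nhds.congr' (hzero.mono fun u hu => hu.symm))
    refine hB T₀ v hT₀ (by rintro rfl; simp at hvn) ?_
    have hc : q.coeff n ≠ 0 := by rw [← hq]; exact leadingCoeff_ne_zero.2 hq0
    refine (mul_eq_zero.1 ?_).resolve_left hc
    rw [Finset.mul_sum, ← h0]
    exact Finset.sum_congr rfl fun j _ => by ring
  obtain ⟨pa, hpa, pb, hpb, h⟩ := eventually_prod_iff.1 key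
  obtain ⟨R, hR⟩ := hpb.exists
  exact ⟨R, hpa.mono fun y hy => h hy hR⟩

/-! ### Persistence of zeros -/

/-- Without a zero, the maximum principle for `1 / h` would bound `‖h c‖` below by `μ`. -/
lemma exists_zero_of_norm_lt {h : ℂ → ℂ} {c : ℂ} {r μ : ℝ} (hr : 0 < r)
    (hd : ∀ z ∈ Metric.closedBall c r, DifferentiableAt ℂ h z)
    (hμ : ∀ z ∈ Metric.sphere c r, μ ≤ ‖h z‖) (hc : ‖h c‖ < μ) :
    ∃ z ∈ Metric.closedBall c r, h z = 0 := by
  by_contra! hne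
  have hcne := hne c (Metric.mem_closedBall_self hr.le)
  have hdo : DifferentiableOn ℂ (fun z => (h z)⁻¹) (Metric.closedBall c r) := fun z hz =>
    ((hd z hz).inv (hne z hz)).differentiableWithinAt
  have hμ0 : 0 < μ := (norm_nonneg _).trans_lt hc
  have hb := Complex.norm_le_of_forall_mem_frontier_norm_le (U := Metric.ball c r)
    (f := fun z => (h z)⁻¹) (C := μ⁻¹) Metric.isBounded_ball
    (DifferentiableOn.diffContOnCl (by rwa [closure_ball c hr.ne'])) (fun z hz => by
      rw [frontier_ball c hr.ne'] at hz
      rw [norm_inv]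
      exact inv_anti₀ hμ0 (hμ z hz)) (subset_closure (Metric.mem_ball_self hr))
  rw [norm_inv] at hb
  exact absurd ((inv_le_inv₀ (norm_pos_iff.2 hcne) hμ0).1 hb) (not_le.2 hc)

/-- An isolated zero of a holomorphic function persists under deformation. -/
lemma eventually_exists_zero {H : ℂ × ℂ → ℂ} {t₀ e₀ : ℂ}
    (hd : ∀ᶠ u in 𝓝 (t₀, e₀), DifferentiableAt ℂ H u) (h0 : H (t₀, e₀) = 0)
    (hiso : ∀ᶠ t in 𝓝 t₀, H (t, e₀) = 0 → t = t₀) {W : Set ℂ} (hW : W ∈ 𝓝 t₀) :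
    ∀ᶠ e in 𝓝 e₀, ∃ t ∈ W, H (t, e) = 0 := by
  rw [nhds_prod_eq, eventually_prod_iff] at hd
  obtain ⟨pa, hpa, pb, hpb, hd⟩ := hd
  obtain ⟨r, hr, hrs⟩ := Metric.nhds_basis_closedBall.mem_iff.1 (inter_mem (inter_mem hW hpa) hiso)
  have hcont : ∀ t ∈ Metric.closedBall t₀ r, ContinuousAt H (t, e₀) := fun t ht =>
    (hd (hrs ht).1.2 hpb.self_of_nhds).continuousAt
  have hne : ∀ t ∈ Metric.sphere t₀ r, 0 < ‖H (t, e₀)‖ := fun t ht => norm_pos_iff.2 fun h => by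
    have := (hrs (Metric.sphere_subset_closedBall ht)).2 h
    subst this
    simp at ht; exact hr.ne ht
  obtain ⟨t₁, ht₁, hmin⟩ := (isCompact_sphere t₀ r).exists_isMinOn
    (NormedSpace.sphere_nonempty.2 hr.le) (f := fun t => ‖H (t, e₀)‖) fun t ht => by
      have h1 := (hcont t (Metric.sphere_subset_closedBall ht)).comp
        (f := fun t : ℂ => (t, e₀)) (by fun_prop)
      exact h1.norm.continuousWithinAt
  set μ := ‖H (t₁, e₀)‖
  have hμ : 0 < μ := hne t₁ ht₁
  have h1 : ∀ᶠ e in 𝓝 e₀, ∀ t ∈ Metric.sphere t₀ r, μ / 2 < ‖H (t, e)‖ := by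
    refine (isCompact_sphere t₀ r).eventually_forall_of_forall_eventually
      (P := fun e t => μ / 2 < ‖H (t, e)‖) fun t ht => ?_
    have h2 : ContinuousAt (fun z : ℂ × ℂ => ‖H (z.2, z.1)‖) (e₀, t) :=
      (ContinuousAt.comp (f := fun z : ℂ × ℂ => (z.2, z.1)) (x := (e₀, t))
        (hcont t (Metric.sphere_subset_closedBall ht)) (by fun_prop)).norm
    exact h2.eventually (lt_mem_nhds ((half_lt_self hμ).trans_le (hmin ht)))
  have h3 : ∀ᶠ e in 𝓝 e₀, ‖H (t₀, e)‖ < μ / 2 := by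
    have h2 : ContinuousAt (fun e : ℂ => ‖H (t₀, e)‖) e₀ :=
      (ContinuousAt.comp (f := fun e : ℂ => (t₀, e)) (x := e₀)
        (hcont t₀ (Metric.mem_closedBall_self hr.le)) (by fun_prop)).norm
    refine h2.eventually (gt_mem_nhds ?_)
    change ‖H (t₀, e₀)‖ < μ / 2
    rw [h0, norm_zero]; positivity
  filter_upwards [h1, h3, hpb] with e he1 he2 he3
  obtain ⟨t, ht, hz⟩ := exists_zero_of_norm_lt (h := fun t => H (t, e)) hr (fun t ht =>
    (hd (hrs ht).1.2 he3).comp (f := fun t : ℂ => (t, e)) t (by fun_prop))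
    (fun t ht => (he1 t ht).le) he2
  exact ⟨t, (hrs ht).1.1, hz⟩

/-! ### No alien limit cycles -/

/-- The tuples of distinct points in one fibre of `f + ε g` with vanishing integral of `g`. -/
def zeroTuples {m : ℕ} (w : Fin m → ℤ) (f g : ℂ[X]) : Set ((Fin m → ℂ) × ℂ) :=
  {x | Function.Injective x.1 ∧ (∃ t, ∀ j, (deform f g x.2).eval (x.1 j) = t) ∧
    integral w g x.1 = 0}

/-- A polynomial in `(ε, t)` whose zeros are the values carrying a zero of an integral of `q` over
the fibres of `f + ε g`. -/
lemma exists_deform_product_polynomial {κ : Type*} [Fintype κ] [DecidableEq κ] (f g q : ℂ[X])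
    {N : ℕ} (hN : 0 < N) (ω : κ → ℤ) :
    ∃ (k : ℕ) (Ξ : ℂ[X][X]), ∀ (ε t : ℂ) (Z : Fin N → ℂ),
      RootTuple (deform f g ε) ((deform f g ε).coeff N) t Z →
        (specialize Ξ ε).eval t = (deform f g ε).coeff N ^ k *
          ∏ σ : κ ↪ Fin N, ∑ i, (ω i : ℂ) * q.eval (Z (σ i)) := by
  obtain ⟨k, Ξ, h⟩ := exists_product_polynomial N hN (f.map C + C X * g.map C) (q.map C) ω
  refine ⟨k, Ξ, fun ε t Z hZ => ?_⟩
  have hC : (evalRingHom ε).comp C = RingHom.id ℂ := by ext; simp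
  have hmap : ∀ p : ℂ[X], (p.map C).map (evalRingHom ε) = p := fun p => by
    rw [Polynomial.map_map, hC, Polynomial.map_id]
  have h1 : (f.map C + C X * g.map C).map (evalRingHom ε) = deform f g ε := by
    rw [Polynomial.map_add, Polynomial.map_mul, hmap, hmap, Polynomial.map_C, deform]
    simp
  have h2 := h (evalRingHom ε) t Z
  rw [h1, hmap, ← coeff_map, h1] at h2
  exact h2 hZ

/-- The hypotheses of `exists_lift_ray` hold: `hB` gives boundedness; closedness holds because a
limit with coinciding points would be a zero in a critical fibre; openness and local injectivity
come from the local uniqueness of the zeros of the product polynomial `Ξ`, outside finitely many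
parameters. -/
lemma zeroTuples_lift {m n : ℕ} {f g : ℂ[X]} {w : Fin m → ℤ} (hf : f.natDegree = m)
    (hg : g.natDegree = n) (hm : 0 < m) (hnm : n < m) (hg0 : g ≠ 0)
    (hB : ∀ (T : ℂ) (v : Fin m → ℂ), RootTuple (C f.leadingCoeff * X ^ m) f.leadingCoeff T v →
      v ≠ 0 → ∑ j, (w j : ℂ) * v j ^ n ≠ 0)
    (h0 : NoCriticalZero f g w m)
    (hev : ∀ᶠ ε in 𝓝[≠] (0 : ℂ), NoCriticalZero (deform f g ε) g w m) :
    ∃ ρ > 0, ∀ ε : ℂ, ε ≠ 0 → ‖ε‖ < ρ → ∀ z, (z, ε) ∈ zeroTuples w f g →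
      ∃ Z : ℝ → Fin m → ℂ, ContinuousOn Z (Set.Icc 0 1) ∧ Z 1 = z ∧
        ∀ s ∈ Set.Icc (0 : ℝ) 1, (Z s, (s : ℂ) * ε) ∈ zeroTuples w f g := by
  classical
  have hdeg : ∀ ε, (deform f g ε).natDegree = m := fun ε =>
    (natDegree_deform_of_lt (by omega) ε).1.trans hf
  have hlead : ∀ ε, (deform f g ε).leadingCoeff = f.leadingCoeff := fun ε =>
    (natDegree_deform_of_lt (by omega) ε).2
  have hcoeff : ∀ ε, (deform f g ε).coeff m = f.leadingCoeff := fun ε => by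
    rw [← hlead ε, leadingCoeff, hdeg]
  have ha : f.leadingCoeff ≠ 0 := leadingCoeff_ne_zero_of_natDegree (hf ▸ hm)
  have had : ∀ ε, (deform f g ε).leadingCoeff ≠ 0 := fun ε => by rw [hlead]; exact ha
  set j₀ : Fin m := ⟨0, hm⟩
  have hroot : ∀ x ∈ zeroTuples w f g, ∃ t, RootTuple (deform f g x.2) f.leadingCoeff t x.1 ∧
      (∀ j, (deform f g x.2).eval (x.1 j) = t) ∧ integral w g x.1 = 0 := by
    rintro x ⟨h1, ⟨t, h2⟩, h3⟩
    refine ⟨t, ?_, h2, h3⟩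
    rw [← hlead x.2]
    exact rootTuple_of_injective (hdeg _) hm h1 h2
  obtain ⟨R, hR⟩ := exists_bound_of_sum_pow_ne_zero (l := 𝓝 (0 : ℂ)) (P := deform f g)
    (polyTendsto_deform hf.le (by omega) 0) hg hg0 (w := w) (by
      rw [hcoeff 0]; exact hB)
  simp only [hcoeff] at hR
  obtain ⟨k, Ξ, hΞ⟩ := exists_deform_product_polynomial f g g hm w
  simp only [hcoeff] at hΞ
  -- A fibre through a point of modulus `|R| + 1` carries no zero, so `Ξ(ε, ·)` does not vanish at
  -- its value.
  have hΞne : ∀ ε, (∀ (t : ℂ) (Z : Fin m → ℂ), RootTuple (deform f g ε) f.leadingCoeff t Z →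
      integral w g Z = 0 → ‖Z‖ ≤ R) → specialize Ξ ε ≠ 0 := by
    intro ε hε hz
    set x : ℂ := ((|R| + 1 : ℝ) : ℂ)
    obtain ⟨Z, hZ⟩ := exists_rootTuple (hdeg ε) hm ((deform f g ε).eval x)
    rw [hlead] at hZ
    obtain ⟨i, hi⟩ := hZ.exists_index ha rfl
    have h1 := hΞ ε _ Z hZ
    rw [hz, eval_zero] at h1
    obtain ⟨σ, -, hσ⟩ := Finset.prod_eq_zero_iff.1 ((mul_eq_zero.1 h1.symm).resolve_left
      (pow_ne_zero _ ha))
    set e : Equiv.Perm (Fin m) := Equiv.ofBijective σ (Finite.injective_iff_bijective.1 σ.injective)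
    have h2 := hε _ _ (hZ.comp_perm e) hσ
    have h3 := (norm_le_pi_norm (Z ∘ e) (e.symm i)).trans h2
    rw [Function.comp_apply, e.apply_symm_apply, hi, Complex.norm_real, Real.norm_eq_abs,
      abs_of_nonneg (by positivity)] at h3
    linarith [le_abs_self R]
  have hΞ0 : Ξ ≠ 0 := by
    rintro rfl
    exact hΞne 0 hR.self_of_nhds (by simp [specialize])
  obtain ⟨F, hF⟩ := exists_finite_locally_unique hΞ0
  have hFev : ∀ᶠ ε in 𝓝[≠] (0 : ℂ), ε ∉ F := by
    have h1 : IsClosed ((F : Set ℂ) \ {0}) := (F.finite_toSet.sdiff).isClosed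
    filter_upwards [nhdsWithin_le_nhds (h1.isOpen_compl.mem_nhds (by simp)), self_mem_nhdsWithin]
      with x hx hxc h2
    exact hx ⟨h2, hxc⟩
  obtain ⟨ρ, hρ, hρs⟩ := Metric.eventually_nhds_iff.1
    (hR.and (eventually_nhdsWithin_iff.1 (hev.and hFev)))
  simp only [dist_zero_right] at hρs
  have hncz : ∀ ε : ℂ, ‖ε‖ < ρ → NoCriticalZero (deform f g ε) g w m := fun ε hε => by
    by_cases hε0 : ε = 0
    · rw [hε0]; simpa using h0
    · exact ((hρs hε).2 hε0).1
  refine ⟨ρ, hρ, fun ε hε0 hερ z hz => exists_lift_ray (S := zeroTuples w f g) (ρ := ρ) (R := R)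
    ?_ ?_ ?_ ?_ ?_ hz hε0 hερ⟩
  · intro x hx hxρ
    obtain ⟨t, h1, -, h3⟩ := hroot x hx
    exact (hρs hxρ).1 t x.1 h1 h3
  · intro x hx hxρ
    obtain ⟨U, hUS, hUx⟩ := mem_closure_iff_ultrafilter.1 hx
    have hU1 : Tendsto Prod.fst (U : Filter ((Fin m → ℂ) × ℂ)) (𝓝 x.1) :=
      (continuous_fst.tendsto x).mono_left hUx
    have hU2 : Tendsto Prod.snd (U : Filter ((Fin m → ℂ) × ℂ)) (𝓝 x.2) :=
      (continuous_snd.tendsto x).mono_left hUx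
    have hT : Tendsto (fun y : (Fin m → ℂ) × ℂ => (deform f g y.2).eval (y.1 j₀)) U
        (𝓝 ((deform f g x.2).eval (x.1 j₀))) :=
      ((continuous_eval_deform f g).tendsto (x.1 j₀, x.2)).comp
        ((tendsto_pi_nhds.1 hU1 j₀).prodMk_nhds hU2)
    have hZ : RootTuple (deform f g x.2) f.leadingCoeff ((deform f g x.2).eval (x.1 j₀)) x.1 := by
      refine RootTuple.of_tendsto (P := fun y : (Fin m → ℂ) × ℂ => deform f g y.2)
        (A := fun _ => f.leadingCoeff) (fun v => ?_) tendsto_const_nhds hT hU1 ?_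
      · exact ((continuous_eval_deform f g).tendsto (v, x.2)).comp
          (tendsto_const_nhds.prodMk_nhds hU2)
      · filter_upwards [show ∀ᶠ y in (U : Filter _), y ∈ zeroTuples w f g from hUS] with y hy
        obtain ⟨t, h1, h2, -⟩ := hroot y hy
        rw [h2 j₀]; exact h1
    have hI : integral w g x.1 = 0 := by
      refine tendsto_nhds_unique (((continuous_integral w g).tendsto x.1).comp hU1)
        (tendsto_const_nhds.congr' ?_)
      filter_upwards [show ∀ᶠ y in (U : Filter _), y ∈ zeroTuples w f g from hUS] with y hy
      exact hy.2.2.symm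
    refine ⟨?_, ⟨_, hZ.eval_root⟩, hI⟩
    by_contra hni
    rw [← hlead x.2] at hZ
    exact hncz _ hxρ _ _ hZ hni (Function.Embedding.refl _) hI
  · intro x hx hx0 hxρ W hW
    obtain ⟨t₀, h1, h2, h3⟩ := hroot x hx
    have hx0' : x.2 ≠ 0 := norm_pos_iff.1 hx0
    obtain ⟨Ψ, hΨ0, hΨ, -⟩ := exists_local_section f g hx.1 h2
      (fun j => h1.derivative_ne_zero ha hx.1 j)
    have hF' := hF x.2 ((hρs hxρ).2 hx0').2 t₀
    have hzero : ∀ᶠ u in 𝓝 (t₀, x.2), integral w g (Ψ u) = 0 →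
        (specialize Ξ u.2).eval u.1 = 0 := by
      filter_upwards [hΨ] with u hu hI
      have h4 : RootTuple (deform f g u.2) f.leadingCoeff u.1 (Ψ u) := by
        rw [← hlead u.2]; exact rootTuple_of_injective (hdeg _) hm hu.2.1 hu.2.2
      rw [hΞ _ _ _ h4, Finset.prod_eq_zero (Finset.mem_univ (Function.Embedding.refl _)) hI,
        mul_zero]
    have hΨc : ContinuousAt Ψ (t₀, x.2) := hΨ.self_of_nhds.1.continuousAt
    have hgood : ∀ᶠ u in 𝓝 (t₀, x.2), Ψ u ∈ W ∧ Function.Injective (Ψ u) ∧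
        ∀ j, (deform f g u.2).eval (Ψ u j) = u.1 :=
      (hΨc.eventually (by rw [hΨ0]; exact hW)).and (hΨ.mono fun u hu => hu.2)
    rw [nhds_prod_eq, eventually_prod_iff] at hgood
    obtain ⟨pa, hpa, pb, hpb, hgood⟩ := hgood
    have key := eventually_exists_zero (H := fun u => integral w g (Ψ u)) (t₀ := t₀) (e₀ := x.2)
      (hΨ.mono fun u hu => by
        simp only [integral]
        refine DifferentiableAt.fun_sum fun j _ => ?_
        exact (g.differentiable.differentiableAt.comp u
          ((differentiableAt_pi.1 hu.1) j)).const_mul _)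
      (by rw [hΨ0]; exact h3) ?_ hpa
    · filter_upwards [key, hpb] with e he heb
      obtain ⟨t, ht, hI⟩ := he
      have h5 := hgood ht heb
      exact ⟨Ψ (t, e), h5.1, h5.2.1, ⟨t, h5.2.2⟩, hI⟩
    · have c1 : Tendsto (fun t : ℂ => (t, x.2)) (𝓝 t₀) (𝓝 (t₀, x.2)) :=
        Continuous.tendsto (by fun_prop) t₀
      have c2 : Tendsto (fun t : ℂ => (x.2, t, t₀)) (𝓝 t₀) (𝓝 (x.2, t₀, t₀)) :=
        Continuous.tendsto (by fun_prop) t₀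
      filter_upwards [c1.eventually hzero, c2.eventually hF'] with t ht ht2 hI
      refine ht2 (ht hI) ?_
      have := hzero.self_of_nhds
      exact this (by rw [hΨ0]; exact h3)
  · intro x hx hx0 hxρ
    obtain ⟨t₀, h1, h2, h3⟩ := hroot x hx
    obtain ⟨Ψ, -, -, hΨ⟩ := exists_local_section f g hx.1 h2
      (fun j => h1.derivative_ne_zero ha hx.1 j)
    have hF' := hF x.2 ((hρs hxρ).2 (norm_pos_iff.1 hx0)).2 t₀
    have hτ : Tendsto (fun y : (Fin m → ℂ) × ℂ => (deform f g y.2).eval (y.1 j₀)) (𝓝 x)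
        (𝓝 t₀) := by
      rw [← h2 j₀]
      exact ((continuous_eval_deform f g).comp
        (((continuous_apply j₀).comp continuous_fst).prodMk continuous_snd)).tendsto x
    have hpair : ∀ᶠ y in 𝓝 x ×ˢ 𝓝 x,
        (specialize Ξ y.1.2).eval ((deform f g y.1.2).eval (y.1.1 j₀)) = 0 →
        (specialize Ξ y.1.2).eval ((deform f g y.2.2).eval (y.2.1 j₀)) = 0 →
        (deform f g y.1.2).eval (y.1.1 j₀) = (deform f g y.2.2).eval (y.2.1 j₀) := by
      have c1 : Tendsto (fun y : ((Fin m → ℂ) × ℂ) × ((Fin m → ℂ) × ℂ) =>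
          (y.1.2, (deform f g y.1.2).eval (y.1.1 j₀), (deform f g y.2.2).eval (y.2.1 j₀)))
          (𝓝 x ×ˢ 𝓝 x) (𝓝 (x.2, t₀, t₀)) :=
        ((continuous_snd.tendsto x).comp tendsto_fst).prodMk_nhds
          ((hτ.comp tendsto_fst).prodMk_nhds (hτ.comp tendsto_snd))
      exact c1.eventually hF'
    obtain ⟨W, hW, hWW⟩ := eventually_prod_self_iff'.1 hpair
    refine ⟨W ∩ {v | ∀ t, (∀ j, (deform f g v.2).eval (v.1 j) = t) → Ψ (t, v.2) = v.1},
      inter_mem hW hΨ, ?_⟩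
    rintro y ⟨⟨hyW, hyΨ⟩, hyS⟩ y' ⟨⟨hyW', hyΨ'⟩, hyS'⟩ hyy
    obtain ⟨t, k1, k2, k3⟩ := hroot y hyS
    obtain ⟨t', k1', k2', k3'⟩ := hroot y' hyS'
    have hz1 : (specialize Ξ y.2).eval t = 0 := by
      rw [hΞ _ _ _ k1, Finset.prod_eq_zero (Finset.mem_univ (Function.Embedding.refl _)) k3,
        mul_zero]
    have hz2 : (specialize Ξ y'.2).eval t' = 0 := by
      rw [hΞ _ _ _ k1', Finset.prod_eq_zero (Finset.mem_univ (Function.Embedding.refl _)) k3',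
        mul_zero]
    have htt := hWW y hyW y' hyW'
    simp only [k2, k2'] at htt
    have htt' := htt hz1 (by rw [hyy]; exact hz2)
    have e1 := hyΨ t k2
    have e2 := hyΨ' t' k2'
    refine Prod.ext ?_ hyy
    rw [← e1, ← e2, htt', hyy]
  · intro e he
    have hne := hΞne e (fun t Z h1 h2 => (hρs he).1 t Z h1 h2)
    have hsub : {z : Fin m → ℂ | (z, e) ∈ zeroTuples w f g} ⊆
        ⋃ t ∈ (specialize Ξ e).roots.toFinset,
          Set.univ.pi fun _ : Fin m => {x | (deform f g e).eval x = t} := by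
      intro z hz
      obtain ⟨t, h1, h2, h3⟩ := hroot _ hz
      have hz1 : (specialize Ξ e).eval t = 0 := by
        rw [hΞ _ _ _ h1, Finset.prod_eq_zero (Finset.mem_univ (Function.Embedding.refl _)) h3,
          mul_zero]
      refine Set.mem_biUnion (x := t) ?_ fun j _ => h2 j
      simp [hne, hz1]
    refine Set.Finite.subset (Set.Finite.biUnion (Finset.finite_toSet _) fun t _ => ?_) hsub
    exact Set.Finite.pi fun _ => finite_setOf_eval_eq (by rw [hdeg]; exact hm) t

/-! ### Branches, accumulation of zeros and regular families. -/

lemma JoinedIn.prodMk_zero {f : ℂ[X]} {g : ℂ[X]} {m : ℕ} {z z' : Fin m → ℂ}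
    (h : JoinedIn (regularTuples f m) z z') :
    JoinedIn (deformedTuples f g m) (z, 0) (z', 0) := by
  obtain ⟨γ, hγ⟩ := h
  refine ⟨γ.map (f := fun z : Fin m → ℂ => (z, (0 : ℂ))) (by fun_prop), fun s => ?_⟩
  change γ s ∈ regularTuples (deform f g 0) m
  rw [deform_zero_right]
  exact hγ s

lemma joinedIn_of_continuousOn {E : Type*} [TopologicalSpace E] {S : Set E} {γ : ℝ → E}
    (hc : ContinuousOn γ (Set.Icc 0 1)) (h : ∀ s ∈ Set.Icc (0 : ℝ) 1, γ s ∈ S) {a b : ℝ}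
    (ha : a ∈ Set.Icc (0 : ℝ) 1) (hb : b ∈ Set.Icc (0 : ℝ) 1) : JoinedIn S (γ a) (γ b) := by
  have h1 : IsPathConnected (γ '' Set.Icc 0 1) :=
    ((convex_Icc (0 : ℝ) 1).isPathConnected ⟨a, ha⟩).image' hc
  refine (h1.joinedIn _ ⟨a, ha, rfl⟩ _ ⟨b, hb, rfl⟩).mono ?_
  rintro _ ⟨s, hs, rfl⟩
  exact h s hs

lemma mem_zeroTuples_of_isInfinitesimalSolution {f g : ℂ[X]} {m : ℕ} {K : ZeroCycle f m}
    {ε t : ℂ} (hε : ε ≠ 0) {z : Fin m → ℂ} (h : IsInfinitesimalSolution g K ε t z) :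
    (z, ε) ∈ zeroTuples K.weight f g := by
  obtain ⟨⟨hj, hz⟩, hI⟩ := h
  refine ⟨hj.target_mem.1, ⟨t, hz⟩, ?_⟩
  have h1 := integral_deform_eq_zero K.sum_weight hz
  rw [hI, zero_add] at h1
  exact (mul_eq_zero.1 h1).resolve_left hε

/-- A curve of solutions through `z` with `ε` fixed and a value that varies. The parameter `u` need
not be the value itself: for quadratic `f` it is a root. -/
lemma accPt_of_section {f g : ℂ[X]} {m : ℕ} {K : ZeroCycle f m} {ε t : ℂ} {z : Fin m → ℂ}
    (h : IsInfinitesimalSolution g K ε t z) {Ψ : ℂ → Fin m → ℂ} {T : ℂ → ℂ} {u₀ : ℂ}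
    (h0 : Ψ u₀ = z) (hT : T u₀ = t)
    (hΨ : ∀ᶠ u in 𝓝 u₀, ContinuousAt Ψ u ∧ Ψ u ∈ regularTuples (deform f g ε) m ∧
      (∀ j, (deform f g ε).eval (Ψ u j) = T u) ∧ integral K.weight f (Ψ u) = 0)
    (hTc : ContinuousAt T u₀) (hTne : ∀ᶠ u in 𝓝[≠] u₀, T u ≠ t) :
    AccPt t (𝓟 (displacementZeros g K ε)) := by
  obtain ⟨r, hr, hrs⟩ := Metric.nhds_basis_ball.mem_iff.1 hΨ
  have hsol : ∀ u ∈ Metric.ball u₀ r, T u ∈ displacementZeros g K ε := by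
    intro u hu
    refine ⟨Ψ u, ⟨h.1.1.trans ?_, (hrs hu).2.2.1⟩, (hrs hu).2.2.2⟩
    have hpc : IsPathConnected (Metric.ball u₀ r) :=
      (convex_ball u₀ r).isPathConnected ⟨u, hu⟩
    have h1 := hpc.image' (f := fun u => (Ψ u, ε))
      (fun v hv => ((hrs hv).1.prodMk continuousAt_const).continuousWithinAt)
    have h2 := h1.joinedIn _ ⟨u₀, Metric.mem_ball_self hr, rfl⟩ _ ⟨u, hu, rfl⟩
    simp only [h0] at h2
    refine h2.mono ?_
    rintro _ ⟨v, hv, rfl⟩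
    exact (hrs hv).2.1
  rw [accPt_iff_frequently]
  have h1 : Tendsto T (𝓝[≠] u₀) (𝓝 t) := by
    rw [← hT]; exact hTc.tendsto.mono_left nhdsWithin_le_nhds
  refine h1.frequently (Eventually.frequently ?_)
  filter_upwards [hTne, nhdsWithin_le_nhds (Metric.ball_mem_nhds u₀ hr)] with u hu1 hu2
  exact ⟨hu1, hsol u hu2⟩

/-- If the integral of `f` vanishes over all tuples in fibres of `f + ε g`, then no zero of the
displacement function is isolated. -/
lemma accPt_of_integral_eq_zero {f g : ℂ[X]} {m : ℕ} (hm : 0 < m) {K : ZeroCycle f m} {ε t : ℂ}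
    {z : Fin m → ℂ} (h : IsInfinitesimalSolution g K ε t z)
    (hI : ∀ (t' : ℂ) (z' : Fin m → ℂ), (∀ j, (deform f g ε).eval (z' j) = t') →
      integral K.weight f z' = 0) : AccPt t (𝓟 (displacementZeros g K ε)) := by
  obtain ⟨hinj, t', ht', hzt'⟩ := h.1.1.target_mem
  change ∀ j, (deform f g ε).eval (z j) = t' at hzt'
  change Function.Injective z at hinj
  have hd : ∀ j, (deform f g ε).derivative.eval (z j) ≠ 0 := fun j hj =>
    ht' ⟨z j, hj, hzt' j⟩
  obtain ⟨Ψ, hΨ0, hΨ, -⟩ := exists_local_section f g hinj h.1.2 hd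
  have c1 : Tendsto (fun u : ℂ => (u, ε)) (𝓝 t) (𝓝 (t, ε)) := Continuous.tendsto (by fun_prop) t
  have htt : t' = t := (hzt' ⟨0, hm⟩).symm.trans (h.1.2 ⟨0, hm⟩)
  have hpos : 0 < (deform f g ε).natDegree := by
    by_contra hneg
    rw [not_lt, Nat.le_zero, natDegree_eq_zero] at hneg
    obtain ⟨c, hc⟩ := hneg
    exact hd ⟨0, hm⟩ (by rw [← hc]; simp)
  have hreg : ∀ᶠ u in 𝓝 t, u ∉ criticalValues (deform f g ε) :=
    (finite_criticalValues (derivative_ne_zero_of_natDegree hpos)).isClosed.isOpen_compl.mem_nhds (htt ▸ ht')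
  refine accPt_of_section h (Ψ := fun u => Ψ (u, ε)) (T := id) (u₀ := t) hΨ0 rfl ?_
    continuousAt_id ?_
  · filter_upwards [c1.eventually hΨ, hreg] with u hu hur
    refine ⟨ContinuousAt.comp (f := fun u : ℂ => (u, ε)) hu.1.continuousAt (by fun_prop),
      ⟨hu.2.1, u, hur, hu.2.2⟩, hu.2.2, hI _ _ hu.2.2⟩
  · exact self_mem_nhdsWithin

/-- The lifted ray is the family that makes a cycle regular. Its points are branches: monodromy
joins the base fibre to the limit at `ε = 0`, and the lift itself leads on from there. -/
theorem noAlienCycles_of_conditions {m n : ℕ} {f g : ℂ[X]} (hf : f.natDegree = m)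
    (hg : g.natDegree = n) (hm : 0 < m) (hnm : n < m) (hg0 : g ≠ 0) (K : ZeroCycle f m)
    (hM : IsMorse f m)
    (hB : ∀ (T : ℂ) (v : Fin m → ℂ), RootTuple (C f.leadingCoeff * X ^ m) f.leadingCoeff T v →
      v ≠ 0 → ∑ j, (K.weight j : ℂ) * v j ^ n ≠ 0)
    (h0 : NoCriticalZero f g K.weight m)
    (hev : ∀ᶠ ε in 𝓝[≠] (0 : ℂ), NoCriticalZero (deform f g ε) g K.weight m) :
    NoAlienCycles g K := by
  obtain ⟨ρ, hρ, hlift⟩ := zeroTuples_lift hf hg hm hnm hg0 hB h0 hev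
  have hball : ∀ᶠ ε in 𝓝[≠] (0 : ℂ), ‖ε‖ < ρ := by
    refine nhdsWithin_le_nhds ?_
    filter_upwards [Metric.ball_mem_nhds (0 : ℂ) hρ] with ε hε
    simpa using hε
  filter_upwards [hball, self_mem_nhdsWithin] with ε hερ hε0 t z hA
  obtain ⟨hsol, -, hnr⟩ := hA
  apply hnr
  have hzS := mem_zeroTuples_of_isInfinitesimalSolution hε0 hsol
  obtain ⟨Z, hZc, hZ1, hZS⟩ := hlift ε hε0 hερ z hzS
  set j₀ : Fin m := ⟨0, hm⟩
  have hdeg : ∀ ε, (deform f g ε).natDegree = m := fun ε =>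
    (natDegree_deform_of_lt (by omega) ε).1.trans hf
  have hval : ∀ s ∈ Set.Icc (0 : ℝ) 1, ∀ j, (deform f g ((s : ℂ) * ε)).eval (Z s j) =
      (deform f g ((s : ℂ) * ε)).eval (Z s j₀) := fun s hs j => by
    obtain ⟨-, ⟨t, ht⟩, -⟩ := hZS s hs
    exact (ht j).trans (ht j₀).symm
  have hreg : ∀ s ∈ Set.Icc (0 : ℝ) 1, (Z s, (s : ℂ) * ε) ∈ deformedTuples f g m := by
    intro s hs
    exact (mem_regularTuples_iff (hdeg _) hm).2 ⟨(hZS s hs).1, (hZS s hs).2.1⟩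
  have h0mem : (0 : ℝ) ∈ Set.Icc (0 : ℝ) 1 := ⟨le_rfl, zero_le_one⟩
  have hγ : ContinuousOn (fun s : ℝ => (Z s, (s : ℂ) * ε)) (Set.Icc 0 1) :=
    hZc.prodMk (Continuous.continuousOn (Complex.continuous_ofReal.mul continuous_const))
  have hZ0 : Z 0 ∈ regularTuples f m := by
    have := hreg 0 h0mem
    simpa [deformedTuples] using this
  have hbr := hM.joinedIn hf hm K.base_mem hZ0
  refine ⟨fun s => (deform f g ((s : ℂ) * ε)).eval (Z s j₀), Z, ?_, hZc, ?_, ⟨⟨hbr, ?_⟩, ?_⟩, ?_, ?_⟩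
  · exact (continuous_eval_deform f g).comp_continuousOn
      ((((continuous_apply j₀).comp continuous_fst).prodMk continuous_snd).comp_continuousOn hγ)
  · intro s hs
    have hs' : s ∈ Set.Icc (0 : ℝ) 1 := ⟨hs.1.le, hs.2⟩
    refine ⟨⟨(JoinedIn.prodMk_zero hbr).trans ?_, hval s hs'⟩, ?_⟩
    · have := joinedIn_of_continuousOn hγ hreg h0mem hs'
      simpa using this
    · have h1 := integral_deform_eq_zero K.sum_weight (hval s hs')
      rw [(hZS s hs').2.2, mul_zero, add_zero] at h1
      exact h1
  · intro j
    have := hval 0 h0mem j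
    simp only [Complex.ofReal_zero, zero_mul, deform_zero_right] at this ⊢
    exact this
  · have := (hZS 0 h0mem).2.2
    simp [this]
  · simp only [Complex.ofReal_one, one_mul, hZ1]
    exact hsol.1.2 j₀
  · rw [hZ1]

/-! ### Asymmetric weights -/

lemma Asymmetric.injective {m : ℕ} {w : Fin m → ℤ} (h : Asymmetric w) : Function.Injective w := by
  intro i j hij
  by_contra hne
  have h1 := h (Equiv.swap i j) (Or.inl (funext fun k => by
    rw [Function.comp_apply, Equiv.swap_apply_def]
    split_ifs with h1 h2
    · rw [h1, hij]
    · rw [h2, hij]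
    · rfl))
  exact hne ((Equiv.swap_eq_one_iff).1 h1)

/-- If all weights off `i ≠ j` vanished, then `w i = -w j` and the transposition of `i` and `j`
would send `w` to `-w`. The case `i = j` reduces to this by adding any other index. -/
lemma Asymmetric.exists_ne_zero {m : ℕ} {w : Fin m → ℤ} (h : Asymmetric w) (hm : 1 < m)
    (hw : ∑ j, w j = 0) (i j : Fin m) : ∃ k, k ≠ i ∧ k ≠ j ∧ w k ≠ 0 := by
  by_contra! hcon
  have h1 : ∀ i j, (∀ k, k ≠ i → k ≠ j → w k = 0) → i = j := by
    intro i j hcon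
    by_contra hne
    have hs : w i + w j = 0 := by
      rw [← hw, ← Finset.sum_pair hne]
      refine Finset.sum_subset (Finset.subset_univ _) fun k _ hk => ?_
      simp only [Finset.mem_insert, Finset.mem_singleton, not_or] at hk
      exact hcon k hk.1 hk.2
    have h1 := h (Equiv.swap i j) (Or.inr (funext fun k => by
      rw [Function.comp_apply, Equiv.swap_apply_def, Pi.neg_apply]
      split_ifs with h1 h2
      · rw [h1]; omega
      · rw [h2]; omega
      · rw [hcon k h1 h2]; rfl))
    exact hne ((Equiv.swap_eq_one_iff).1 h1)
  have : Nontrivial (Fin m) := Fin.nontrivial_iff_two_le.2 hm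
  have hij := h1 i j hcon
  obtain ⟨l, hl⟩ := exists_ne i
  exact hl (h1 l i fun k _ hk => hcon k hk (hij ▸ hk))

/-! ### Generic pairs have no alien limit cycles if `deg g < deg f` -/

theorem generic_noAlienCycles {m n : ℕ} (hm : 2 < m) (hnm : n < m) {w : Fin m → ℤ}
    (hw : ∑ j, w j = 0) (hA : Asymmetric w) :
    Generic fun x : PolySpace m × PolySpace n =>
      RegularAtInfinity x.1.poly x.2.poly w →
        ∀ K : ZeroCycle x.1.poly m, K.weight = w → NoAlienCycles x.2.poly K := by
  rcases Nat.eq_zero_or_pos n with rfl | hn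
  -- For constant `g` the displacement vanishes identically, so none of its zeros is isolated.
  · refine Generic.of_forall fun x _ K _ => ?_
    filter_upwards with ε t z hz
    refine hz.2.1 (accPt_of_integral_eq_zero (by omega) hz.1 fun t' z' h => ?_)
    have h1 := integral_deform_eq_zero K.sum_weight h
    obtain ⟨c, hc⟩ := natDegree_eq_zero.1 (natDegree_poly x.2)
    have h2 : integral K.weight x.2.poly z' = 0 := by
      simp only [integral, ← hc, eval_C]
      rw [← Finset.sum_mul, ← Int.cast_sum, K.sum_weight, Int.cast_zero, zero_mul]
    rw [h2, mul_zero, add_zero] at h1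
    exact h1
  · have : Nonempty (Fin m) := ⟨⟨0, by omega⟩⟩
    have hω := hA.exists_ne_zero (by omega) hw
    obtain ⟨j₁, -, -, hj₁⟩ := hω ⟨0, by omega⟩ ⟨0, by omega⟩
    have hmax : max m n = m := max_eq_left hnm.le
    refine (((generic_isMorse_fst n (by omega : 1 < m)).and
      (generic_noCriticalZero_fst hω (by omega) hn)).and
      (generic_eventually_noCriticalZero hω hw (by omega) hn (by omega : m ≠ n))).mono ?_
    rintro x ⟨⟨h1, h2⟩, h3⟩ hR K rfl
    rw [hmax] at h3
    refine noAlienCycles_of_conditions (natDegree_poly x.1) (natDegree_poly x.2) (by omega) hnm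
      ?_ K h1 (fun T v hv hv0 => ?_) h2 h3
    · intro h0
      have := natDegree_poly x.2
      rw [h0, natDegree_zero] at this
      omega
    · exact hR.sum_pow_ne_zero (natDegree_poly x.1) (by omega) (natDegree_poly x.2) hn
        (Nat.not_dvd_of_pos_of_lt hn hnm) hj₁ hv hv0

/-! ### Quadratic polynomials -/

lemma exists_eval_sub_eval_of_natDegree_two {f : ℂ[X]} (hf : f.natDegree = 2) :
    ∃ a σ : ℂ, a ≠ 0 ∧ ∀ x y, f.eval x - f.eval y = a * (x - y) * (x + y - σ) := by
  have ha : f.coeff 2 ≠ 0 := by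
    have := leadingCoeff_ne_zero_of_natDegree (p := f) (by omega)
    rwa [leadingCoeff, hf] at this
  refine ⟨f.coeff 2, -f.coeff 1 / f.coeff 2, ha, fun x y => ?_⟩
  rw [eval_eq_sum_range, eval_eq_sum_range, hf]
  simp only [Finset.sum_range_succ, Finset.sum_range_zero]
  field_simp
  ring

lemma isMorse_two (f : ℂ[X]) : IsMorse f 2 := by
  intro t Z hZ i j k l hij hkl h1 h2
  have h3 : ∀ i j : Fin 2, i ≠ j → Z i = Z j → ∀ k, Z k = Z i := by
    intro i j hij h k
    fin_cases i <;> fin_cases j <;> fin_cases k <;> simp_all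
  fin_cases i <;> fin_cases j <;> fin_cases k <;> fin_cases l <;> simp_all

/-- Two points in a common fibre of both members of a pencil `f + ε g`, with `f` quadratic, are not
in a critical fibre for small `ε`. -/
lemma eventually_not_mem_criticalValues {f g : ℂ[X]} {a σ : ℂ} (ha : a ≠ 0)
    (hf : ∀ x y, f.eval x - f.eval y = a * (x - y) * (x + y - σ)) {x : ℂ} (hx : x ≠ σ - x)
    (hg : g.eval x = g.eval (σ - x)) :
    ∀ᶠ ε in 𝓝 (0 : ℂ), (deform f g ε).eval x ∉ criticalValues (deform f g ε) := by
  have hfp : f = C (f.eval x) + C a * ((X - C x) * (X - C (σ - x))) := by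
    apply Polynomial.funext
    intro y
    have := hf y x
    simp only [eval_add, eval_mul, eval_sub, eval_C, eval_X]
    linear_combination this
  obtain ⟨q, hq⟩ : (X - C x) * (X - C (σ - x)) ∣ g - C (g.eval x) := by
    refine IsCoprime.mul_dvd (isCoprime_X_sub_C_of_isUnit_sub
      (isUnit_iff_ne_zero.2 (sub_ne_zero.2 hx))) ?_ ?_
    · exact X_sub_C_dvd_sub_C_eval
    · rw [hg]; exact X_sub_C_dvd_sub_C_eval
  -- `f + ε g` minus its value at `x` is `(X - x)(X - (σ - x))(a + ε q)`. A double root forces `a +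
  -- ε v = 0` with `v` the value of `q` at `x`, at `σ - x` or at a critical point of `q`; for
  -- finitely many `v` this fails when `ε` is small.
  have hV : ({v | ∃ c, q.derivative.eval c = 0 ∧ q.eval c = v} ∪ {q.eval x, q.eval (σ - x)}).Finite := by
    refine Set.Finite.union ?_ (Set.toFinite _)
    by_cases h0 : q.derivative = 0
    · have : q.natDegree = 0 := derivative_eq_zero.1 h0
      obtain ⟨k, hk⟩ := natDegree_eq_zero.1 this
      refine (Set.finite_singleton k).subset ?_
      rintro v ⟨c, -, rfl⟩
      simp [← hk]
    · exact finite_criticalValues h0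
  have hev : ∀ᶠ ε in 𝓝 (0 : ℂ), ∀ v ∈ {v | ∃ c, q.derivative.eval c = 0 ∧ q.eval c = v} ∪
      {q.eval x, q.eval (σ - x)}, a + ε * v ≠ 0 := by
    refine (hV.eventually_all).2 fun v _ => ?_
    have : ContinuousAt (fun ε : ℂ => a + ε * v) 0 := by fun_prop
    exact this.eventually_ne (by simpa using ha)
  filter_upwards [hev] with ε hε
  rintro ⟨c, hc1, hc2⟩
  have hp : deform f g ε = C ((deform f g ε).eval x) +
      (X - C x) * (X - C (σ - x)) * (C a + C ε * q) := by
    have hg' : g = C (g.eval x) + (X - C x) * (X - C (σ - x)) * q := by rw [← hq]; ring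
    rw [eval_deform, C_add, C_mul]
    conv_lhs => rw [deform, hfp, hg']
    ring
  have e1 : (c - x) * (c - (σ - x)) * (a + ε * q.eval c) = 0 := by
    have := congrArg (eval c) hp
    simp only [eval_add, eval_mul, eval_sub, eval_C, eval_X] at this
    rw [hc2] at this
    linear_combination -this
  have e2 : (2 * c - σ) * (a + ε * q.eval c) +
      (c - x) * (c - (σ - x)) * (ε * q.derivative.eval c) = 0 := by
    have := congrArg (fun p => p.derivative.eval c) hp
    simp only [derivative_add, derivative_mul, derivative_sub, derivative_C, derivative_X,
      eval_add, eval_mul, eval_sub, eval_C, eval_X, eval_zero, eval_one] at this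
    rw [hc1] at this
    linear_combination -this
  have hx' : 2 * x - σ ≠ 0 := fun h => hx (by linear_combination h)
  rcases mul_eq_zero.1 e1 with h | h
  · rw [h, zero_mul, add_zero] at e2
    rcases mul_eq_zero.1 h with h | h
    · obtain rfl : c = x := sub_eq_zero.1 h
      exact hε _ (Or.inr (Or.inl rfl)) ((mul_eq_zero.1 e2).resolve_left hx')
    · obtain rfl : c = σ - x := sub_eq_zero.1 h
      refine hε _ (Or.inr (Or.inr rfl)) ((mul_eq_zero.1 e2).resolve_left fun h => hx' ?_)
      linear_combination -h
  · rw [h, mul_zero, zero_add] at e2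
    rcases mul_eq_zero.1 e2 with h' | h'
    · rcases mul_eq_zero.1 h' with h' | h'
      · obtain rfl : c = x := sub_eq_zero.1 h'
        exact hε _ (Or.inr (Or.inl rfl)) h
      · obtain rfl : c = σ - x := sub_eq_zero.1 h'
        exact hε _ (Or.inr (Or.inr rfl)) h
    · rcases mul_eq_zero.1 h' with h' | h'
      · rw [h', zero_mul, add_zero] at h
        exact ha h
      · exact hε _ (Or.inl ⟨c, h', rfl⟩) h

/-- For nonzero weights a solution is a pair `z, σ - z` of distinct points with `g(z) = g(σ - z)`.
The condition is free of `ε`, so the constant pair is the required regular family. -/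
theorem noAlienCycles_of_natDegree_two {f g : ℂ[X]} (hf : f.natDegree = 2) (K : ZeroCycle f 2) :
    NoAlienCycles g K := by
  obtain ⟨a, σ, ha, hfs⟩ := exists_eval_sub_eval_of_natDegree_two hf
  have hw1 : (K.weight 1 : ℂ) = -K.weight 0 := by
    have := K.sum_weight
    rw [Fin.sum_univ_two] at this
    rw [eq_neg_iff_add_eq_zero, add_comm]
    exact_mod_cast this
  have hint : ∀ (q : ℂ[X]) (z : Fin 2 → ℂ),
      integral K.weight q z = K.weight 0 * (q.eval (z 0) - q.eval (z 1)) := fun q z => by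
    rw [integral, Fin.sum_univ_two, hw1]; ring
  by_cases hw0 : K.weight 0 = 0
  · filter_upwards with ε t z hz
    exact hz.2.1 (accPt_of_integral_eq_zero two_pos hz.1 fun t' z' _ => by simp [hint, hw0])
  have hw0' : (K.weight 0 : ℂ) ≠ 0 := Int.cast_ne_zero.2 hw0
  have hsol : ∀ ε t z, ε ≠ 0 → IsInfinitesimalSolution g K ε t z →
      z 0 ≠ σ - z 0 ∧ z 1 = σ - z 0 ∧ g.eval (z 0) = g.eval (σ - z 0) := by
    intro ε t z hε h
    have h1 := mem_zeroTuples_of_isInfinitesimalSolution hε h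
    have h2 := h.2
    rw [hint] at h2
    have h3 := (mul_eq_zero.1 h2).resolve_left hw0'
    rw [hfs] at h3
    have h4 : z 0 - z 1 ≠ 0 := sub_ne_zero.2 fun h => zero_ne_one (h1.1 h)
    have h5 := (mul_eq_zero.1 h3).resolve_left (mul_ne_zero ha h4)
    have h6 : z 1 = σ - z 0 := by linear_combination h5
    have h7 : integral K.weight g z = 0 := h1.2.2
    rw [hint] at h7
    have h8 := (mul_eq_zero.1 h7).resolve_left hw0'
    rw [h6] at h8 h4
    exact ⟨sub_ne_zero.1 h4, h6, sub_eq_zero.1 h8⟩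
  -- If `g` has the symmetry of `f`, symmetric pairs near the given one are solutions as well, and
  -- the zero is not isolated. Otherwise only finitely many `z` occur, and one bound on `ε` keeps
  -- all their fibres regular.
  by_cases hG : ∀ x, g.eval x = g.eval (σ - x)
  · filter_upwards [self_mem_nhdsWithin] with ε hε t z hz
    obtain ⟨h1, h2, -⟩ := hsol ε t z hε hz.1
    obtain ⟨hinj, t', ht', hzt'⟩ := hz.1.1.1.target_mem
    change ∀ j, (deform f g ε).eval (z j) = t' at hzt'
    change t' ∉ criticalValues (deform f g ε) at ht'
    have htt : t' = t := (hzt' 0).symm.trans (hz.1.1.2 0)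
    subst htt
    have hpos : 0 < (deform f g ε).natDegree := by
      by_contra hneg
      rw [not_lt, Nat.le_zero, natDegree_eq_zero] at hneg
      obtain ⟨c, hc⟩ := hneg
      exact ht' ⟨z 0, by rw [← hc]; simp, hzt' 0⟩
    have hcT : Continuous fun u => (deform f g ε).eval u := (deform f g ε).continuous
    have hreg : ∀ᶠ u in 𝓝 (z 0), (deform f g ε).eval u ∉ criticalValues (deform f g ε) :=
      hcT.continuousAt.eventually
        ((finite_criticalValues (derivative_ne_zero_of_natDegree hpos)).isClosed.isOpen_compl.mem_nhds
          (by change (deform f g ε).eval (z 0) ∉ _; rw [hzt' 0]; exact ht'))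
    have hne : ∀ᶠ u in 𝓝 (z 0), u ≠ σ - u := by
      have hc : ContinuousAt (fun u : ℂ => u - (σ - u)) (z 0) := by fun_prop
      filter_upwards [hc.eventually_ne (sub_ne_zero.2 h1)] with u hu
      exact sub_ne_zero.1 hu
    have hsym : ∀ u, (deform f g ε).eval (σ - u) = (deform f g ε).eval u := fun u => by
      have := hfs u (σ - u)
      rw [eval_deform, eval_deform, ← hG]
      linear_combination -this
    refine hz.2.1 (accPt_of_section hz.1 (Ψ := fun u => ![u, σ - u])
      (T := fun u => (deform f g ε).eval u) (u₀ := z 0) ?_ (hzt' 0) ?_ hcT.continuousAt ?_)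
    · funext j; fin_cases j <;> simp [h2]
    · filter_upwards [hreg, hne] with u hu1 hu2
      have hval : ∀ j : Fin 2, (deform f g ε).eval (![u, σ - u] j) = (deform f g ε).eval u := by
        intro j; fin_cases j
        · rfl
        · exact hsym u
      refine ⟨?_, ⟨?_, _, hu1, hval⟩, hval, ?_⟩
      · refine Continuous.continuousAt (continuous_pi fun j => ?_)
        fin_cases j
        · exact continuous_id
        · exact continuous_const.sub continuous_id
      · intro i j hij
        fin_cases i <;> fin_cases j
        · rfl
        · exact absurd hij hu2
        · exact absurd hij.symm hu2
        · rfl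
      · rw [hint]
        have := hfs u (σ - u)
        simp only [Matrix.cons_val_zero, Matrix.cons_val_one]
        rw [this]; ring
    · have hfin : ({u | (deform f g ε).eval u = t'} \ {z 0}).Finite :=
        (finite_setOf_eval_eq hpos t').sdiff
      filter_upwards [nhdsWithin_le_nhds (hfin.isClosed.isOpen_compl.mem_nhds (by simp)),
        self_mem_nhdsWithin] with u hu hu2 h
      exact hu ⟨h, hu2⟩
  · push Not at hG
    obtain ⟨x₀, hx₀⟩ := hG
    set G : ℂ[X] := g - g.comp (C σ - X) with hGdef
    have hGe : ∀ x, G.eval x = g.eval x - g.eval (σ - x) := fun x => by simp [hGdef]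
    have hG0 : G ≠ 0 := by
      intro h
      have := hGe x₀
      rw [h, eval_zero] at this
      exact hx₀ (sub_eq_zero.1 this.symm)
    have hev : ∀ᶠ ε in 𝓝 (0 : ℂ), ∀ x ∈ (G.roots.toFinset : Set ℂ), x ≠ σ - x →
        (deform f g ε).eval x ∉ criticalValues (deform f g ε) := by
      refine ((Finset.finite_toSet _).eventually_all).2 fun x hx => ?_
      by_cases hxx : x = σ - x
      · exact Eventually.of_forall fun _ h => absurd hxx h
      · have h1 : G.eval x = 0 := by simpa [hG0] using hx
        rw [hGe, sub_eq_zero] at h1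
        exact (eventually_not_mem_criticalValues ha hfs hxx h1).mono fun _ h _ => h
    obtain ⟨ρ, hρ, hρs⟩ := Metric.eventually_nhds_iff_ball.1 hev
    filter_upwards [self_mem_nhdsWithin, nhdsWithin_le_nhds (Metric.ball_mem_nhds (0 : ℂ) hρ)]
      with ε hε hερ t z hz
    obtain ⟨h1, h2, h3⟩ := hsol ε t z hε hz.1
    have hroot : z 0 ∈ (G.roots.toFinset : Set ℂ) := by
      have : G.eval (z 0) = 0 := by rw [hGe, h3, sub_self]
      simp [hG0, this]
    have hfz : f.eval (z 1) = f.eval (z 0) := by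
      have := hfs (z 1) (z 0)
      rw [h2] at this ⊢
      linear_combination this
    have hval : ∀ e j, (deform f g e).eval (z j) = (deform f g e).eval (z 0) := by
      intro e j; fin_cases j
      · rfl
      · change (deform f g e).eval (z 1) = _
        rw [eval_deform, eval_deform, hfz, h2, ← h3]
    have hzinj : Function.Injective z := hz.1.1.1.target_mem.1
    have hreg : ∀ s ∈ Set.Icc (0 : ℝ) 1, (z, (s : ℂ) * ε) ∈ deformedTuples f g 2 := by
      intro s hs
      refine ⟨hzinj, _, hρs _ ?_ _ hroot h1, hval _⟩
      simp only [Metric.mem_ball, dist_zero_right] at hερ ⊢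
      rw [norm_mul, Complex.norm_real, Real.norm_eq_abs, abs_of_nonneg hs.1]
      exact (mul_le_of_le_one_left (norm_nonneg _) hs.2).trans_lt hερ
    have h0mem : (0 : ℝ) ∈ Set.Icc (0 : ℝ) 1 := ⟨le_rfl, zero_le_one⟩
    have hz0 : z ∈ regularTuples f 2 := by
      have := hreg 0 h0mem
      simpa [deformedTuples] using this
    have hbr := (isMorse_two f).joinedIn hf two_pos K.base_mem hz0
    refine hz.2.2 ⟨fun s => (deform f g ((s : ℂ) * ε)).eval (z 0), fun _ => z, ?_,
      continuousOn_const, ?_, ⟨⟨hbr, fun j => ?_⟩, ?_⟩, ?_, rfl⟩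
    · exact Continuous.continuousOn ((continuous_eval_deform f g).comp
        (continuous_const.prodMk (Complex.continuous_ofReal.mul continuous_const)))
    · intro s hs
      have hs' : s ∈ Set.Icc (0 : ℝ) 1 := ⟨hs.1.le, hs.2⟩
      refine ⟨⟨(JoinedIn.prodMk_zero hbr).trans ?_, hval _⟩, hz.1.2⟩
      have := joinedIn_of_continuousOn (γ := fun s : ℝ => (z, (s : ℂ) * ε))
        (Continuous.continuousOn (by fun_prop)) hreg h0mem hs'
      simpa using this
    · have := hval 0 j
      simpa using this
    · rw [neg_eq_zero]
      exact (hint g z).trans (by rw [h2, h3, sub_self, mul_zero])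
    · simp only [Complex.ofReal_one, one_mul]
      exact hz.1.1.2 0

/-! ### The number of zeros of the displacement function -/

/-- Vandermonde: as many consecutive weighted power sums as there are points cannot all vanish. -/
lemma exists_sum_pow_ne_zero {κ : Type*} [Fintype κ] [Nonempty κ] {ω : κ → ℤ} (hω : ∀ i, ω i ≠ 0)
    {x : κ → ℂ} (hx : Function.Injective x) (hx0 : ∀ i, x i ≠ 0) (a : ℕ) :
    ∃ r, a ≤ r ∧ r < a + Fintype.card κ ∧ ∑ i, (ω i : ℂ) * x i ^ r ≠ 0 := by
  by_contra! hcon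
  set e := (Fintype.equivFin κ).symm
  have h := Matrix.eq_zero_of_forall_pow_sum_mul_pow_eq_zero (f := x ∘ e)
    (v := fun i => (ω (e i) : ℂ) * x (e i) ^ a) (hx.comp e.injective) fun i => by
      rw [← hcon (a + i) (by omega) (by omega), ← Equiv.sum_comp e]
      refine Finset.sum_congr rfl fun j _ => ?_
      rw [Function.comp_apply, pow_add]
      ring
  have h1 := congrFun h (Fintype.equivFin κ (Classical.arbitrary κ))
  simp only [Pi.zero_apply] at h1
  rcases mul_eq_zero.1 h1 with h1 | h1
  · exact hω _ (Int.cast_eq_zero.1 h1)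
  · exact hx0 _ (eq_zero_of_pow_eq_zero h1)

lemma choose_le_choose_of_le_of_le {N a k : ℕ} (h : a ≤ k) (hk : a + k ≤ N) :
    N.choose a ≤ N.choose k := by
  have key : ∀ k, a ≤ k → 2 * k ≤ N → N.choose a ≤ N.choose k := by
    intro k hk
    induction k, hk using Nat.le_induction with
    | base => intro _; exact le_rfl
    | succ k hk ih =>
      intro h2
      exact (ih (by omega)).trans (Nat.choose_le_succ_of_lt_half_left (by omega))
  by_cases h2 : 2 * k ≤ N
  · exact key k h h2
  · rw [← Nat.choose_symm (show k ≤ N by omega)]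
    exact key (N - k) (by omega) (by omega)

lemma two_mul_choose_two (N : ℕ) : 2 * (N + 1).choose 2 = (N + 1) * N := by
  have := Nat.descFactorial_eq_factorial_mul_choose (N + 1) 2
  simp only [Nat.descFactorial, Nat.factorial] at this
  have h2 : N + 1 - 1 = N := rfl
  rw [h2] at this
  simp only [Nat.sub_zero, mul_one] at this
  nlinarith

/-- This inequality and the next three compare degrees in `τ`, where `t = τⁿ`. The right side is the
number of injections times a lower bound for the degree of each factor; the left side is `n` times
the growth `n (m-1)!` available to bounded tuples. -/
lemma lt_descFactorial {m n : ℕ} (hm : 3 ≤ m) (hmn : m + 2 ≤ n) :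
    n * (n * (m - 1).factorial) < n.descFactorial m := by
  obtain ⟨N, rfl⟩ : ∃ N, n = N + 2 := ⟨n - 2, by omega⟩
  obtain ⟨k, rfl⟩ : ∃ k, m = k + 1 := ⟨m - 1, by omega⟩
  rw [Nat.succ_descFactorial_succ, Nat.descFactorial_eq_factorial_mul_choose]
  have h1 := choose_le_choose_of_le_of_le (N := N + 1) (a := 2) (k := k) (by omega) (by omega)
  have h2 := two_mul_choose_two N
  have h3 : N + 2 < (N + 1).choose k := by nlinarith
  have h4 := Nat.factorial_pos k
  rw [Nat.add_sub_cancel, mul_comm (N + 2) k.factorial]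
  exact Nat.mul_lt_mul_of_pos_left (Nat.mul_lt_mul_of_pos_left h3 h4) (by omega)

lemma lt_two_mul_descFactorial {m n : ℕ} (hm : 4 ≤ m) (hmn : m + 2 ≤ n) :
    n * (n * (m - 1).factorial) < 2 * n.descFactorial (m - 1) := by
  obtain ⟨N, rfl⟩ : ∃ N, n = N + 2 := ⟨n - 2, by omega⟩
  obtain ⟨k, rfl⟩ : ∃ k, m = k + 2 := ⟨m - 2, by omega⟩
  have e : k + 2 - 1 = k + 1 := rfl
  rw [e, Nat.succ_descFactorial_succ, Nat.descFactorial_eq_factorial_mul_choose,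
    Nat.factorial_succ]
  have h2 := two_mul_choose_two N
  have h3 : (N + 2) * (k + 1) < 2 * (N + 1).choose k := by
    rcases Nat.lt_or_ge k 3 with hk | hk
    · obtain rfl : k = 2 := by omega
      rw [h2]
      nlinarith
    · have h1 := choose_le_choose_of_le_of_le (N := N + 1) (a := 3) (k := k) (by omega) (by omega)
      have h5 := Nat.choose_succ_right_eq (N + 1) 2
      obtain ⟨M, rfl⟩ : ∃ M, N = M + 1 := ⟨N - 1, by omega⟩
      have h6 : M + 1 + 1 - 2 = M := rfl
      rw [h6] at h5
      norm_num at h5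
      have h7 : 6 * (M + 1 + 1).choose 3 = (M + 2) * (M + 1) * M := by nlinarith
      have h8 : k + 1 ≤ M := by omega
      have h9 : 6 * ((M + 1 + 2) * (k + 1)) < 2 * ((M + 2) * (M + 1) * M) := by
        calc 6 * ((M + 1 + 2) * (k + 1)) ≤ 6 * ((M + 3) * M) := by gcongr
          _ < 2 * ((M + 2) * (M + 1) * M) := by nlinarith
      omega
  have h4 := Nat.factorial_pos k
  calc (N + 2) * ((N + 2) * ((k + 1) * k.factorial))
      = (N + 2) * k.factorial * ((N + 2) * (k + 1)) := by ring
    _ < (N + 2) * k.factorial * (2 * (N + 1).choose k) :=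
        Nat.mul_lt_mul_of_pos_left h3 (by positivity)
    _ = _ := by ring

lemma lt_two_mul_descFactorial_succ {m : ℕ} (hm : 3 ≤ m) :
    (m + 1) * ((m + 1) * (m - 1).factorial) < 2 * (m + 1).descFactorial m := by
  obtain ⟨k, rfl⟩ : ∃ k, m = k + 1 := ⟨m - 1, by omega⟩
  rw [Nat.succ_descFactorial_succ, Nat.descFactorial_eq_factorial_mul_choose, Nat.choose_succ_self_right,
    Nat.add_sub_cancel]
  have h4 := Nat.factorial_pos k
  calc (k + 1 + 1) * ((k + 1 + 1) * k.factorial) = (k + 2) * k.factorial * (k + 2) := by ring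
    _ < (k + 2) * k.factorial * (2 * (k + 1)) := Nat.mul_lt_mul_of_pos_left (by omega) (by positivity)
    _ = _ := by ring

lemma lt_three_mul_descFactorial_succ {m : ℕ} (hm : 3 ≤ m) :
    (m + 1) * ((m + 1) * (m - 1).factorial) < 3 * (m + 1).descFactorial (m - 1) := by
  obtain ⟨k, rfl⟩ : ∃ k, m = k + 2 := ⟨m - 2, by omega⟩
  have e : k + 2 - 1 = k + 1 := rfl
  rw [e, Nat.succ_descFactorial_succ, Nat.descFactorial_eq_factorial_mul_choose, Nat.factorial_succ]
  have h1 : 2 * (k + 2).choose k = (k + 2) * (k + 1) := by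
    rw [← Nat.choose_symm (show k ≤ k + 2 by omega), Nat.add_sub_cancel_left]
    exact two_mul_choose_two (k + 1)
  have h4 := Nat.factorial_pos k
  have h5 : 2 * ((k + 3) * (k + 1)) < 2 * (3 * (k + 2).choose k) := by nlinarith
  calc (k + 2 + 1) * ((k + 2 + 1) * ((k + 1) * k.factorial))
      = (k + 3) * k.factorial * ((k + 3) * (k + 1)) := by ring
    _ < (k + 3) * k.factorial * (3 * (k + 2).choose k) :=
        Nat.mul_lt_mul_of_pos_left (by omega) (by positivity)
    _ = _ := by ring

/-- A lower bound for the orders at infinity of the factors of the displacement function. -/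
lemma exists_lower_bound {m n m' : ℕ} (hm : 3 ≤ m) (hmn : m < n) (hm' : 3 ≤ m')
    (h : m' = m ∨ m' + 1 = m) :
    ∃ L, n * (n * (m - 1).factorial) < L * n.descFactorial m' ∧
      (L + m' = m + 1 ∨ (L + m' = m + 2 ∧ n = m + 1)) := by
  rcases Nat.lt_or_ge n (m + 2) with h1 | h1
  · obtain rfl : n = m + 1 := by omega
    rcases h with rfl | h
    · exact ⟨2, lt_two_mul_descFactorial_succ hm, Or.inr ⟨by omega, rfl⟩⟩
    · obtain rfl : m' = m - 1 := by omega
      exact ⟨3, lt_three_mul_descFactorial_succ hm, Or.inr ⟨by omega, rfl⟩⟩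
  · rcases h with rfl | h
    · exact ⟨1, by rw [one_mul]; exact lt_descFactorial hm h1, Or.inl (by omega)⟩
    · obtain rfl : m' = m - 1 := by omega
      exact ⟨2, lt_two_mul_descFactorial (by omega) h1, Or.inl (by omega)⟩

/-- The model pair is `f = 1 + X + ⋯ + X^m` and `f + g = X^n`. The fibre over `τⁿ` is `τ` times the
`n`-th roots of unity, so each factor is a polynomial `Q σ` in `τ` whose coefficients are power
sums, and its degree is at least `L`. -/
lemma lt_natDegree_of_eval_eq_prod {κ : Type*} [Fintype κ] [DecidableEq κ] [Nonempty κ] {ω : κ → ℤ}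
    (hω : ∀ i, ω i ≠ 0) (hω0 : ∑ i, ω i = 0) {m n : ℕ} (hm : 3 ≤ m) (hmn : m < n)
    (hm' : 3 ≤ Fintype.card κ) (hκ : Fintype.card κ = m ∨ Fintype.card κ + 1 = m) {f P : ℂ[X]}
    (hf : f = ∑ r ∈ Finset.range (m + 1), X ^ r) {c : ℂ} (hc : c ≠ 0)
    (hP : ∀ (t : ℂ) (Z : Fin n → ℂ), RootTuple (X ^ n) 1 t Z →
      P.eval t = c * ∏ σ : κ ↪ Fin n, ∑ i, (ω i : ℂ) * f.eval (Z (σ i))) :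
    n * (m - 1).factorial < P.natDegree := by
  obtain ⟨L, hL, hLm⟩ := exists_lower_bound hm hmn hm' hκ
  have hn : 0 < n := by omega
  obtain ⟨Z, hZ⟩ := exists_rootTuple (p := (X ^ n : ℂ[X])) (natDegree_X_pow n) hn 1
  rw [(monic_X_pow n).leadingCoeff] at hZ
  have hZC : RootTuple (C 1 * X ^ n) 1 1 Z := by simpa using hZ
  have hZn : ∀ i, Z i ^ n = 1 := fun i => by simpa using hZ.eval_root i
  have hZ0 : ∀ i, Z i ≠ 0 := fun i h => by
    have := hZn i
    rw [h, zero_pow hn.ne'] at this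
    exact zero_ne_one this
  have hZi : Function.Injective Z := (hZC.pow_injective one_ne_zero (fun h => hZ0 ⟨0, hn⟩ (by
    rw [h]; rfl))).1
  set Q : (κ ↪ Fin n) → ℂ[X] := fun σ =>
    ∑ r ∈ Finset.range (m + 1), C (∑ i, (ω i : ℂ) * Z (σ i) ^ r) * X ^ r with hQ
  have hcoeff : ∀ σ, ∀ r ≤ m, (Q σ).coeff r = ∑ i, (ω i : ℂ) * Z (σ i) ^ r := by
    intro σ r hr
    simp only [hQ, finsetSum_coeff, coeff_C_mul, coeff_X_pow]
    simp only [mul_ite, mul_one, mul_zero]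
    rw [Finset.sum_ite_eq]
    simp [Nat.lt_succ_of_le hr]
  have hQL : ∀ σ, L ≤ (Q σ).natDegree ∧ Q σ ≠ 0 := by
    intro σ
    obtain ⟨r, hr1, hr2, hr3⟩ := exists_sum_pow_ne_zero hω (x := fun i => Z (σ i))
      (hZi.comp σ.injective) (fun i => hZ0 _) L
    -- The exponents provided by Vandermonde end at `m`, or at `m + 1 = n`. The latter is excluded:
    -- `n`-th powers of the roots of unity are 1, so that power sum is `∑ ωᵢ = 0`.
    have hrm : r ≤ m := by
      rcases hLm with h | ⟨h, h'⟩
      · omega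
      · by_contra hlt
        obtain rfl : r = n := by omega
        apply hr3
        simp only [hZn, mul_one]
        rw [← Int.cast_sum, hω0, Int.cast_zero]
    have hne : (Q σ).coeff r ≠ 0 := by rw [hcoeff σ r hrm]; exact hr3
    exact ⟨hr1.trans (le_natDegree_of_ne_zero hne), fun h => hne (by rw [h, coeff_zero])⟩
  have hcomp : P.comp (X ^ n) = C c * ∏ σ, Q σ := by
    refine Polynomial.eq_of_infinite_eval_eq _ _ (Set.Infinite.mono ?_
      (Set.infinite_of_finite_compl (s := {0}ᶜ) (by simp)))
    intro τ hτ
    have h1 := hZC.smul_pow (c := τ) hτ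
    rw [mul_one, C_1, one_mul] at h1
    change (P.comp (X ^ n)).eval τ = (C c * ∏ σ, Q σ).eval τ
    rw [eval_comp, eval_pow, eval_X, hP _ _ h1, eval_mul, eval_C, eval_prod]
    congr 1
    refine Finset.prod_congr rfl fun σ _ => ?_
    simp only [hf, hQ, eval_finsetSum, eval_pow, eval_X, eval_mul, eval_C, Pi.smul_apply,
      smul_eq_mul, Finset.mul_sum, Finset.sum_mul]
    rw [Finset.sum_comm]
    refine Finset.sum_congr rfl fun r _ => Finset.sum_congr rfl fun i _ => ?_
    ring
  have hdeg := congrArg natDegree hcomp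
  rw [natDegree_comp, natDegree_X_pow, natDegree_C_mul hc,
    natDegree_prod _ _ fun σ _ => (hQL σ).2] at hdeg
  have hsum : Fintype.card (κ ↪ Fin n) * L ≤ ∑ σ, (Q σ).natDegree := by
    rw [← Finset.card_univ, ← smul_eq_mul]
    exact Finset.card_nsmul_le_sum _ _ _ fun σ _ => (hQL σ).1
  rw [Fintype.card_embedding_eq, Fintype.card_fin, ← hdeg, mul_comm] at hsum
  refine Nat.lt_of_mul_lt_mul_left (a := n) ?_
  rw [mul_comm n P.natDegree]
  exact hL.trans_le hsum

/-- Generically, the product of all branches of the displacement function is a polynomial of large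
degree. -/
theorem generic_lt_natDegree {κ : Type*} [Fintype κ] [DecidableEq κ] [Nonempty κ] {ω : κ → ℤ}
    (hω : ∀ i, ω i ≠ 0) (hω0 : ∑ i, ω i = 0) {m n : ℕ} (hm : 3 ≤ m) (hmn : m < n)
    (hm' : 3 ≤ Fintype.card κ) (hκ : Fintype.card κ = m ∨ Fintype.card κ + 1 = m) :
    Generic fun x : PolySpace m × PolySpace n =>
      ∀ᶠ ε in 𝓝[≠] (0 : ℂ), ∃ (P : ℂ[X]) (c : ℂ), c ≠ 0 ∧ n * (m - 1).factorial < P.natDegree ∧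
        ∀ (t : ℂ) (Z : Fin n → ℂ), RootTuple (deform x.1.poly x.2.poly ε)
          (deform x.1.poly x.2.poly ε).leadingCoeff t Z →
            P.eval t = c * ∏ σ : κ ↪ Fin n, ∑ i, (ω i : ℂ) * x.1.poly.eval (Z (σ i)) := by
  have hmax : max m n = n := max_eq_right hmn.le
  obtain ⟨k, Ξ, hΞ⟩ := exists_product_polynomial n (by omega) (universalSum m n)
    (universalFst m n) ω
  set f₀ : ℂ[X] := ∑ r ∈ Finset.range (m + 1), X ^ r with hf₀
  have hf₀d : f₀.natDegree ≤ m := natDegree_sum_le_of_forall_le _ _ fun r hr => by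
    rw [natDegree_X_pow]
    exact Nat.lt_succ_iff.1 (Finset.mem_range.1 hr)
  set e : CoeffPairs m n := (coeffVec m f₀, coeffVec n (X ^ n - f₀)) with he
  have hesum : (universalSum m n).map (lineFun.evalAt e) = X ^ n := by
    rw [map_universalSum, vecPoly_coeffVec hf₀d, vecPoly_coeffVec]
    · ring
    · refine (natDegree_sub_le _ _).trans (max_le (natDegree_X_pow_le n) (by omega))
  have hefst : (universalFst m n).map (lineFun.evalAt e) = f₀ := by
    rw [map_universalFst, vecPoly_coeffVec hf₀d]
  have hecoeff : lineFun.evalAt e ((universalSum m n).coeff n) = 1 := by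
    rw [← coeff_map, hesum, coeff_X_pow, if_pos rfl]
  have hdeg : n * (m - 1).factorial < (Ξ.map (lineFun.evalAt e)).natDegree := by
    refine lt_natDegree_of_eval_eq_prod hω hω0 hm hmn hm' hκ hf₀ one_ne_zero fun t Z hZ => ?_
    have := hΞ (lineFun.evalAt e) t Z (by rw [hesum, hecoeff]; exact hZ)
    rw [this, hecoeff, one_pow, hefst]
  set D := (Ξ.map (lineFun.evalAt e)).natDegree with hD
  -- The coefficient of degree `D` is nonzero for the model pair, hence generically. The degree can
  -- therefore only be larger than in the model.
  refine (Generic.eventually_of_lineFun (Ξ.coeff D) (e := e) ?_).mono fun x hx => ?_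
  · rw [← coeff_map, hD, coeff_natDegree, Ne, leadingCoeff_eq_zero]
    intro h
    rw [hD, h, natDegree_zero] at hdeg
    omega
  · filter_upwards [hx, self_mem_nhdsWithin] with ε hε hε0
    set φ := lineFun.evalAt (x.1.1, ε • x.2.1) with hφ
    have hne := evalAt_coeff_ne_zero (by omega : m ≠ n) x hε0
    rw [hmax] at hne
    have hsum : (universalSum m n).map φ = deform x.1.poly x.2.poly ε := by
      rw [map_universalSum, ← deform_eq_vecPoly]
    have hlead : (deform x.1.poly x.2.poly ε).leadingCoeff = φ ((universalSum m n).coeff n) := by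
      have h1 := natDegree_deform_poly (by omega : m ≠ n) x hε0
      rw [leadingCoeff, h1, hmax, ← hsum, coeff_map]
    refine ⟨Ξ.map φ, φ ((universalSum m n).coeff n) ^ k, pow_ne_zero _ hne, ?_, fun t Z hZ => ?_⟩
    · refine hdeg.trans_le (le_natDegree_of_ne_zero ?_)
      rw [coeff_map]; exact hε
    · rw [hlead] at hZ
      have := hΞ φ t Z (by rw [hsum]; exact hZ)
      rw [this, map_universalFst]
      rfl

/-! ### Degeneration of fibres as the degree drops -/

lemma exists_limit_rootTuple {α : Type*} (U : Ultrafilter α) {P : α → ℂ[X]} {p : ℂ[X]}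
    {n m : ℕ} (h : PolyTendsto P U p n) (hpm : p.natDegree = m) (hm : 0 < m) {A T : α → ℂ}
    {t : ℂ} {Z : α → Fin n → ℂ} (hT : Tendsto T U (𝓝 t))
    (hR : ∀ᶠ y in (U : Filter α), RootTuple (P y) (A y) (T y) (Z y)) :
    ∃ (e : Fin m ↪ Fin n) (Z' : Fin m → ℂ), RootTuple p p.leadingCoeff t Z' ∧
      (∀ j, Tendsto (fun y => Z y (e j)) U (𝓝 (Z' j))) ∧
      ∀ i ∉ Set.range e, Tendsto (fun y => ‖Z y i‖) U atTop := by
  obtain ⟨s, ζ, hs, h1, h2, h3⟩ := exists_tendsto_roots_of_degree_drop U h hpm hm hT hR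
  set e : Fin m ≃ s := (s.equivFinOfCardEq hs).symm with he
  refine ⟨e.toEmbedding.trans (Function.Embedding.subtype _), fun j => ζ (e j), fun x => ?_,
    fun j => h1 _ (e j).2, fun i hi => h2 i fun his => hi ⟨e.symm ⟨i, his⟩, by simp⟩⟩
  rw [h3, ← Finset.prod_coe_sort s, ← Equiv.prod_comp e]

/-- If all entries of `Z ∘ σ` stay bounded, then `σ` factors through the bounded roots. -/
lemma exists_factor_of_bounded {α κ : Type*} (U : Ultrafilter α) {n m : ℕ} {Z : α → Fin n → ℂ}
    {e : Fin m ↪ Fin n} (he : ∀ i ∉ Set.range e, Tendsto (fun y => ‖Z y i‖) U atTop) {B : ℝ}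
    {σ : κ ↪ Fin n} (hσ : ∀ᶠ y in (U : Filter α), ∀ i, ‖Z y (σ i)‖ ≤ B) :
    ∃ σ' : κ ↪ Fin m, ∀ i, σ i = e (σ' i) := by
  have h1 : ∀ i, ∃ j, e j = σ i := fun i => by
    by_contra hcon
    obtain ⟨y, hy1, hy2⟩ := (((he _ hcon).eventually_gt_atTop B).and hσ).exists
    exact absurd (hy2 i) (not_le.2 hy1)
  choose σ' hσ' using h1
  exact ⟨⟨σ', fun i j hij => σ.injective (by rw [← hσ', ← hσ', hij])⟩, fun i => (hσ' i).symm⟩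

section

variable {f g : ℂ[X]} {m n : ℕ}

lemma polyTendsto_deform_zero (hf : f.natDegree ≤ n) (hg : g.natDegree ≤ n) {l : Filter ℂ}
    (hl : l ≤ 𝓝 0) : PolyTendsto (deform f g) l f n := by
  have := (polyTendsto_deform hf hg 0).mono hl
  rwa [deform_zero_right] at this

lemma tendsto_eval_deform {α : Type*} {l : Filter α} {E X : α → ℂ} {x : ℂ} (hE : Tendsto E l (𝓝 0))
    (hX : Tendsto X l (𝓝 x)) :
    Tendsto (fun y => (deform f g (E y)).eval (X y)) l (𝓝 (f.eval x)) := by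
  have := ((continuous_eval_deform f g).tendsto (x, 0)).comp (hX.prodMk_nhds hE)
  simpa [Function.comp_def] using this

/-- At most `deg f` roots of `f + ε g - t` are bounded. -/
lemma eventually_card_bounded_roots_le (hf : f.natDegree = m) (hm : 0 < m) (hmn : m ≤ n)
    (hg : g.natDegree ≤ n) (ρ B : ℝ) :
    ∀ᶠ ε in 𝓝 (0 : ℂ), ∀ (a t : ℂ) (Z : Fin n → ℂ), ‖t‖ ≤ ρ → RootTuple (deform f g ε) a t Z →
      (Finset.univ.filter fun i => ‖Z i‖ ≤ B).card ≤ m := by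
  refine eventually_of_forall_ultrafilter fun U hU hbad => ?_
  push Not at hbad
  have hbad' : ∀ᶠ ε in (U : Filter ℂ), ∃ x : (Fin n → ℂ) × ℂ × ℂ, ‖x.2.2‖ ≤ ρ ∧
      RootTuple (deform f g ε) x.2.1 x.2.2 x.1 ∧
        m < (Finset.univ.filter fun i => ‖x.1 i‖ ≤ B).card :=
    hbad.mono fun ε ⟨a, t, Z, h⟩ => ⟨(Z, a, t), h⟩
  obtain ⟨x, hx⟩ := hbad'.choice
  obtain ⟨t, ht⟩ := exists_tendsto_of_norm_le U (fun ε => (x ε).2.2) ρ (hx.mono fun ε h => h.1)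
  obtain ⟨e, Z', -, -, he⟩ := exists_limit_rootTuple U
    (polyTendsto_deform_zero (by omega) hg hU) hf hm ht (hx.mono fun ε h => h.2.1)
  have h1 : ∀ᶠ ε in (U : Filter ℂ), ∀ i, i ∉ Set.range e → B < ‖(x ε).1 i‖ := by
    rw [eventually_all]
    intro i
    by_cases hi : i ∈ Set.range e
    · exact Eventually.of_forall fun _ h => absurd hi h
    · exact ((he i hi).eventually_gt_atTop B).mono fun _ h _ => h
  obtain ⟨ε, h2, h3⟩ := (h1.and hx).exists
  refine absurd h3.2.2 (not_lt.2 ?_)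
  calc (Finset.univ.filter fun i => ‖(x ε).1 i‖ ≤ B).card ≤ (Finset.univ.map e).card := by
        refine Finset.card_le_card fun i hi => ?_
        rw [Finset.mem_map]
        by_contra hcon
        refine absurd (Finset.mem_filter.1 hi).2 (not_le.2 (h2 i fun ⟨j, hj⟩ => hcon ⟨j, by simp, hj⟩))
    _ = m := by simp

lemma tendsto_sum_eval {α κ : Type*} [Fintype κ] {l : Filter α} (ω : κ → ℤ) (q : ℂ[X])
    {Z : α → κ → ℂ} {Z' : κ → ℂ} (h : ∀ i, Tendsto (fun y => Z y i) l (𝓝 (Z' i))) :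
    Tendsto (fun y => ∑ i, (ω i : ℂ) * q.eval (Z y i)) l
      (𝓝 (∑ i, (ω i : ℂ) * q.eval (Z' i))) :=
  tendsto_finsetSum _ fun i _ => tendsto_const_nhds.mul ((q.continuous.tendsto _).comp (h i))

/-- Integrals along bounded divisors are close to integrals over fibres of `f`. -/
lemma eventually_lt_norm_integral {κ : Type*} [Fintype κ] (hf : f.natDegree = m) (hm : 0 < m)
    (hmn : m ≤ n) (hg : g.natDegree ≤ n) (ω : κ → ℤ) (t₁ : ℂ) (B α₀ : ℝ)
    (hα : ∀ Z : Fin m → ℂ, RootTuple f f.leadingCoeff t₁ Z → ∀ σ : κ ↪ Fin m,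
      α₀ < ‖∑ i, (ω i : ℂ) * g.eval (Z (σ i))‖) :
    ∀ᶠ ε in 𝓝 (0 : ℂ), ∀ (a : ℂ) (Z : Fin n → ℂ), RootTuple (deform f g ε) a t₁ Z →
      ∀ σ : κ ↪ Fin n, (∀ i, ‖Z (σ i)‖ ≤ B) → α₀ < ‖∑ i, (ω i : ℂ) * g.eval (Z (σ i))‖ := by
  refine eventually_of_forall_ultrafilter fun U hU hbad => ?_
  push Not at hbad
  have hbad' : ∀ᶠ ε in (U : Filter ℂ), ∃ x : (Fin n → ℂ) × ℂ × (κ ↪ Fin n),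
      RootTuple (deform f g ε) x.2.1 t₁ x.1 ∧ (∀ i, ‖x.1 (x.2.2 i)‖ ≤ B) ∧
        ‖∑ i, (ω i : ℂ) * g.eval (x.1 (x.2.2 i))‖ ≤ α₀ :=
    hbad.mono fun ε ⟨a, Z, h, σ, h2⟩ => ⟨(Z, a, σ), h, h2⟩
  obtain ⟨x, hx⟩ := hbad'.choice
  obtain ⟨σ, hσ⟩ := eventually_eq_of_finite U fun ε => (x ε).2.2
  obtain ⟨e, Z', hZ', hZe, he⟩ := exists_limit_rootTuple U
    (polyTendsto_deform_zero (by omega) hg hU) hf hm tendsto_const_nhds (hx.mono fun ε h => h.1)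
  obtain ⟨σ', hσ'⟩ := exists_factor_of_bounded U he (B := B) (σ := σ) (by
    filter_upwards [hx, hσ] with ε h1 h2
    rw [← h2]; exact h1.2.1)
  have hlim := (tendsto_sum_eval ω g fun i => hZe (σ' i)).norm
  obtain ⟨ε, h1, h2, h3⟩ := (((hlim.eventually (lt_mem_nhds (hα Z' hZ' σ'))).and (hx.and hσ))).exists
  refine absurd h2.2.2 (not_le.2 ?_)
  rw [h3]
  simp only [hσ']
  exact h1

/-- Bounded solutions of the infinitesimal problem stay away from the boundary. -/
lemma eventually_norm_lt_of_integral_eq_zero {κ : Type*} [Fintype κ] (hf : f.natDegree = m)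
    (hm : 0 < m) (hmn : m ≤ n) (hg : g.natDegree ≤ n) (ω : κ → ℤ) {R R₁ : ℝ} (hRR : R < R₁)
    (hR : ∀ (t : ℂ) (Z : Fin m → ℂ), RootTuple f f.leadingCoeff t Z → ∀ σ : κ ↪ Fin m,
      ∑ i, (ω i : ℂ) * g.eval (Z (σ i)) = 0 → ∀ j, ‖Z j‖ ≤ R) :
    ∀ᶠ ε in 𝓝 (0 : ℂ), ∀ (a t : ℂ) (Z : Fin n → ℂ), RootTuple (deform f g ε) a t Z →
      ∀ σ : κ ↪ Fin n, (∀ i, ‖Z (σ i)‖ ≤ R₁) → ∑ i, (ω i : ℂ) * g.eval (Z (σ i)) = 0 →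
        ∀ i, ‖Z (σ i)‖ < R₁ := by
  refine eventually_of_forall_ultrafilter fun U hU hbad => ?_
  push Not at hbad
  have hbad' : ∀ᶠ ε in (U : Filter ℂ), ∃ x : (Fin n → ℂ) × (ℂ × ℂ) × (κ ↪ Fin n) × κ,
      RootTuple (deform f g ε) x.2.1.1 x.2.1.2 x.1 ∧ (∀ i, ‖x.1 (x.2.2.1 i)‖ ≤ R₁) ∧
        ∑ i, (ω i : ℂ) * g.eval (x.1 (x.2.2.1 i)) = 0 ∧ R₁ ≤ ‖x.1 (x.2.2.1 x.2.2.2)‖ :=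
    hbad.mono fun ε ⟨a, t, Z, h, σ, h2, h3, i, h4⟩ => ⟨(Z, (a, t), σ, i), h, h2, h3, h4⟩
  obtain ⟨x, hx⟩ := hbad'.choice
  obtain ⟨⟨σ, i⟩, hσ⟩ := eventually_eq_of_finite U fun ε => (x ε).2.2
  have hx2 : ∀ᶠ ε in (U : Filter ℂ), RootTuple (deform f g ε) (x ε).2.1.1 (x ε).2.1.2 (x ε).1 ∧
      (∀ i, ‖(x ε).1 (σ i)‖ ≤ R₁) ∧ ∑ i, (ω i : ℂ) * g.eval ((x ε).1 (σ i)) = 0 ∧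
        R₁ ≤ ‖(x ε).1 (σ i)‖ := by
    filter_upwards [hx, hσ] with ε h1 h2
    rw [h2] at h1
    exact h1
  obtain ⟨ξ, hξ⟩ := exists_tendsto_of_norm_le U (fun ε => (x ε).1 (σ i)) R₁
    (hx2.mono fun ε h => h.2.1 i)
  have hT : Tendsto (fun ε => (x ε).2.1.2) U (𝓝 (f.eval ξ)) := by
    refine (tendsto_eval_deform (f := f) (g := g) (E := id) hU hξ).congr' ?_
    filter_upwards [hx2] with ε h
    exact h.1.eval_root _
  obtain ⟨e, Z', hZ', hZe, he⟩ := exists_limit_rootTuple U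
    (polyTendsto_deform_zero (by omega) hg hU) hf hm hT (hx2.mono fun ε h => h.1)
  obtain ⟨σ', hσ'⟩ := exists_factor_of_bounded U he (hx2.mono fun ε h => h.2.1)
  have hlim := tendsto_sum_eval ω g fun i => hZe (σ' i)
  have h0 : ∑ i, (ω i : ℂ) * g.eval (Z' (σ' i)) = 0 := by
    refine tendsto_nhds_unique hlim (tendsto_const_nhds.congr' ?_)
    filter_upwards [hx2] with ε h
    simp only [← hσ']
    exact h.2.2.1.symm
  have h1 : R₁ ≤ ‖Z' (σ' i)‖ := by
    refine ge_of_tendsto (hZe (σ' i)).norm ?_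
    filter_upwards [hx2] with ε h
    rw [← hσ']; exact h.2.2.2
  linarith [hR _ _ hZ' σ' h0 (σ' i)]

/-- A regular value of `f` is a regular value of `f + ε g` for small `ε`. -/
lemma eventually_not_mem_criticalValues_deform (hf : f.natDegree = m) (hm : 0 < m)
    (hg : g.natDegree = n) (hmn : m < n) {t : ℂ} (ht : t ∉ criticalValues f) :
    ∀ᶠ ε in 𝓝 (0 : ℂ), t ∉ criticalValues (deform f g ε) := by
  -- Eliminating `ε` from `f + ε g = t` and `f' + ε g' = 0` leaves `q = 0`. Its coefficient of
  -- degree `m + n - 1` is `(n - m)` times the product of the leading coefficients, so only finitely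
  -- many points can become critical over `t`, for any `ε`.
  set q := (f - C t) * derivative g - derivative f * g with hq
  have hd1 : (f - C t).natDegree = m := by rw [natDegree_sub_C, hf]
  have hq0 : q.coeff (m + (n - 1)) ≠ 0 := by
    obtain ⟨k, rfl⟩ : ∃ k, m = k + 1 := ⟨m - 1, by omega⟩
    obtain ⟨l, rfl⟩ : ∃ l, n = l + 1 := ⟨n - 1, by omega⟩
    have h1 : ((f - C t) * derivative g).coeff (k + 1 + (l + 1 - 1)) =
        f.coeff (k + 1) * (g.coeff (l + 1) * ((l : ℂ) + 1)) := by
      rw [Nat.add_sub_cancel, coeff_mul_add_eq_of_natDegree_le hd1.le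
        ((natDegree_derivative_le g).trans (by omega)), coeff_derivative, coeff_sub,
        coeff_C_succ, sub_zero]
    have h2 : (derivative f * g).coeff (k + 1 + (l + 1 - 1)) =
        f.coeff (k + 1) * ((k : ℂ) + 1) * g.coeff (l + 1) := by
      have e : k + 1 + (l + 1 - 1) = k + (l + 1) := by omega
      rw [e, coeff_mul_add_eq_of_natDegree_le ((natDegree_derivative_le f).trans (by omega)) hg.le,
        coeff_derivative]
    have h3 : f.coeff (k + 1) ≠ 0 := by
      have := leadingCoeff_ne_zero_of_natDegree (p := f) (by omega)
      rwa [leadingCoeff, hf] at this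
    have h4 : g.coeff (l + 1) ≠ 0 := by
      have := leadingCoeff_ne_zero_of_natDegree (p := g) (by omega)
      rwa [leadingCoeff, hg] at this
    rw [hq, coeff_sub, h1, h2]
    have h5 : (l : ℂ) - k ≠ 0 := by
      rw [sub_ne_zero]
      intro h
      have : l = k := by exact_mod_cast h
      omega
    have h6 : f.coeff (k + 1) * (g.coeff (l + 1) * ((l : ℂ) + 1)) -
        f.coeff (k + 1) * ((k : ℂ) + 1) * g.coeff (l + 1) =
        f.coeff (k + 1) * g.coeff (l + 1) * (l - k) := by ring
    rw [h6]
    exact mul_ne_zero (mul_ne_zero h3 h4) h5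
  have hqne : q ≠ 0 := fun h => hq0 (by rw [h, coeff_zero])
  have hev : ∀ᶠ ε in 𝓝 (0 : ℂ), ∀ c ∈ (q.roots.toFinset : Set ℂ),
      (deform f g ε).derivative.eval c = 0 → (deform f g ε).eval c ≠ t := by
    refine ((Finset.finite_toSet _).eventually_all).2 fun c _ => ?_
    have hc1 : Tendsto (fun ε => (deform f g ε).eval c) (𝓝 0) (𝓝 (f.eval c)) :=
      tendsto_eval_deform tendsto_id tendsto_const_nhds
    have hc2 : Tendsto (fun ε => (deform f g ε).derivative.eval c) (𝓝 0)
        (𝓝 (f.derivative.eval c)) := by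
      simp only [derivative_deform]
      exact tendsto_eval_deform tendsto_id tendsto_const_nhds
    by_cases h0 : f.derivative.eval c = 0
    · have h1 : f.eval c ≠ t := fun h => ht ⟨c, h0, h⟩
      filter_upwards [hc1.eventually_ne h1] with ε h _
      exact h
    · filter_upwards [hc2.eventually_ne h0] with ε h h'
      exact absurd h' h
  filter_upwards [hev] with ε hε
  rintro ⟨c, hc1, hc2⟩
  refine hε c ?_ hc1 hc2
  have : q.eval c = 0 := by
    rw [derivative_deform, eval_deform] at hc1
    rw [eval_deform] at hc2
    simp only [hq, eval_sub, eval_mul, eval_C]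
    linear_combination (g.derivative.eval c) * hc2 - (g.eval c) * hc1
  simp [hqne, this]

end

/-! ### A comparison of growth -/

/-- The singularities of `h` at `F` are removable, since `h P` is bounded and `P` does not vanish
there. The maximum principle on `‖t‖ = r` bounds `h t₁` by `M / min ‖P‖`. As all roots of `P` lie in
the disc of radius `τ`, its values at `t₁` and on the circle compare like powers of degree
`natDegree P`. -/
lemma growth_comparison {h : ℂ → ℂ} {P : ℂ[X]} {F : Set ℂ} (hF : F.Finite) {t₁ : ℂ} {α M τ r ρ : ℝ}
    (hP : 0 < P.natDegree) (hr : r < ρ) (hτ : τ < r) (ht₁ : ‖t₁‖ < r)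
    (hd : ∀ t ∈ Metric.ball (0 : ℂ) ρ, t ∉ F → DifferentiableAt ℂ h t)
    (hb : ∀ t ∈ Metric.ball (0 : ℂ) ρ, t ∉ F → ‖h t‖ * ‖P.eval t‖ ≤ M)
    (hPF : ∀ t ∈ F, P.eval t ≠ 0) (ht₁F : t₁ ∉ F) (hα1 : α ≤ ‖h t₁‖ * ‖P.eval t₁‖)
    (hP0 : ∀ t, P.eval t = 0 → ‖t‖ ≤ τ) :
    α * (r - τ) ^ P.natDegree ≤ M * (‖t₁‖ + τ) ^ P.natDegree := by
  have hr0 : 0 < r := (norm_nonneg _).trans_lt ht₁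
  have hFc : ∀ c, ∀ᶠ t in 𝓝[≠] c, t ∉ F := fun c => by
    filter_upwards [nhdsWithin_le_nhds ((hF.sdiff (t := {c})).isClosed.isOpen_compl.mem_nhds
      (by simp)), self_mem_nhdsWithin] with x hx hxc h
    exact hx ⟨h, hxc⟩
  have hball : ∀ c ∈ Metric.ball (0 : ℂ) ρ, ∀ᶠ t in 𝓝[≠] c, t ∈ Metric.ball (0 : ℂ) ρ := fun c hc =>
    nhdsWithin_le_nhds (Metric.isOpen_ball.mem_nhds hc)
  obtain ⟨H, hH, hHh⟩ := exists_differentiable_extension Metric.isOpen_ball hF.toFinset h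
    (fun x hx hxF => hd x hx (by simpa using hxF)) (fun c hc => by
      by_cases hcF : c ∈ F
      · have h1 := norm_pos_iff.2 (hPF c hcF)
        have h2 : ∀ᶠ t in 𝓝[≠] c, ‖P.eval c‖ / 2 < ‖P.eval t‖ :=
          nhdsWithin_le_nhds (P.continuous.norm.continuousAt.eventually
            (lt_mem_nhds (half_lt_self h1)))
        refine ⟨M / (‖P.eval c‖ / 2), ?_⟩
        filter_upwards [h2, hFc c, hball c hc] with t h3 h4 h5
        rw [le_div_iff₀ (half_pos h1)]
        exact (mul_le_mul_of_nonneg_left h3.le (norm_nonneg _)).trans (hb t h5 h4)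
      · have h1 := (hd c hc hcF).continuousAt.norm
        refine ⟨‖h c‖ + 1, ?_⟩
        filter_upwards [nhdsWithin_le_nhds (h1.eventually (gt_mem_nhds (lt_add_one _)))] with t ht
        exact ht.le)
  have hHF : ∀ t ∉ F, H t = h t := fun t ht => hHh t (by simpa using ht)
  have hHb : ∀ t ∈ Metric.ball (0 : ℂ) ρ, ‖H t‖ * ‖P.eval t‖ ≤ M := by
    intro t ht
    have hc : ContinuousAt (fun t => ‖H t‖ * ‖P.eval t‖) t :=
      (hH t ht).continuousAt.norm.mul P.continuous.norm.continuousAt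
    refine le_of_tendsto (hc.tendsto.mono_left (nhdsWithin_le_nhds (s := {t}ᶜ))) ?_
    filter_upwards [hFc t, hball t ht] with s h1 h2
    rw [hHF s h1]
    exact hb s h2 h1
  set D := P.natDegree with hD
  obtain ⟨Z, hZ⟩ := exists_rootTuple (p := P) hD.symm hP 0
  have ha : 0 < ‖P.leadingCoeff‖ := norm_pos_iff.2 (leadingCoeff_ne_zero_of_natDegree hP)
  have hZτ : ∀ i, ‖Z i‖ ≤ τ := fun i => hP0 _ (hZ.eval_root i)
  have hnorm : ∀ t, ‖P.eval t‖ = ‖P.leadingCoeff‖ * ∏ i, ‖t - Z i‖ := fun t => by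
    have := hZ t
    rw [sub_zero] at this
    rw [this, norm_mul, norm_prod]
  have hτ0 : 0 ≤ τ := (norm_nonneg _).trans (hZτ ⟨0, hP⟩)
  have hupper : ‖P.eval t₁‖ ≤ ‖P.leadingCoeff‖ * (‖t₁‖ + τ) ^ D := by
    rw [hnorm]
    gcongr
    calc ∏ i, ‖t₁ - Z i‖ ≤ ∏ _i : Fin D, (‖t₁‖ + τ) :=
          Finset.prod_le_prod (fun _ _ => norm_nonneg _) fun i _ =>
            (norm_sub_le _ _).trans (by linarith [hZτ i])
      _ = _ := by simp
  have hlower : ∀ t, ‖t‖ = r → ‖P.leadingCoeff‖ * (r - τ) ^ D ≤ ‖P.eval t‖ := by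
    intro t ht
    rw [hnorm]
    gcongr
    calc (r - τ) ^ D = ∏ _i : Fin D, (r - τ) := by simp
      _ ≤ ∏ i, ‖t - Z i‖ := Finset.prod_le_prod (fun _ _ => by linarith) fun i _ => by
          have := norm_sub_norm_le t (Z i)
          linarith [hZτ i]
  have hpos : 0 < ‖P.leadingCoeff‖ * (r - τ) ^ D := mul_pos ha (pow_pos (by linarith) _)
  have hsub : Metric.closedBall (0 : ℂ) r ⊆ Metric.ball 0 ρ := Metric.closedBall_subset_ball hr
  have hmax := Complex.norm_le_of_forall_mem_frontier_norm_le (U := Metric.ball (0 : ℂ) r)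
    (f := H) (C := M / (‖P.leadingCoeff‖ * (r - τ) ^ D)) Metric.isBounded_ball
    (DifferentiableOn.diffContOnCl (by
      rw [closure_ball _ hr0.ne']
      exact fun t ht => (hH t (hsub ht)).differentiableWithinAt)) (fun t ht => by
      rw [frontier_ball _ hr0.ne'] at ht
      rw [le_div_iff₀ hpos]
      exact (mul_le_mul_of_nonneg_left (hlower t (by simpa using ht)) (norm_nonneg _)).trans
        (hHb t (hsub (Metric.sphere_subset_closedBall ht))))
    (subset_closure (by simpa using ht₁ : t₁ ∈ Metric.ball (0 : ℂ) r))
  rw [le_div_iff₀ hpos] at hmax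
  rw [← hHF t₁ ht₁F] at hα1
  have h1 : α * (‖P.leadingCoeff‖ * (r - τ) ^ D) ≤ M * (‖P.leadingCoeff‖ * (‖t₁‖ + τ) ^ D) := by
    calc α * (‖P.leadingCoeff‖ * (r - τ) ^ D)
        ≤ ‖H t₁‖ * ‖P.eval t₁‖ * (‖P.leadingCoeff‖ * (r - τ) ^ D) := by gcongr
      _ = ‖H t₁‖ * (‖P.leadingCoeff‖ * (r - τ) ^ D) * ‖P.eval t₁‖ := by ring
      _ ≤ M * ‖P.eval t₁‖ := by gcongr
      _ ≤ M * (‖P.leadingCoeff‖ * (‖t₁‖ + τ) ^ D) := by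
          refine mul_le_mul_of_nonneg_left hupper ?_
          exact (mul_nonneg (norm_nonneg _) hpos.le).trans hmax
  refine le_of_mul_le_mul_left ?_ ha
  linarith [h1]

/-- The threshold for `Y` must not depend on `D`, since the degree of `P` may vary with `ε`. It is
fixed for `D = E + 1`; every further factor helps because `s ≤ c Y - s`. -/
lemma eventually_growth {α c C s : ℝ} (hα : 0 < α) (hc : 0 < c) (hC : 0 < C) (hs : 0 < s) (E : ℕ) :
    ∀ᶠ Y : ℝ in atTop, ∀ D, E < D → C * Y ^ E * s ^ D < α * (c * Y - s) ^ D := by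
  filter_upwards [eventually_gt_atTop 0, eventually_ge_atTop (2 * s / c),
    eventually_gt_atTop (C * s ^ (E + 1) / (α * (c / 2) ^ (E + 1)))] with Y hY0 hY1 hY2 D hD
  rw [div_le_iff₀ hc] at hY1
  rw [div_lt_iff₀ (by positivity)] at hY2
  have h1 : c / 2 * Y ≤ c * Y - s := by linarith
  have h2 : s ≤ c * Y - s := by linarith
  obtain ⟨k, rfl⟩ : ∃ k, D = (E + 1) + k := ⟨D - (E + 1), by omega⟩
  rw [pow_add, pow_add _ (E + 1)]
  have h3 : C * Y ^ E * s ^ (E + 1) < α * (c * Y - s) ^ (E + 1) := by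
    calc C * Y ^ E * s ^ (E + 1) = C * s ^ (E + 1) * Y ^ E := by ring
      _ < Y * (α * (c / 2) ^ (E + 1)) * Y ^ E := by gcongr
      _ = α * (c / 2 * Y) ^ (E + 1) := by ring
      _ ≤ α * (c * Y - s) ^ (E + 1) := by gcongr
  have h4 : s ^ k ≤ (c * Y - s) ^ k := by gcongr
  have h5 : 0 < s ^ k := by positivity
  have h6 : 0 ≤ α * (c * Y - s) ^ (E + 1) := (by positivity : (0 : ℝ) ≤ _).trans h3.le
  calc C * Y ^ E * (s ^ (E + 1) * s ^ k) = C * Y ^ E * s ^ (E + 1) * s ^ k := by ring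
    _ < α * (c * Y - s) ^ (E + 1) * s ^ k := by gcongr
    _ ≤ α * (c * Y - s) ^ (E + 1) * (c * Y - s) ^ k := by gcongr
    _ = _ := by ring

/-! ### Solutions of the infinitesimal problem near infinity -/

lemma natDegree_deform_of_gt {f g : ℂ[X]} (h : f.natDegree < g.natDegree) {ε : ℂ} (hε : ε ≠ 0) :
    (deform f g ε).natDegree = g.natDegree := by
  have h1 : (C ε * g).natDegree = g.natDegree := natDegree_C_mul hε
  rw [deform, natDegree_add_eq_right_of_natDegree_lt (by rwa [h1]), h1]

lemma exists_norm_eval_le {q : ℂ[X]} {n : ℕ} (hq : q.natDegree ≤ n) :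
    ∃ C : ℝ, 0 < C ∧ ∀ (y : ℝ) (x : ℂ), 1 ≤ y → ‖x‖ ≤ y → ‖q.eval x‖ ≤ C * y ^ n := by
  refine ⟨∑ i ∈ Finset.range (n + 1), ‖q.coeff i‖ + 1,
    add_pos_of_nonneg_of_pos (Finset.sum_nonneg fun _ _ => norm_nonneg _) one_pos,
    fun y x hy hx => ?_⟩
  rw [eval_eq_sum_range' (Nat.lt_succ_of_le hq)]
  calc ‖∑ i ∈ Finset.range n.succ, q.coeff i * x ^ i‖
      ≤ ∑ i ∈ Finset.range (n + 1), ‖q.coeff i‖ * y ^ n := by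
        refine norm_sum_le_of_le _ fun i hi => ?_
        rw [norm_mul, norm_pow]
        gcongr
        calc ‖x‖ ^ i ≤ y ^ i := by gcongr
          _ ≤ y ^ n := pow_le_pow_right₀ hy (Nat.lt_succ_iff.1 (Finset.mem_range.1 hi))
    _ = (∑ i ∈ Finset.range (n + 1), ‖q.coeff i‖) * y ^ n := by rw [Finset.sum_mul]
    _ ≤ _ := by gcongr; linarith

/-- The factor 4 leaves room: with `ε g` below `2 c y^m` on the circle, `f + ε g` exceeds `2 c y^m`
there, so no root has modulus `y` for `‖t‖ < 2 c y^m`. The comparison circle has radius `c y^m`. -/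
lemma exists_le_norm_eval {f : ℂ[X]} {m : ℕ} (hf : f.natDegree = m) (hm : 0 < m) :
    ∃ c : ℝ, 0 < c ∧ ∀ᶠ y : ℝ in atTop, ∀ x : ℂ, ‖x‖ = y → 4 * c * y ^ m ≤ ‖f.eval x‖ := by
  have ha : 0 < ‖f.coeff m‖ := by
    have := leadingCoeff_ne_zero_of_natDegree (p := f) (by omega)
    rw [leadingCoeff, hf] at this
    exact norm_pos_iff.2 this
  set B := ∑ i ∈ Finset.range m, ‖f.coeff i‖
  refine ⟨‖f.coeff m‖ / 8, by positivity, ?_⟩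
  filter_upwards [eventually_ge_atTop 1, eventually_ge_atTop (2 * B / ‖f.coeff m‖)] with y hy1 hy2
    x hx
  obtain ⟨k, rfl⟩ : ∃ k, m = k + 1 := ⟨m - 1, by omega⟩
  rw [eval_eq_sum_range' (Nat.lt_succ_of_le hf.le), Finset.sum_range_succ]
  have h1 : ‖∑ i ∈ Finset.range (k + 1), f.coeff i * x ^ i‖ ≤ B * y ^ k := by
    rw [Finset.sum_mul]
    refine norm_sum_le_of_le _ fun i hi => ?_
    rw [norm_mul, norm_pow, hx]
    gcongr
    exact Nat.lt_succ_iff.1 (Finset.mem_range.1 hi)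
  have h2 : ‖f.coeff (k + 1) * x ^ (k + 1)‖ = ‖f.coeff (k + 1)‖ * y ^ (k + 1) := by
    rw [norm_mul, norm_pow, hx]
  rw [div_le_iff₀ ha] at hy2
  have h3 : 2 * B * y ^ k ≤ ‖f.coeff (k + 1)‖ * y ^ (k + 1) := by
    calc 2 * B * y ^ k ≤ y * ‖f.coeff (k + 1)‖ * y ^ k := by gcongr
      _ = _ := by ring
  have h4 := norm_sub_norm_le (f.coeff (k + 1) * x ^ (k + 1))
    (-∑ i ∈ Finset.range (k + 1), f.coeff i * x ^ i)
  rw [sub_neg_eq_add, norm_neg, add_comm (f.coeff (k + 1) * x ^ (k + 1)), h2] at h4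
  linarith

lemma card_filter_embedding_le {κ : Type*} [Fintype κ] [DecidableEq κ] {n m : ℕ}
    (hκ : Fintype.card κ ≤ m) {s : Finset (Fin n)} (hs : s.card ≤ m) :
    (Finset.univ.filter fun σ : κ ↪ Fin n => ∀ i, σ i ∈ s).card ≤ m.factorial := by
  classical
  calc (Finset.univ.filter fun σ : κ ↪ Fin n => ∀ i, σ i ∈ s).card
      ≤ (Finset.univ.image fun τ : κ ↪ s => τ.trans (Function.Embedding.subtype _)).card := by
        refine Finset.card_le_card fun σ hσ => ?_
        have hσ' := (Finset.mem_filter.1 hσ).2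
        exact Finset.mem_image.2 ⟨⟨fun i => ⟨σ i, hσ' i⟩, fun i j hij =>
          σ.injective (congrArg Subtype.val hij)⟩, Finset.mem_univ _, rfl⟩
    _ ≤ Fintype.card (κ ↪ s) := Finset.card_image_le
    _ = s.card.descFactorial (Fintype.card κ) := by
        rw [Fintype.card_embedding_eq, Fintype.card_coe]
    _ ≤ m.descFactorial (Fintype.card κ) := Nat.descFactorial_le _ hs
    _ ≤ m.factorial := by
        rw [← Nat.factorial_mul_descFactorial hκ]
        exact Nat.le_mul_of_pos_left _ (Nat.factorial_pos _)

open Classical in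
/-- The inverse of the product of the integrals of `q` along the divisors with weights `ω` in the
fibre `Z` that leave the disc of radius `y`. -/
noncomputable def outerInverse {κ : Type*} [Fintype κ] {n : ℕ} (ω : κ → ℤ) (q : ℂ[X]) (y : ℝ)
    (Z : Fin n → ℂ) : ℂ :=
  ∏ σ : κ ↪ Fin n, if ∀ i, ‖Z (σ i)‖ ≤ y then 1 else (∑ i, (ω i : ℂ) * q.eval (Z (σ i)))⁻¹

lemma outerInverse_comp_perm {κ : Type*} [Fintype κ] {n : ℕ} (ω : κ → ℤ) (q : ℂ[X]) (y : ℝ)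
    (Z : Fin n → ℂ) (ρ : Equiv.Perm (Fin n)) :
    outerInverse ω q y (Z ∘ ρ) = outerInverse ω q y Z := by
  classical
  rw [outerInverse, outerInverse]
  conv_rhs => rw [← Equiv.prod_comp (Equiv.embeddingCongr (Equiv.refl κ) ρ)]
  refine Finset.prod_congr rfl fun σ _ => ?_
  simp

-- Multiplication by `outerInverse` leaves only the factors inside the disc. The hypothesis `h` says
-- that no outer factor is zero, so the inverses are genuine.
open Classical in
lemma norm_outerInverse_mul {κ : Type*} [Fintype κ] {n : ℕ} (ω : κ → ℤ) (q : ℂ[X]) (y : ℝ)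
    (Z : Fin n → ℂ) (c : ℂ) (h : ∀ σ : κ ↪ Fin n, ∑ i, (ω i : ℂ) * q.eval (Z (σ i)) = 0 →
      ∀ i, ‖Z (σ i)‖ ≤ y) :
    ‖outerInverse ω q y Z‖ * ‖c * ∏ σ : κ ↪ Fin n, ∑ i, (ω i : ℂ) * q.eval (Z (σ i))‖ =
      ‖c‖ * ∏ σ ∈ Finset.univ.filter fun σ : κ ↪ Fin n => ∀ i, ‖Z (σ i)‖ ≤ y,
        ‖∑ i, (ω i : ℂ) * q.eval (Z (σ i))‖ := by
  rw [← norm_mul, outerInverse, mul_left_comm, ← Finset.prod_mul_distrib, norm_mul, norm_prod,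
    Finset.prod_filter]
  congr 1
  refine Finset.prod_congr rfl fun σ _ => ?_
  by_cases hσ : ∀ i, ‖Z (σ i)‖ ≤ y
  · rw [if_pos hσ, if_pos hσ, one_mul]
  · rw [if_neg hσ, if_neg hσ, inv_mul_cancel₀ fun h0 => hσ (h σ h0), norm_one]

/-- By `hy` no root crosses the circle of radius `y`, so in a holomorphic labelling the set of outer
injections is locally constant. The labelling is irrelevant by `outerInverse_comp_perm`. -/
lemma differentiableAt_outerInverse {κ : Type*} [Fintype κ] {p q : ℂ[X]} {n : ℕ}
    (hp : p.natDegree = n) (hn : 0 < n) (ω : κ → ℤ) {y : ℝ} {t₀ : ℂ}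
    {Z : ℂ → Fin n → ℂ} (hZ : ∀ t, RootTuple p p.leadingCoeff t (Z t))
    (ht₀ : t₀ ∉ criticalValues p) (hy : ∀ x, ‖x‖ = y → p.eval x ≠ t₀)
    (h : ∀ σ : κ ↪ Fin n, ∑ i, (ω i : ℂ) * q.eval (Z t₀ (σ i)) = 0 → ∀ i, ‖Z t₀ (σ i)‖ ≤ y) :
    DifferentiableAt ℂ (fun t => outerInverse ω q y (Z t)) t₀ := by
  classical
  have ha : p.leadingCoeff ≠ 0 := leadingCoeff_ne_zero_of_natDegree (hp ▸ hn)
  obtain ⟨Ψ, r, hr, hΨ0, hΨ⟩ := exists_section hp hn (hZ t₀) (((hZ t₀).injective_iff ha).2 ht₀)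
  have hball := Metric.ball_mem_nhds t₀ hr
  have hc := (hΨ t₀ (Metric.mem_ball_self hr)).1
  have hsmall : ∀ᶠ t in 𝓝 t₀, ∀ j, (‖Ψ t j‖ ≤ y ↔ ‖Z t₀ j‖ ≤ y) := by
    rw [eventually_all]
    intro j
    have hcj : ContinuousAt (fun t => ‖Ψ t j‖) t₀ := (continuousAt_pi.1 hc.continuousAt j).norm
    have hne : ‖Z t₀ j‖ ≠ y := fun h => hy _ h ((hZ t₀).eval_root j)
    have h0 : ‖Ψ t₀ j‖ = ‖Z t₀ j‖ := by rw [hΨ0]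
    rcases lt_or_gt_of_ne hne with h1 | h1
    · filter_upwards [hcj.eventually (gt_mem_nhds (h0 ▸ h1))] with t ht
      exact ⟨fun _ => h1.le, fun _ => ht.le⟩
    · filter_upwards [hcj.eventually (lt_mem_nhds (h0 ▸ h1))] with t ht
      exact ⟨fun h => absurd h (not_le.2 ht), fun h => absurd h (not_le.2 h1)⟩
  have heq : (fun t => outerInverse ω q y (Z t)) =ᶠ[𝓝 t₀] fun t => ∏ σ : κ ↪ Fin n,
      if ∀ i, ‖Z t₀ (σ i)‖ ≤ y then 1 else (∑ i, (ω i : ℂ) * q.eval (Ψ t (σ i)))⁻¹ := by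
    filter_upwards [hsmall, hball] with t ht htb
    obtain ⟨ρ, hρ⟩ := (hZ t).exists_perm ha (hΨ t htb).2.2
    rw [← outerInverse_comp_perm ω q y (Z t) ρ, ← hρ, outerInverse]
    refine Finset.prod_congr rfl fun σ _ => ?_
    simp only [ht]
  refine DifferentiableAt.congr_of_eventuallyEq ?_ heq
  refine DifferentiableAt.fun_finsetProd fun σ _ => ?_
  by_cases hσ : ∀ i, ‖Z t₀ (σ i)‖ ≤ y
  · simp only [if_pos hσ]
    exact differentiableAt_const _
  · simp only [if_neg hσ]
    refine DifferentiableAt.inv (DifferentiableAt.fun_sum fun i _ => ?_) ?_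
    · exact (q.differentiable.differentiableAt.comp t₀
        ((differentiableAt_pi.1 hc) (σ i))).const_mul _
    · rw [hΨ0]
      exact fun h0 => hσ (h σ h0)

lemma exists_regular_point {f : ℂ[X]} {m : ℕ} (hf : f.natDegree = m) (hm : 0 < m) (R : ℝ) :
    ∃ x : ℂ, R < ‖x‖ ∧ f.eval x ∉ criticalValues f := by
  have h1 : ∀ᶠ x in cocompact ℂ, R < ‖x‖ :=
    tendsto_norm_cocompact_atTop.eventually_gt_atTop R
  have h2 : ∀ᶠ x in cocompact ℂ, f.eval x ∉ criticalValues f :=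
    (finite_critical_fibres (hf ▸ hm)).isCompact.compl_mem_cocompact
  exact (h1.and h2).exists

theorem eventually_exists_large_solution {κ : Type*} [Fintype κ] [DecidableEq κ] [Nonempty κ]
    {ω : κ → ℤ} {f g : ℂ[X]} {m n : ℕ} (hf : f.natDegree = m) (hm : 0 < m) (hg : g.natDegree = n)
    (hmn : m < n) (hκ : Fintype.card κ ≤ m) {R : ℝ}
    (hR : ∀ (t : ℂ) (Z : Fin m → ℂ), RootTuple f f.leadingCoeff t Z → ∀ σ : κ ↪ Fin m,
      ∑ i, (ω i : ℂ) * g.eval (Z (σ i)) = 0 → ∀ j, ‖Z j‖ ≤ R)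
    (hev : ∀ᶠ ε in 𝓝[≠] (0 : ℂ), ∃ (P : ℂ[X]) (c : ℂ), c ≠ 0 ∧
      n * (m - 1).factorial < P.natDegree ∧ ∀ (t : ℂ) (Z : Fin n → ℂ),
        RootTuple (deform f g ε) (deform f g ε).leadingCoeff t Z →
          P.eval t = c * ∏ σ : κ ↪ Fin n, ∑ i, (ω i : ℂ) * g.eval (Z (σ i)))
    (hncz : ∀ᶠ ε in 𝓝[≠] (0 : ℂ), NoCriticalZero (deform f g ε) g ω n) (R₁ : ℝ) :
    ∀ᶠ ε in 𝓝[≠] (0 : ℂ), ∃ (t : ℂ) (Z : Fin n → ℂ),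
      RootTuple (deform f g ε) (deform f g ε).leadingCoeff t Z ∧ ∃ σ : κ ↪ Fin n,
        ∑ i, (ω i : ℂ) * g.eval (Z (σ i)) = 0 ∧ ∃ i, R₁ < ‖Z (σ i)‖ := by
  classical
  -- A reference value whose fibre has a point beyond `R`: by `hR` no integral over this fibre
  -- vanishes, and `α₀` is a common lower bound. It is taken at most 1 so that a product of at most
  -- `m!` such factors is at least `α₀ ^ m!`.
  obtain ⟨x₁, hx₁, ht₁⟩ := exists_regular_point hf hm R
  set t₁ := f.eval x₁ with ht₁def
  have hla : f.leadingCoeff ≠ 0 := leadingCoeff_ne_zero_of_natDegree (hf ▸ hm)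
  obtain ⟨α₀, hα0, hα1, hα⟩ : ∃ α₀ : ℝ, 0 < α₀ ∧ α₀ ≤ 1 ∧ ∀ Z : Fin m → ℂ,
      RootTuple f f.leadingCoeff t₁ Z → ∀ σ : κ ↪ Fin m,
        α₀ < ‖∑ i, (ω i : ℂ) * g.eval (Z (σ i))‖ := by
    obtain ⟨Z₀, hZ₀⟩ := exists_rootTuple hf hm t₁
    obtain ⟨i₁, hi₁⟩ := hZ₀.exists_index hla ht₁def.symm
    have h1 : ∀ σ : κ ↪ Fin m, 0 < ‖∑ i, (ω i : ℂ) * g.eval (Z₀ (σ i))‖ := fun σ =>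
      norm_pos_iff.2 fun h => by
        have := hR _ _ hZ₀ σ h i₁
        rw [hi₁] at this
        linarith
    have h2 : ∀ᶠ α in 𝓝[>] (0 : ℝ), ∀ σ : κ ↪ Fin m,
        α < ‖∑ i, (ω i : ℂ) * g.eval (Z₀ (σ i))‖ :=
      eventually_all.2 fun σ => nhdsWithin_le_nhds (gt_mem_nhds (h1 σ))
    obtain ⟨α, h3, h4⟩ := (h2.and (Ioc_mem_nhdsGT one_pos)).exists
    refine ⟨α, h4.1, h4.2, fun Z hZ σ => ?_⟩
    obtain ⟨ρ, rfl⟩ := hZ₀.exists_perm hla hZ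
    exact h3 (σ.trans ρ.toEmbedding)
  obtain ⟨Cf, hCf, hCf'⟩ := exists_norm_eval_le hf.le
  obtain ⟨Cg, hCg, hCg'⟩ := exists_norm_eval_le hg.le
  obtain ⟨c, hc, hfc⟩ := exists_le_norm_eval hf hm
  -- A bound, for `‖ε‖ ≤ 1`, for the values of `f + ε g` on the disc of radius `R₁`. If no large
  -- solution existed, it would bound the roots of `P`.
  set τ := Cf * (max 1 R₁) ^ m + Cg * (max 1 R₁) ^ n with hτ
  have hmax : (0 : ℝ) < max 1 R₁ := lt_max_of_lt_left one_pos
  have hτ0 : 0 < τ := by positivity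
  set C' := (∑ i, ‖(ω i : ℂ)‖ + 1) * Cg with hC'
  have hC'0 : 0 < C' := by positivity
  set s := ‖t₁‖ + τ with hs
  have hs0 : 0 < s := by positivity
  have hgrow := eventually_growth (α := α₀ ^ m.factorial) (c := c) (C := C' ^ m.factorial) (s := s)
    (by positivity) hc (by positivity) hs0 (n * (m - 1).factorial)
  have hpow : Tendsto (fun y : ℝ => y ^ m) atTop atTop := tendsto_pow_atTop hm.ne'
  obtain ⟨y, ⟨hy1, hyR, hyC⟩, hyf, hyg, hys⟩ := (((eventually_ge_atTop (1 : ℝ)).and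
    ((eventually_ge_atTop R₁).and (eventually_ge_atTop (1 / C')))).and (hfc.and
      ((hpow.eventually hgrow).and (hpow.eventually (eventually_gt_atTop (s / c)))))).exists
  rw [div_lt_iff₀ hc] at hys
  rw [div_le_iff₀ hC'0] at hyC
  have hY0 : 0 < y ^ m := by positivity
  have hJ : ∀ (Z : Fin n → ℂ) (σ : κ ↪ Fin n), (∀ i, ‖Z (σ i)‖ ≤ y) →
      ‖∑ i, (ω i : ℂ) * g.eval (Z (σ i))‖ ≤ C' * y ^ n := by
    intro Z σ hσ
    calc ‖∑ i, (ω i : ℂ) * g.eval (Z (σ i))‖ ≤ ∑ i, ‖(ω i : ℂ)‖ * (Cg * y ^ n) := by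
          refine norm_sum_le_of_le _ fun i _ => ?_
          rw [norm_mul]
          gcongr
          exact hCg' y _ hy1 (hσ i)
      _ = (∑ i, ‖(ω i : ℂ)‖) * (Cg * y ^ n) := by rw [Finset.sum_mul]
      _ ≤ (∑ i, ‖(ω i : ℂ)‖ + 1) * (Cg * y ^ n) := by gcongr; linarith
      _ = _ := by ring
  have hC1 : 1 ≤ C' * y ^ n := by
    calc 1 ≤ C' * y := by linarith
      _ ≤ C' * y ^ n := by
        gcongr
        exact le_self_pow₀ hy1 (by omega)
  have he1 : ∀ᶠ ε in 𝓝 (0 : ℂ), ‖ε‖ ≤ 1 ∧ ‖ε‖ * (Cg * y ^ n) < 2 * c * y ^ m := by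
    have h1 : Tendsto (fun ε : ℂ => ‖ε‖) (𝓝 0) (𝓝 0) := by
      simpa using (continuous_norm (E := ℂ)).tendsto 0
    have h2 := h1.mul_const (Cg * y ^ n)
    rw [zero_mul] at h2
    exact (h1.eventually (ge_mem_nhds one_pos)).and
      (h2.eventually (gt_mem_nhds (by positivity)))
  filter_upwards [self_mem_nhdsWithin, hev, hncz, nhdsWithin_le_nhds he1,
    nhdsWithin_le_nhds (eventually_card_bounded_roots_le hf hm hmn.le hg.le (2 * c * y ^ m) y),
    nhdsWithin_le_nhds (eventually_lt_norm_integral hf hm hmn.le hg.le ω t₁ y α₀ hα),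
    nhdsWithin_le_nhds (eventually_not_mem_criticalValues_deform hf hm hg hmn ht₁)]
    with ε hε0 hP hN hε1 hcard hα' ht₁'
  obtain ⟨P, a, ha, hPdeg, hPe⟩ := hP
  by_contra! hcon
  have hn : 0 < n := by omega
  have hdeg : (deform f g ε).natDegree = n :=
    (natDegree_deform_of_gt (by omega) hε0).trans hg
  have hlead : (deform f g ε).leadingCoeff ≠ 0 :=
    leadingCoeff_ne_zero_of_natDegree (hdeg ▸ hn)
  choose Z hZ using fun t => exists_rootTuple hdeg hn t
  have hsmall : ∀ t, ∀ σ : κ ↪ Fin n, ∑ i, (ω i : ℂ) * g.eval (Z t (σ i)) = 0 →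
      ∀ i, ‖Z t (σ i)‖ ≤ y := fun t σ h i => (hcon t (Z t) (hZ t) σ h i).trans hyR
  have hprod : ∀ t, ‖outerInverse ω g y (Z t)‖ * ‖P.eval t‖ =
      ‖a‖ * ∏ σ ∈ Finset.univ.filter fun σ : κ ↪ Fin n => ∀ i, ‖Z t (σ i)‖ ≤ y,
        ‖∑ i, (ω i : ℂ) * g.eval (Z t (σ i))‖ := fun t => by
    rw [hPe t (Z t) (hZ t)]
    exact norm_outerInverse_mul ω g y (Z t) a (hsmall t)
  have hcard' : ∀ t, ‖t‖ ≤ 2 * c * y ^ m →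
      (Finset.univ.filter fun σ : κ ↪ Fin n => ∀ i, ‖Z t (σ i)‖ ≤ y).card ≤ m.factorial := by
    intro t ht
    have := card_filter_embedding_le (κ := κ) hκ (hcard _ t (Z t) ht (hZ t))
    simpa using this
  have key := growth_comparison (h := fun t => outerInverse ω g y (Z t)) (P := P)
    (F := criticalValues (deform f g ε)) (t₁ := t₁) (α := ‖a‖ * α₀ ^ m.factorial)
    (M := ‖a‖ * (C' * y ^ n) ^ m.factorial) (τ := τ) (r := c * y ^ m) (ρ := 2 * c * y ^ m)
    (finite_criticalValues (derivative_ne_zero_of_natDegree (hdeg ▸ hn))) (by omega)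
    (by nlinarith) (by linarith [norm_nonneg t₁]) (by linarith)
    (fun t ht htF => differentiableAt_outerInverse hdeg hn ω hZ htF (fun x hx hxt => ?_)
      (hsmall t))
    (fun t ht _ => ?_) (fun t ht h0 => ?_) ht₁' ?_ (fun t h0 => ?_)
  · have h1 := hyg _ hPdeg
    have hfac : m.factorial = m * (m - 1).factorial := (Nat.mul_factorial_pred hm.ne').symm
    -- At most `m!` inner factors of size `yⁿ` amount to `(yᵐ)^(n (m-1)!)`, fewer powers of `yᵐ`
    -- than the degree of `P`.
    have h2 : (C' * y ^ n) ^ m.factorial =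
        C' ^ m.factorial * (y ^ m) ^ (n * (m - 1).factorial) := by
      rw [mul_pow, ← pow_mul, ← pow_mul]
      congr 2
      rw [hfac]; ring
    have h3 : α₀ ^ m.factorial * (c * y ^ m - s) ^ P.natDegree ≤
        α₀ ^ m.factorial * (c * y ^ m - τ) ^ P.natDegree := by
      gcongr
      · linarith
      · linarith [norm_nonneg t₁]
    rw [mul_assoc, mul_assoc, h2] at key
    have h4 := le_of_mul_le_mul_left key (norm_pos_iff.2 ha)
    exact absurd (h1.trans_le (h3.trans h4)) (lt_irrefl _)
  · rw [mem_ball_zero_iff] at ht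
    have h1 := hyf x hx
    have h2 : ‖ε * g.eval x‖ ≤ ‖ε‖ * (Cg * y ^ n) := by
      rw [norm_mul]
      gcongr
      exact hCg' y x hy1 hx.le
    have h3 := norm_sub_norm_le (f.eval x) (-(ε * g.eval x))
    rw [sub_neg_eq_add, norm_neg, ← eval_deform, hxt] at h3
    linarith [hε1.2]
  · rw [mem_ball_zero_iff] at ht
    rw [hprod t]
    gcongr
    refine (Finset.prod_le_prod (fun _ _ => norm_nonneg _) (g := fun _ => C' * y ^ n)
      fun σ hσ => hJ _ _ (Finset.mem_filter.1 hσ).2).trans ?_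
    rw [Finset.prod_const]
    exact pow_le_pow_right₀ hC1 (hcard' t ht.le)
  · rw [hPe t (Z t) (hZ t)] at h0
    obtain ⟨σ, -, hσ⟩ := Finset.prod_eq_zero_iff.1 ((mul_eq_zero.1 h0).resolve_left ha)
    exact hN t (Z t) (hZ t) (fun hi => ((hZ t).injective_iff hlead).1 hi ht) σ hσ
  · refine le_of_le_of_eq ?_ (hprod t₁).symm
    refine mul_le_mul_of_nonneg_left ?_ (norm_nonneg _)
    calc α₀ ^ m.factorial ≤ α₀ ^ (Finset.univ.filter fun σ : κ ↪ Fin n =>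
            ∀ i, ‖Z t₁ (σ i)‖ ≤ y).card :=
          pow_le_pow_of_le_one hα0.le hα1 (hcard' t₁ (by linarith))
      _ = ∏ _σ ∈ Finset.univ.filter fun σ : κ ↪ Fin n => ∀ i, ‖Z t₁ (σ i)‖ ≤ y, α₀ := by
          rw [Finset.prod_const]
      _ ≤ _ := Finset.prod_le_prod (fun _ _ => hα0.le) fun σ hσ =>
          (hα' _ (Z t₁) (hZ t₁) σ (Finset.mem_filter.1 hσ).2).le
  · rw [hPe t (Z t) (hZ t)] at h0
    obtain ⟨σ, -, hσ⟩ := Finset.prod_eq_zero_iff.1 ((mul_eq_zero.1 h0).resolve_left ha)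
    obtain ⟨i⟩ := ‹Nonempty κ›
    have h1 := hcon t (Z t) (hZ t) σ hσ i
    rw [← (hZ t).eval_root (σ i), eval_deform]
    have h2 : ‖Z t (σ i)‖ ≤ max 1 R₁ := h1.trans (le_max_right _ _)
    calc ‖f.eval (Z t (σ i)) + ε * g.eval (Z t (σ i))‖
        ≤ ‖f.eval (Z t (σ i))‖ + ‖ε‖ * ‖g.eval (Z t (σ i))‖ := by
          rw [← norm_mul]; exact norm_add_le _ _
      _ ≤ Cf * (max 1 R₁) ^ m + 1 * (Cg * (max 1 R₁) ^ n) := by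
          gcongr
          · exact hCf' _ _ (le_max_left _ _) h2
          · exact hε1.1
          · exact hCg' _ _ (le_max_left _ _) h2
      _ = τ := by rw [one_mul]

/-! ### Tuples of points of a fibre -/

lemma exists_perm_comp_eq {m n : ℕ} (e σ : Fin m ↪ Fin n) :
    ∃ ρ : Equiv.Perm (Fin n), ∀ j, ρ (e j) = σ j := by
  have := Equiv.Perm.isMultiplyPretransitive (Fin n) m
  obtain ⟨ρ, hρ⟩ := MulAction.exists_smul_eq (Equiv.Perm (Fin n)) e σ
  exact ⟨ρ, fun j => by rw [← hρ]; rfl⟩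

lemma exists_embedding_extension {m n : ℕ} (hmn : m ≤ n) {p : Fin m → Prop}
    (σ : {j // p j} ↪ Fin n) : ∃ σ' : Fin m ↪ Fin n, ∀ i : {j // p j}, σ' i = σ i := by
  classical
  set s : Finset (Fin m) := Finset.univ.filter p
  set F : Fin m → Fin n := fun j => if h : p j then σ ⟨j, h⟩ else Fin.castLE hmn j with hF
  have hFp : ∀ i : {j // p j}, F i = σ i := fun i => by simp [hF, i.2]
  have hinj : Set.InjOn F s := by
    intro i hi j hj hij
    have hi' : p i := by simpa [s] using hi
    have hj' : p j := by simpa [s] using hj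
    have h1 := hFp ⟨i, hi'⟩
    have h2 := hFp ⟨j, hj'⟩
    simp only at h1 h2
    rw [h1, h2] at hij
    exact congrArg Subtype.val (σ.injective hij)
  have hcard : (s.image F).card ≤ m := Finset.card_image_le.trans
    ((Finset.card_le_univ _).trans (by simp))
  obtain ⟨t, ht1, -, ht2⟩ := Finset.exists_subsuperset_card_eq (Finset.subset_univ (s.image F))
    hcard (by simpa using hmn)
  obtain ⟨e, he⟩ := Finset.exists_equiv_extend_of_card_eq (α := Fin m) (t := t)
    (by rw [ht2, Fintype.card_fin]) ht1 hinj
  refine ⟨e.toEmbedding.trans (Function.Embedding.subtype _), fun i => ?_⟩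
  change ((e i : t) : Fin n) = σ i
  rw [he i (by simp [s, i.2]), hFp]

lemma exists_rootTuple_extension {p : ℂ[X]} {m n : ℕ} (hp : p.natDegree = n) (hn : 0 < n) {t : ℂ}
    {z : Fin m → ℂ} (hi : Function.Injective z) (hz : ∀ j, p.eval (z j) = t) :
    ∃ (Z : Fin n → ℂ) (σ : Fin m ↪ Fin n), RootTuple p p.leadingCoeff t Z ∧ ∀ j, Z (σ j) = z j := by
  obtain ⟨Z, hZ⟩ := exists_rootTuple hp hn t
  have ha : p.leadingCoeff ≠ 0 := leadingCoeff_ne_zero_of_natDegree (hp ▸ hn)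
  choose σ hσ using fun j => hZ.exists_index ha (hz j)
  exact ⟨Z, ⟨σ, fun i j hij => hi (by rw [← hσ, ← hσ, hij])⟩, hZ, hσ⟩

/-- Both tuples are completed to full fibres with the given points in the first places; a path
between these is then restricted to those places. -/
lemma IsMorse.joinedIn_of_le {p : ℂ[X]} {m n : ℕ} (hp : p.natDegree = n) (hn : 0 < n)
    (hM : IsMorse p n) (hmn : m ≤ n) {z z' : Fin m → ℂ} (hz : z ∈ regularTuples p m)
    (hz' : z' ∈ regularTuples p m) : JoinedIn (regularTuples p m) z z' := by
  have ha : p.leadingCoeff ≠ 0 := leadingCoeff_ne_zero_of_natDegree (hp ▸ hn)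
  have hext : ∀ z ∈ regularTuples p m, ∃ Z ∈ regularTuples p n, ∀ j, Z (Fin.castLE hmn j) = z j := by
    rintro z ⟨hi, t, ht, hz⟩
    obtain ⟨Z, σ, hZ, hσ⟩ := exists_rootTuple_extension hp hn hi hz
    obtain ⟨ρ, hρ⟩ := exists_perm_comp_eq (Fin.castLEEmb hmn) σ
    refine ⟨Z ∘ ρ, ⟨((hZ.injective_iff ha).2 ht).comp ρ.injective, t, ht,
      fun j => hZ.eval_root _⟩, fun j => ?_⟩
    rw [← hσ j, ← hρ j]
    rfl
  obtain ⟨Z, hZ, hZz⟩ := hext z hz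
  obtain ⟨Z', hZ', hZz'⟩ := hext z' hz'
  obtain ⟨γ, hγ⟩ := hM.joinedIn hp hn hZ hZ'
  have h1 : (fun j => Z (Fin.castLE hmn j)) = z := funext hZz
  have h2 : (fun j => Z' (Fin.castLE hmn j)) = z' := funext hZz'
  rw [← h1, ← h2]
  refine ⟨γ.map (f := fun Z : Fin n → ℂ => fun j : Fin m => Z (Fin.castLE hmn j)) (by fun_prop),
    fun s => ?_⟩
  obtain ⟨h3, t, h4, h5⟩ := hγ s
  exact ⟨h3.comp (Fin.castLE_injective hmn), t, h4, fun j => h5 _⟩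

/-- For small `ε`, every tuple in a regular fibre of a Morse polynomial `f + ε g` is a branch of the
deformed cycle. -/
lemma eventually_joinedIn_deformedTuples {f g : ℂ[X]} {m n : ℕ} (hf : f.natDegree = m)
    (hm : 0 < m) (hg : g.natDegree = n) (hmn : m < n) (K : ZeroCycle f m) :
    ∀ᶠ ε in 𝓝[≠] (0 : ℂ), IsMorse (deform f g ε) n → ∀ z ∈ regularTuples (deform f g ε) m,
      JoinedIn (deformedTuples f g m) (K.base, 0) (z, ε) := by
  obtain ⟨hinj, t₀, ht₀, hbase⟩ := K.base_mem
  obtain ⟨Ψ, hΨ0, hΨ, -⟩ := exists_local_section f g (e₀ := 0) hinj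
    (t₀ := t₀) (by simpa using hbase) (fun j hj => ht₀ ⟨K.base j, by simpa using hj, hbase j⟩)
  have c1 : Tendsto (fun e : ℂ => (t₀, e)) (𝓝 0) (𝓝 (t₀, 0)) := Continuous.tendsto (by fun_prop) 0
  obtain ⟨r, hr, hrs⟩ := Metric.nhds_basis_ball.mem_iff.1 ((c1.eventually hΨ).and
    (eventually_not_mem_criticalValues_deform hf hm hg hmn ht₀))
  filter_upwards [self_mem_nhdsWithin, nhdsWithin_le_nhds (Metric.ball_mem_nhds (0 : ℂ) hr)]
    with ε hε0 hεr hM z hz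
  -- The path first varies the parameter from 0 to `ε` over the fixed value `t₀`, and then uses
  -- monodromy at the fixed parameter `ε`.
  have hreg : ∀ e ∈ Metric.ball (0 : ℂ) r, (Ψ (t₀, e), e) ∈ deformedTuples f g m := fun e he =>
    ⟨(hrs he).1.2.1, t₀, (hrs he).2, (hrs he).1.2.2⟩
  have h1 : JoinedIn (deformedTuples f g m) (K.base, 0) (Ψ (t₀, ε), ε) := by
    have hpc : IsPathConnected (Metric.ball (0 : ℂ) r) :=
      (convex_ball (0 : ℂ) r).isPathConnected ⟨ε, hεr⟩
    have h2 := hpc.image' (f := fun e => (Ψ (t₀, e), e)) (fun e he => by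
      have h3 : ContinuousAt (fun e : ℂ => Ψ (t₀, e)) e :=
        ContinuousAt.comp (f := fun e : ℂ => (t₀, e)) (hrs he).1.1.continuousAt (by fun_prop)
      exact (h3.prodMk continuousAt_id).continuousWithinAt)
    have h3 := h2.joinedIn _ ⟨0, Metric.mem_ball_self hr, rfl⟩ _ ⟨ε, hεr, rfl⟩
    simp only [hΨ0] at h3
    refine h3.mono ?_
    rintro _ ⟨e, he, rfl⟩
    exact hreg e he
  have hdeg : (deform f g ε).natDegree = n := (natDegree_deform_of_gt (by omega) hε0).trans hg
  obtain ⟨γ, hγ⟩ := hM.joinedIn_of_le hdeg (by omega) hmn.le (hreg ε hεr) hz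
  exact h1.trans ⟨γ.map (f := fun z : Fin m → ℂ => (z, ε)) (by fun_prop), hγ⟩

/-! ### Existence of alien limit cycles -/

/-- Points of weight 0 are dropped: the divisor does not see them, and they could be large without
the cycle being so. -/
lemma sum_support_eq_integral {m : ℕ} (w : Fin m → ℤ) (q : ℂ[X]) (z : Fin m → ℂ) :
    ∑ i : {j // w j ≠ 0}, (w i : ℂ) * q.eval (z i) = integral w q z := by
  classical
  rw [integral, ← Fintype.sum_subtype_add_sum_subtype (fun j => w j ≠ 0), left_eq_add]
  refine Finset.sum_eq_zero fun i _ => ?_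
  have : w i = 0 := not_not.1 i.2
  rw [this, Int.cast_zero, zero_mul]

lemma divisor_apply {m : ℕ} (w : Fin m → ℤ) (z : Fin m → ℂ) (x : ℂ) [DecidableEq ℂ] :
    divisor w z x = ∑ j, if z j = x then w j else 0 := by
  rw [divisor, Finsupp.finsetSum_apply]
  exact Finset.sum_congr rfl fun j _ => by rw [Finsupp.single_apply]

/-- The points of a divisor of distinct points with nonzero weight are determined by the divisor. -/
lemma exists_eq_of_divisor_eq {m : ℕ} {w : Fin m → ℤ} {z z' : Fin m → ℂ}
    (hz : Function.Injective z) (h : divisor w z' = divisor w z) {i : Fin m} (hi : w i ≠ 0) :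
    ∃ j, w j ≠ 0 ∧ z' j = z i := by
  classical
  by_contra! hcon
  have h1 : divisor w z (z i) = w i := by
    rw [divisor_apply, Finset.sum_eq_single i, if_pos rfl]
    · exact fun j _ hj => if_neg fun h => hj (hz h)
    · simp
  rw [← h, divisor_apply] at h1
  refine hi (h1.symm.trans (Finset.sum_eq_zero fun j _ => ?_))
  split_ifs with h2
  · by_contra h3; exact hcon j h3 h2
  · rfl

lemma IsInfinitesimalSolution.exists_rootTuple {f g : ℂ[X]} {m n : ℕ} {K : ZeroCycle f m} {ε t : ℂ}
    {z : Fin m → ℂ} (h : IsInfinitesimalSolution g K ε t z) (hε : ε ≠ 0)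
    (hdeg : (deform f g ε).natDegree = n) (hn : 0 < n) :
    ∃ (Z : Fin n → ℂ) (σ : {j // K.weight j ≠ 0} ↪ Fin n),
      RootTuple (deform f g ε) (deform f g ε).leadingCoeff t Z ∧ (∀ i, Z (σ i) = z i) ∧
        ∑ i : {j // K.weight j ≠ 0}, (K.weight i : ℂ) * g.eval (Z (σ i)) = 0 := by
  have h1 := mem_zeroTuples_of_isInfinitesimalSolution hε h
  obtain ⟨Z, σ, hZ, hσ⟩ := exists_rootTuple_extension hdeg hn h1.1 h.1.2
  refine ⟨Z, (Function.Embedding.subtype _).trans σ, hZ, fun i => hσ i, ?_⟩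
  rw [← h1.2.2]
  simp only [Function.Embedding.trans_apply, Function.Embedding.subtype_apply, hσ]
  exact sum_support_eq_integral K.weight g z

/-- Tangential solutions lie within radius `R < R₁`, and for small parameters no solution has its
largest point of nonzero weight on the circle of radius `R₁`. A solution with such a point outside
cannot be connected to a tangential one. -/
theorem hasAlienCycles_of_conditions {f g : ℂ[X]} {m n : ℕ} (hf : f.natDegree = m) (hm : 0 < m)
    (hg : g.natDegree = n) (hmn : m < n) (K : ZeroCycle f m) (hK : ∃ j, K.weight j ≠ 0)
    (hM : IsMorse f m)
    (hB : ∀ (T : ℂ) (v : Fin m → ℂ), RootTuple (C f.leadingCoeff * X ^ m) f.leadingCoeff T v →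
      v ≠ 0 → ∑ j, (K.weight j : ℂ) * v j ^ n ≠ 0)
    (hMev : ∀ᶠ ε in 𝓝[≠] (0 : ℂ), IsMorse (deform f g ε) n)
    (hncz : ∀ᶠ ε in 𝓝[≠] (0 : ℂ), NoCriticalZero (deform f g ε) g
      (fun i : {j // K.weight j ≠ 0} => K.weight i) n)
    (hdegP : ∀ᶠ ε in 𝓝[≠] (0 : ℂ), ∃ (P : ℂ[X]) (c : ℂ), c ≠ 0 ∧
      n * (m - 1).factorial < P.natDegree ∧ ∀ (t : ℂ) (Z : Fin n → ℂ),
        RootTuple (deform f g ε) (deform f g ε).leadingCoeff t Z →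
          P.eval t = c * ∏ σ : {j // K.weight j ≠ 0} ↪ Fin n,
            ∑ i : {j // K.weight j ≠ 0}, (K.weight i : ℂ) * g.eval (Z (σ i))) :
    HasAlienCycles g K := by
  have hn : 0 < n := by omega
  have hla : f.leadingCoeff ≠ 0 := leadingCoeff_ne_zero_of_natDegree (hf ▸ hm)
  have hcoeff : f.coeff m = f.leadingCoeff := by rw [leadingCoeff, hf]
  have hne : Nonempty {j // K.weight j ≠ 0} := let ⟨j, hj⟩ := hK; ⟨⟨j, hj⟩⟩
  obtain ⟨R, hR⟩ := exists_bound_of_sum_pow_ne_zero (P := fun _ : Unit => f) (l := pure ())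
    (polyTendsto_const hf.le) hg (fun h => by rw [h, natDegree_zero] at hg; omega)
    (w := K.weight) (by rw [hcoeff]; exact hB)
  rw [eventually_pure, hcoeff] at hR
  have hRσ : ∀ (t : ℂ) (Z : Fin m → ℂ), RootTuple f f.leadingCoeff t Z →
      ∀ σ : {j // K.weight j ≠ 0} ↪ Fin m,
        ∑ i : {j // K.weight j ≠ 0}, (K.weight i : ℂ) * g.eval (Z (σ i)) = 0 → ∀ j, ‖Z j‖ ≤ R := by
    intro t Z hZ σ hσ j
    obtain ⟨σ', hσ'⟩ := exists_embedding_extension le_rfl σ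
    set e : Equiv.Perm (Fin m) :=
      Equiv.ofBijective σ' (Finite.injective_iff_bijective.1 σ'.injective)
    have h1 := hR t (Z ∘ e) (hZ.comp_perm e) (by
      rw [← sum_support_eq_integral, ← hσ]
      refine Finset.sum_congr rfl fun i _ => ?_
      change _ * g.eval (Z (σ' i)) = _
      rw [hσ'])
    have h2 := (norm_le_pi_norm (Z ∘ e) (e.symm j)).trans h1
    rwa [Function.comp_apply, e.apply_symm_apply] at h2
  refine ⟨?_, ?_⟩
  · obtain ⟨x, hx, hxc⟩ := exists_regular_point hf hm R
    obtain ⟨Z, hZ⟩ := exists_rootTuple hf hm (f.eval x)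
    obtain ⟨i, hi⟩ := hZ.exists_index hla rfl
    have hZm := hZ.mem_regularTuples hla ((hZ.injective_iff hla).2 hxc)
    refine ⟨f.eval x, Z, ⟨hM.joinedIn hf hm K.base_mem hZm, hZ.eval_root⟩, fun h => ?_⟩
    have h1 := (norm_le_pi_norm Z i).trans (hR _ Z hZ (neg_eq_zero.1 h.2))
    rw [hi] at h1
    linarith
  set R₁ := max R 0 + 1 with hR₁
  have hRR : R < R₁ := (le_max_left R 0).trans_lt (lt_add_one _)
  have hR₁0 : 0 < R₁ := add_pos_of_nonneg_of_pos (le_max_right R 0) one_pos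
  have hκ : Fintype.card {j // K.weight j ≠ 0} ≤ m :=
    (Fintype.card_subtype_le _).trans (by simp)
  obtain ⟨r, hr, hrs⟩ := Metric.eventually_nhds_iff_ball.1
    (eventually_norm_lt_of_integral_eq_zero hf hm hmn.le hg.le
      (fun i : {j // K.weight j ≠ 0} => K.weight i) hRR hRσ)
  filter_upwards [self_mem_nhdsWithin, nhdsWithin_le_nhds (Metric.ball_mem_nhds (0 : ℂ) hr),
    eventually_exists_large_solution hf hm hg hmn hκ hRσ hdegP hncz R₁, hMev, hncz, hdegP,
    eventually_joinedIn_deformedTuples hf hm hg hmn K] with ε hε0 hεr hlarge hMε hnε hPε hj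
  have hdeg : ∀ e : ℂ, e ≠ 0 → (deform f g e).natDegree = n := fun e he =>
    (natDegree_deform_of_gt (by omega) he).trans hg
  have hlead : (deform f g ε).leadingCoeff ≠ 0 :=
    leadingCoeff_ne_zero_of_natDegree ((hdeg ε hε0).symm ▸ hn)
  obtain ⟨t, Z, hZ, σ, hσ, i₀, hi₀⟩ := hlarge
  have hZi : Function.Injective Z := by
    by_contra h
    exact hnε t Z hZ h σ hσ
  obtain ⟨σ', hσ'⟩ := exists_embedding_extension hmn.le σ
  set z : Fin m → ℂ := fun j => Z (σ' j) with hz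
  have hzi : Function.Injective z := hZi.comp σ'.injective
  have hzt : ∀ j, (deform f g ε).eval (z j) = t := fun j => hZ.eval_root _
  have hsol : IsInfinitesimalSolution g K ε t z := by
    refine ⟨⟨hj hMε z ⟨hzi, t, (hZ.injective_iff hlead).1 hZi, hzt⟩, hzt⟩, ?_⟩
    have h1 := integral_deform_eq_zero K.sum_weight hzt
    have h2 : integral K.weight g z = 0 := by
      rw [← sum_support_eq_integral, ← hσ]
      exact Finset.sum_congr rfl fun i _ => by rw [hz, ← hσ']
    rwa [h2, mul_zero, add_zero] at h1
  refine ⟨t, z, hsol, ?_, ?_⟩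
  -- All displacement zeros, on every branch, are roots of the one polynomial `P`, so they are
  -- isolated.
  · obtain ⟨P, c, -, hPd, hP⟩ := hPε
    have hP0 : P ≠ 0 := by rintro rfl; simp at hPd
    have hsub : displacementZeros g K ε ⊆ P.roots.toFinset := by
      rintro s ⟨y, hy⟩
      obtain ⟨Y, υ, hY, -, hυ⟩ := hy.exists_rootTuple hε0 (hdeg ε hε0) hn
      have : P.eval s = 0 := by
        rw [hP s Y hY, Finset.prod_eq_zero (Finset.mem_univ υ) hυ, mul_zero]
      simp [hP0, this]
    have hfin : (displacementZeros g K ε \ {t}).Finite :=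
      (P.roots.toFinset.finite_toSet.subset hsub).sdiff
    rw [accPt_iff_frequently, not_frequently]
    filter_upwards [hfin.isClosed.isOpen_compl.mem_nhds (by simp)] with s hs h
    exact hs ⟨h.2, h.1⟩
  · rintro ⟨τ, Y, -, hYc, hYsol, hY0, -, hYdiv⟩
    -- The largest modulus among the points of nonzero weight along a supposed regular family. It
    -- would have to take the forbidden value `R₁`.
    set μ : ℝ → ℝ := fun s => ‖fun i : {j // K.weight j ≠ 0} => Y s i‖ with hμ
    have hμc : ContinuousOn μ (Set.Icc 0 1) := by
      refine ContinuousOn.norm (continuousOn_pi.2 fun i => ?_)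
      exact (continuous_apply i.1).comp_continuousOn hYc
    have hμ0 : μ 0 ≤ R₁ := by
      have h1 : Y 0 ∈ regularTuples f m := hY0.1.1.target_mem
      have h2 := rootTuple_of_injective hf hm h1.1 hY0.1.2
      have h3 := hR _ _ h2 (neg_eq_zero.1 hY0.2)
      refine (pi_norm_le_iff_of_nonneg hR₁0.le).2 fun i => ?_
      exact (norm_le_pi_norm (Y 0) i.1).trans (h3.trans hRR.le)
    have hμ1 : R₁ ≤ μ 1 := by
      obtain ⟨j, hj1, hj2⟩ := exists_eq_of_divisor_eq hzi hYdiv i₀.2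
      have h1 := norm_le_pi_norm (fun i : {j // K.weight j ≠ 0} => Y 1 i) ⟨j, hj1⟩
      simp only [hj2] at h1
      refine le_trans ?_ h1
      change R₁ ≤ ‖Z (σ' i₀)‖
      rw [hσ']
      exact hi₀.le
    obtain ⟨s, hs, hsμ⟩ := intermediate_value_Icc zero_le_one hμc ⟨hμ0, hμ1⟩
    have hs0 : s ≠ 0 := by
      rintro rfl
      have h1 : Y 0 ∈ regularTuples f m := hY0.1.1.target_mem
      have h2 := rootTuple_of_injective hf hm h1.1 hY0.1.2
      have h3 := hR _ _ h2 (neg_eq_zero.1 hY0.2)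
      refine absurd hsμ (ne_of_lt ((pi_norm_lt_iff hR₁0).2 fun i => ?_))
      exact (norm_le_pi_norm (Y 0) i.1).trans_lt (h3.trans_lt hRR)
    have hsε : (s : ℂ) * ε ≠ 0 := mul_ne_zero (Complex.ofReal_ne_zero.2 hs0) hε0
    obtain ⟨W, υ, hW, hWY, hυ⟩ := (hYsol s ⟨lt_of_le_of_ne hs.1 (Ne.symm hs0), hs.2⟩).exists_rootTuple
      hsε (hdeg _ hsε) hn
    have hball : (s : ℂ) * ε ∈ Metric.ball (0 : ℂ) r := by
      simp only [Metric.mem_ball, dist_zero_right] at hεr ⊢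
      rw [norm_mul, Complex.norm_real, Real.norm_eq_abs, abs_of_nonneg hs.1]
      exact (mul_le_of_le_one_left (norm_nonneg _) hs.2).trans_lt hεr
    have hle : ∀ i, ‖W (υ i)‖ ≤ R₁ := fun i => by
      rw [hWY]
      exact (norm_le_pi_norm (fun i : {j // K.weight j ≠ 0} => Y s i) i).trans hsμ.le
    have hlt := hrs _ hball _ _ W hW υ hle hυ
    refine absurd hsμ (ne_of_lt ((pi_norm_lt_iff hR₁0).2 fun i => ?_))
    rw [← hWY]
    exact hlt i

/-! ### Generic pairs have alien limit cycles if `deg g > deg f` -/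

/-- Asymmetric weights are pairwise distinct, so at most one is 0; applying `exists_ne_zero`
repeatedly gives three nonzero ones. -/
lemma Asymmetric.card_support {m : ℕ} {w : Fin m → ℤ} (h : Asymmetric w) (hm : 2 < m)
    (hw : ∑ j, w j = 0) : 3 ≤ Fintype.card {j // w j ≠ 0} ∧
      (Fintype.card {j // w j ≠ 0} = m ∨ Fintype.card {j // w j ≠ 0} + 1 = m) := by
  classical
  have hex := h.exists_ne_zero (by omega) hw
  constructor
  · obtain ⟨a, -, -, ha⟩ := hex ⟨0, by omega⟩ ⟨0, by omega⟩
    obtain ⟨b, hba, -, hb⟩ := hex a a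
    obtain ⟨c, hca, hcb, hc⟩ := hex a b
    rw [Fintype.card_subtype]
    exact Finset.two_lt_card.2 ⟨a, by simpa, b, by simpa, c, by simpa, hba.symm, hca.symm, hcb.symm⟩
  · have h1 : Fintype.card {j // ¬ w j ≠ 0} ≤ 1 :=
      Fintype.card_le_one_iff.2 fun i j => Subtype.ext (h.injective (by
        rw [not_not.1 i.2, not_not.1 j.2]))
    have h2 := Fintype.card_subtype_compl (fun j => w j ≠ 0)
    have h3 := Fintype.card_subtype_le (fun j => w j ≠ 0)
    rw [Fintype.card_fin] at h2 h3
    omega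

theorem generic_hasAlienCycles {m n : ℕ} (hm : 2 < m) (hmn : m < n) (hd : ¬ m ∣ n)
    {w : Fin m → ℤ} (hw : ∑ j, w j = 0) (hA : Asymmetric w) :
    Generic fun x : PolySpace m × PolySpace n =>
      RegularAtInfinity x.1.poly x.2.poly w →
        ∀ K : ZeroCycle x.1.poly m, K.weight = w → HasAlienCycles x.2.poly K := by
  classical
  obtain ⟨hcard3, hcard⟩ := hA.card_support hm hw
  have hex := hA.exists_ne_zero (by omega) hw
  obtain ⟨j₁, -, -, hj₁⟩ := hex ⟨0, by omega⟩ ⟨0, by omega⟩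
  have : Nonempty {j // w j ≠ 0} := ⟨⟨j₁, hj₁⟩⟩
  set ω : {j // w j ≠ 0} → ℤ := fun i => w i with hω
  have hω0 : ∀ i, ω i ≠ 0 := fun i => i.2
  have hω3 : ∀ i j, ∃ k, k ≠ i ∧ k ≠ j ∧ ω k ≠ 0 := fun i j => by
    obtain ⟨k, h1, h2, h3⟩ := hex i.1 j.1
    exact ⟨⟨k, h3⟩, fun h => h1 (congrArg Subtype.val h), fun h => h2 (congrArg Subtype.val h), h3⟩
  have hωs : ∑ i, ω i = 0 := by
    have h1 := sum_support_eq_integral w 1 0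
    simp only [integral, eval_one, mul_one] at h1
    rw [← Int.cast_sum, ← Int.cast_sum, hw, Int.cast_inj] at h1
    exact h1
  have hmax : max m n = n := max_eq_right hmn.le
  refine (((generic_isMorse_fst n (by omega : 1 < m)).and
    (generic_eventually_isMorse (by omega : m ≠ n) (by omega))).and
    ((generic_eventually_noCriticalZero hω3 hωs (by omega) (by omega) (by omega : m ≠ n)).and
      (generic_lt_natDegree hω0 hωs hm hmn hcard3 hcard))).mono ?_
  rintro x ⟨⟨h1, h2⟩, h3, h4⟩ hR K rfl
  rw [hmax] at h2 h3
  refine hasAlienCycles_of_conditions (natDegree_poly x.1) (by omega) (natDegree_poly x.2) hmn K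
    ⟨j₁, hj₁⟩ h1 (fun T v hv hv0 => hR.sum_pow_ne_zero (natDegree_poly x.1) (by omega)
      (natDegree_poly x.2) (by omega) hd hj₁ hv hv0) h2 h3 ?_
  filter_upwards [h4, self_mem_nhdsWithin] with ε hε hε0
  obtain ⟨P, c, hc, hPd, hP⟩ := hε
  -- Each integral of `f` is `-ε` times the integral of `g`, which gives one factor `-ε` per
  -- injection.
  refine ⟨P, c * (-ε) ^ Fintype.card ({j // K.weight j ≠ 0} ↪ Fin n),
    mul_ne_zero hc (pow_ne_zero _ (neg_ne_zero.2 hε0)), hPd, fun t Z hZ => ?_⟩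
  rw [hP t Z hZ, mul_assoc, ← Finset.card_univ, ← Finset.prod_const, ← Finset.prod_mul_distrib]
  congr 1
  refine Finset.prod_congr rfl fun σ _ => ?_
  have h5 : ∑ i : {j // K.weight j ≠ 0}, (ω i : ℂ) * (deform x.1.poly x.2.poly ε).eval (Z (σ i)) = 0 := by
    simp only [hZ.eval_root]
    rw [← Finset.sum_mul, ← Int.cast_sum, hωs, Int.cast_zero, zero_mul]
  simp only [eval_deform, mul_add, Finset.sum_add_distrib] at h5
  rw [eq_neg_of_add_eq_zero_left h5, ← Finset.sum_neg_distrib, Finset.mul_sum]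
  refine Finset.sum_congr rfl fun i _ => ?_
  ring

end ZeroCycles

theorem theoremC :
    (∀ m n : ℕ, 2 < m → n < m →
      ∀ w : Fin m → ℤ, ∑ j, w j = 0 → ZeroCycles.Asymmetric w →
        ZeroCycles.Generic fun x : ZeroCycles.PolySpace m × ZeroCycles.PolySpace n =>
          ZeroCycles.RegularAtInfinity x.1.poly x.2.poly w →
            ∀ K : ZeroCycles.ZeroCycle x.1.poly m, K.weight = w →
              ZeroCycles.NoAlienCycles x.2.poly K) ∧
    (∀ m n : ℕ, 2 < m → m < n → ¬ m ∣ n →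
      ∀ w : Fin m → ℤ, ∑ j, w j = 0 → ZeroCycles.Asymmetric w →
        ZeroCycles.Generic fun x : ZeroCycles.PolySpace m × ZeroCycles.PolySpace n =>
          ZeroCycles.RegularAtInfinity x.1.poly x.2.poly w →
            ∀ K : ZeroCycles.ZeroCycle x.1.poly m, K.weight = w →
              ZeroCycles.HasAlienCycles x.2.poly K) ∧
    (∀ n : ℕ, ∀ f : Polynomial ℂ, f.natDegree = 2 →
      ∀ w : Fin 2 → ℤ, ∑ j, w j = 0 →
        ZeroCycles.Generic fun b : ZeroCycles.PolySpace n =>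
          ZeroCycles.RegularAtInfinity f b.poly w →
            ∀ K : ZeroCycles.ZeroCycle f 2, K.weight = w →
              ZeroCycles.NoAlienCycles b.poly K) := by
  exact ⟨fun m n hm hnm w hw hA => ZeroCycles.generic_noAlienCycles hm hnm hw hA,
    fun m n hm hmn hd w hw hA => ZeroCycles.generic_hasAlienCycles hm hmn hd hw hA,
    fun n f hf w _ => ZeroCycles.Generic.of_forall
      fun b _ K _ => ZeroCycles.noAlienCycles_of_natDegree_two hf K⟩
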